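/- Fix $m\ge 1$ colors. Let $L_i(n)\ge 0$ be the quantity of color $i$ ($1\le i\le m$) in an urn after $n\ge 0$ steps, and put $C(n)=\sum_{i=1}^m L_i(n)$ and $P_i(n)=L_i(n)/C(n)$. Initially, $C(0)^2\sim\mathrm{Gamma}(\frac{m+1}{2},\frac12)$ (shape, rate) and $(P_1(0),\dots,P_m(0))\sim\mathrm{Dirichlet}(1,\dots,1)$, independently of each other. At step $n+1$, given everything so far, a color $I(n+1)$ is chosen so that $I(n+1)=i$ with conditional probability $P_i(n)$; then, given in addition $I(n+1)$, a positive random quantity $A(n+1)$ is sampled whose conditional density, on the event $C(n)=c$, is $(a+c)\exp\big(-\frac12(a+c)^2+\frac12c^2\big)$, $a>0$ (the time until the next point of an inhomogeneous Poisson process of rate $t$ at time $t$, given a point at $c$). Finally $L_{I(n+1)}(n+1)=L_{I(n+1)}(n)+A(n+1)$ and $L_j(n+1)=L_j(n)$ for $j\ne I(n+1)$. Then there is a random vector $P=(P_1,\dots,P_m)\sim\mathrm{Dirichlet}(\frac12,\dots,\frac12)$ such that $(P_1(n),\dots,P_m(n))\to(P_1,\dots,P_m)$ almost surely as $n\to\infty$.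 Conditional on $P$, the indices $I(1),I(2),\dots$ are independent and identically distributed with $\mathbb P(I(1)=i\mid P)=P_i$ for $1\le i\le m$. Almost surely every color is chosen infinitely often. Finally, conditional on $P$, for each $1\le i\le m$ the sequence of additions to color $i$ (the initial quantity $L_i(0)$, followed by the quantities $A(n)$ at the successive steps $n$ with $I(n)=i$) is distributed as the sequence of inter-jump times (the first one measured from time $0$) of an inhomogeneous Poisson process on $[0,\infty)$ with rate $t$ at time $t$, multiplied by $\sqrt{P_i}$, and these sequences are conditionally independent for distinct $i$. -/

import Mathlib

open MeasureTheory ProbabilityTheory Filter Topology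

noncomputable section

namespace ContinuousUrn

/-- The point `(x_0, …, x_{d-1}, 1 - x_0 - ⋯ - x_{d-1})` of the hyperplane `∑ y_j = 1`. -/
def simplexPoint {d : ℕ} (x : Fin d → ℝ) : Fin (d + 1) → ℝ :=
  Fin.snoc (α := fun _ => ℝ) x (1 - ∑ j, x j)

/-- The Dirichlet distribution with parameters `α` on the open simplex in `ℝ^(d+1)`, given by its
density in the first `d` coordinates with respect to `d`-dimensional Lebesgue measure. -/
def dirichletMeasure {d : ℕ} (α : Fin (d + 1) → ℝ) : Measure (Fin (d + 1) → ℝ) :=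
  ((volume : Measure (Fin d → ℝ)).withDensity
    ({x : Fin d → ℝ | ∀ j, 0 < simplexPoint x j}.indicator fun x =>
      ENNReal.ofReal (Real.Gamma (∑ j, α j) / (∏ j, Real.Gamma (α j)) *
        ∏ j, simplexPoint x j ^ (α j - 1)))).map simplexPoint

/-- The law on `(0, ∞)` with density `(a + c) exp (-(a + c)² / 2 + c² / 2)`, for `c ≥ 0`. -/
def gapMeasure (c : ℝ) : Measure ℝ :=
  (volume.restrict (Set.Ioi 0)).withDensity fun a =>
    ENNReal.ofReal ((a + c) * Real.exp (-(1 / 2) * (a + c) ^ 2 + (1 / 2) * c ^ 2))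

section Conditioning

variable {Ω 𝓧 𝓨 ι : Type*} [MeasurableSpace Ω] [MeasurableSpace 𝓧] [MeasurableSpace 𝓨]

/-- Conditionally on `X`, the random variable `Y` has the (random) law `ν`. -/
def HasCondLaw (Y : Ω → 𝓨) (X : Ω → 𝓧) (ν : Ω → Measure 𝓨) (μ : Measure Ω) : Prop :=
  ∀ B : Set 𝓨, MeasurableSet B →
    μ⟦Y ⁻¹' B | MeasurableSpace.comap X inferInstance⟧ =ᵐ[μ] fun ω => (ν ω).real B

/-- The family `Y` is conditionally independent given `X`. -/
def CondIndepFamily (Y : ι → Ω → 𝓨) (X : Ω → 𝓧) (μ : Measure Ω) : Prop :=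
  ∀ (S : Finset ι) (B : ι → Set 𝓨), (∀ i, MeasurableSet (B i)) →
    μ⟦⋂ i ∈ S, Y i ⁻¹' B i | MeasurableSpace.comap X inferInstance⟧ =ᵐ[μ]
      fun ω => ∏ i ∈ S, (μ⟦Y i ⁻¹' B i | MeasurableSpace.comap X inferInstance⟧) ω

end Conditioning

/-- The `k`-th jump time (`k ≥ 0`) of the point process with successive inter-jump times `x`;
the first one, `x 0`, is measured from time `0`. -/
def jumpTime (x : ℕ → ℝ) (k : ℕ) : ℝ := ∑ j ∈ Finset.range (k + 1), x j

/-- The number of jumps in `(s, t]` of the point process with inter-jump times `x`. -/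
def jumpCount (s t : ℝ) (x : ℕ → ℝ) : ℕ :=
  {k : ℕ | jumpTime x k ∈ Set.Ioc s t}.ncard

/-- `ν` is the law of the sequence of inter-jump times of an inhomogeneous Poisson process on
`[0, ∞)` of instantaneous rate `rate t` at time `t`: the jump times are positive, strictly
increasing and locally finite, the number of jumps in `(s, t]` is Poisson with mean
`∫ u in s..t, rate u`, and the numbers of jumps in successive intervals are independent. -/
structure IsPoissonInterJumpLaw (rate : ℝ → ℝ) (ν : Measure (ℕ → ℝ)) : Prop where
  isProbabilityMeasure : IsProbabilityMeasure ν
  pos : ∀ᵐ x ∂ν, ∀ k, 0 < x k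
  tendsto_jumpTime : ∀ᵐ x ∂ν, Tendsto (jumpTime x) atTop atTop
  hasLaw_jumpCount : ∀ s t : ℝ, 0 ≤ s → s ≤ t →
    HasLaw (jumpCount s t) (poissonMeasure (∫ u in s..t, rate u).toNNReal) ν
  indep_jumpCount : ∀ t : ℕ → ℝ, 0 ≤ t 0 → Monotone t →
    iIndepFun (fun k => jumpCount (t k) (t (k + 1))) ν

section Urn

variable {Ω : Type*} {d : ℕ}

/-- The total quantity `C(n)` in the urn. -/
def total (L : ℕ → Ω → Fin (d + 1) → ℝ) (n : ℕ) (ω : Ω) : ℝ := ∑ i, L n ω i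

/-- The vector of proportions of the colors at step `n`. -/
def proportion (L : ℕ → Ω → Fin (d + 1) → ℝ) (n : ℕ) (ω : Ω) : Fin (d + 1) → ℝ :=
  fun i => L n ω i / total L n ω

/-- The history up to step `n`: the initial quantities, and the first `n` choices and additions. -/
def past (L : ℕ → Ω → Fin (d + 1) → ℝ) (I : ℕ → Ω → Fin (d + 1)) (A : ℕ → Ω → ℝ) (n : ℕ)
    (ω : Ω) : (Fin (d + 1) → ℝ) × (Fin n → Fin (d + 1) × ℝ) :=
  (L 0 ω, fun k => (I k ω, A k ω))

/-- The continuous urn with `d + 1` colors. `L n ω i` is the quantity of color `i` after `n` steps;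
`I n` is the color chosen and `A n` the quantity added at step `n + 1`. -/
structure IsContinuousUrn [MeasurableSpace Ω] (L : ℕ → Ω → Fin (d + 1) → ℝ)
    (I : ℕ → Ω → Fin (d + 1)) (A : ℕ → Ω → ℝ) (μ : Measure Ω) : Prop where
  measurable_initial : Measurable (L 0)
  measurable_index : ∀ n, Measurable (I n)
  measurable_addition : ∀ n, Measurable (A n)
  initial_nonneg : ∀ᵐ ω ∂μ, ∀ i, 0 ≤ L 0 ω i
  /-- With `m = d + 1` colors, `C(0)² ∼ Gamma((m + 1) / 2, 1 / 2)`. -/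
  hasLaw_total_sq : HasLaw (fun ω => total L 0 ω ^ 2)
    (gammaMeasure ((((d + 1 : ℕ) : ℝ) + 1) / 2) (1 / 2)) μ
  hasLaw_proportion : HasLaw (proportion L 0) (dirichletMeasure fun _ => 1) μ
  indep_initial : IndepFun (total L 0) (proportion L 0) μ
  /-- Given the past, color `i` is chosen with probability equal to its current proportion. -/
  index_cond : ∀ n i, μ⟦I n ⁻¹' {i} | MeasurableSpace.comap (past L I A n) inferInstance⟧ =ᵐ[μ]
    fun ω => proportion L n ω i
  /-- Given the past and the chosen color, the law of the addition depends on `C(n)` only. -/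
  addition_cond : ∀ n, HasCondLaw (A n) (fun ω => (past L I A n ω, I n ω))
    (fun ω => gapMeasure (total L n ω)) μ
  succ_eq : ∀ n ω, L (n + 1) ω =
    Function.update (L n ω) (I n ω) (L n ω (I n ω) + A n ω)

/-- The sequence of additions to color `i`: first its initial quantity, then the quantities added
at the successive steps at which color `i` is chosen. -/
def colorAdditions (L : ℕ → Ω → Fin (d + 1) → ℝ) (I : ℕ → Ω → Fin (d + 1)) (A : ℕ → Ω → ℝ)
    (i : Fin (d + 1)) (ω : Ω) : ℕ → ℝ
  | 0 => L 0 ω i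
  | k + 1 => A (Nat.nth (fun n => I n ω = i) k) ω

end Urn

end ContinuousUrn

end

/-!
The urn is a mixture. Draw `p` from `Dirichlet(1/2, …, 1/2)`; given `p`, choose colors independently
with law `p` and let color `i` read an exponential clock of its own, holding `√(2 * p i * t)` when
its clock shows `t`. In this mixture, the posterior density of `p` given the quantities `l` is
`∏ i, h (l i) (p i) / h (∑ i, l i) 1`, where `h a` is the density of the time at which a Brownian
motion first hits the level `a`. It integrates to one because hitting times are additive in the
level, and since `h c 1` is proportional to `c * exp (-c ^ 2 / 2)`, averaging the transition given
`p` over the posterior is exactly the transition of the urn. Hence the mixture and the urn have the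
same law on paths. The law of large numbers recovers `p` from the path, so conditioning the urn on
its limiting proportions returns the independent choices and clocks.
-/

noncomputable section

namespace ContinuousUrn

open scoped ENNReal

/-! ### Hitting-time densities -/

/-- The density at time `t` of the first hitting time of level `a` by a Brownian motion started
at `0`; it is the building block of the posterior law of the limiting proportions. -/
def hittingDensity (a t : ℝ) : ℝ :=
  if 0 < t then a / √(2 * Real.pi) / (t * √t) * Real.exp (-(a ^ 2 / (2 * t))) else 0

lemma hittingDensity_of_pos {t : ℝ} (ht : 0 < t) (a : ℝ) :
    hittingDensity a t = a / √(2 * Real.pi) / (t * √t) * Real.exp (-(a ^ 2 / (2 * t))) :=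
  if_pos ht

lemma hittingDensity_of_nonpos {t : ℝ} (ht : t ≤ 0) (a : ℝ) : hittingDensity a t = 0 :=
  if_neg ht.not_gt

lemma hittingDensity_nonneg {a : ℝ} (ha : 0 ≤ a) (t : ℝ) : 0 ≤ hittingDensity a t := by
  unfold hittingDensity
  split_ifs with h <;> positivity

lemma hittingDensity_pos {a t : ℝ} (ha : 0 < a) (ht : 0 < t) : 0 < hittingDensity a t := by
  rw [hittingDensity_of_pos ht]
  positivity

@[fun_prop]
lemma measurable_hittingDensity_uncurry : Measurable fun x : ℝ × ℝ => hittingDensity x.1 x.2 := by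
  unfold hittingDensity
  exact Measurable.ite (measurableSet_lt measurable_const measurable_snd) (by fun_prop)
    measurable_const

lemma measurable_hittingDensity {α : Type*} [MeasurableSpace α] {f g : α → ℝ} (hf : Measurable f)
    (hg : Measurable g) : Measurable fun x => hittingDensity (f x) (g x) :=
  measurable_hittingDensity_uncurry.comp (hf.prodMk hg)

lemma lintegral_exp_neg_sq_div_two :
    ∫⁻ x : ℝ, ENNReal.ofReal (Real.exp (-(x ^ 2 / 2))) = ENNReal.ofReal √(2 * Real.pi) := by
  have hexp : ∀ x : ℝ, -(x ^ 2 / 2) = -(1 / 2) * x ^ 2 := fun x => by ring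
  simp_rw [hexp]
  rw [← ofReal_integral_eq_lintegral_ofReal (integrable_exp_neg_mul_sq (by norm_num))
    (ae_of_all _ fun x => (Real.exp_pos _).le), integral_gaussian]
  congr 2
  ring

section CauchySchloemilch

variable {α β : ℝ}

lemma image_sub_div_Ioi (hα : 0 < α) (hβ : 0 < β) :
    (fun v : ℝ => β * v - α / v) '' Set.Ioi 0 = Set.univ := by
  refine Set.eq_univ_of_forall fun y => ?_
  have hs : |y| < √(y ^ 2 + 4 * α * β) := by
    rw [← Real.sqrt_sq_eq_abs]
    exact Real.sqrt_lt_sqrt (sq_nonneg y) (by nlinarith [mul_pos hα hβ])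
  have hsq : √(y ^ 2 + 4 * α * β) ^ 2 = y ^ 2 + 4 * α * β := Real.sq_sqrt (by positivity)
  set r := √(y ^ 2 + 4 * α * β)
  have hpos : 0 < y + r := by linarith [neg_abs_le y]
  refine ⟨(y + r) / (2 * β), div_pos hpos (by positivity), ?_⟩
  simp only
  have : y + r ≠ 0 := hpos.ne'
  field_simp
  nlinarith

lemma lintegral_add_mul_exp_sub_div (hα : 0 < α) (hβ : 0 < β) :
    ∫⁻ v in Set.Ioi (0 : ℝ), ENNReal.ofReal (β + α / v ^ 2) *
      ENNReal.ofReal (Real.exp (-((β * v - α / v) ^ 2 / 2))) = ENNReal.ofReal √(2 * Real.pi) := by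
  rw [← lintegral_exp_neg_sq_div_two, ← setLIntegral_univ (μ := volume)
    (fun x : ℝ => ENNReal.ofReal (Real.exp (-(x ^ 2 / 2)))), ← image_sub_div_Ioi hα hβ,
    lintegral_image_eq_lintegral_deriv_mul_of_monotoneOn (f' := fun v => β + α / v ^ 2)
      measurableSet_Ioi]
  · intro v hv
    have hv' : v ≠ 0 := (Set.mem_Ioi.1 hv).ne'
    have h := ((hasDerivAt_id v).const_mul β).sub ((hasDerivAt_inv hv').const_mul α)
    refine (h.congr_deriv ?_).hasDerivWithinAt
    simp [div_eq_mul_inv]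
  · intro v hv w _ hvw
    have : α / w ≤ α / v := div_le_div_of_nonneg_left hα.le hv hvw
    have : β * v ≤ β * w := by gcongr
    simp only
    linarith

lemma image_const_div_Ioi {γ : ℝ} (hγ : 0 < γ) :
    (fun v : ℝ => γ / v) '' Set.Ioi 0 = Set.Ioi 0 := by
  ext y
  constructor
  · rintro ⟨v, hv, rfl⟩
    exact div_pos hγ hv
  · intro hy
    exact ⟨γ / y, div_pos hγ hy, div_div_cancel₀ hγ.ne'⟩

/-- The substitution `v ↦ α / (β v)` changes the sign of `β v - α / v`. -/
lemma lintegral_exp_sub_div_inversion (hα : 0 < α) (hβ : 0 < β) :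
    ∫⁻ v in Set.Ioi (0 : ℝ), ENNReal.ofReal (Real.exp (-((β * v - α / v) ^ 2 / 2))) =
      ENNReal.ofReal (α / β) * ∫⁻ v in Set.Ioi (0 : ℝ), ENNReal.ofReal (1 / v ^ 2) *
        ENNReal.ofReal (Real.exp (-((β * v - α / v) ^ 2 / 2))) := by
  have hγ : 0 < α / β := div_pos hα hβ
  conv_lhs => rw [← image_const_div_Ioi hγ]
  rw [← lintegral_const_mul _ (by fun_prop),
    lintegral_image_eq_lintegral_deriv_mul_of_antitoneOn (f' := fun v => -(α / β / v ^ 2))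
      measurableSet_Ioi]
  · refine setLIntegral_congr_fun measurableSet_Ioi fun v hv => ?_
    have hv' : 0 < v := hv
    simp only [neg_neg]
    rw [← mul_assoc, ← ENNReal.ofReal_mul hγ.le, mul_one_div]
    congr 4
    field_simp
    ring
  · intro v hv
    have hv' : v ≠ 0 := (Set.mem_Ioi.1 hv).ne'
    refine (((hasDerivAt_inv hv').const_mul (α / β)).congr_deriv ?_).hasDerivWithinAt
    simp [div_eq_mul_inv]
  · intro v hv w _ hvw
    exact div_le_div_of_nonneg_left hγ.le hv hvw

lemma lintegral_inv_sq_mul_exp_sub_div (hα : 0 < α) (hβ : 0 < β) :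
    ∫⁻ v in Set.Ioi (0 : ℝ), ENNReal.ofReal (1 / v ^ 2) *
      ENNReal.ofReal (Real.exp (-((β * v - α / v) ^ 2 / 2))) =
      ENNReal.ofReal (√(2 * Real.pi) / (2 * α)) := by
  have hsum := lintegral_add_mul_exp_sub_div hα hβ
  have hsplit : ∀ v : ℝ, ENNReal.ofReal (β + α / v ^ 2) *
      ENNReal.ofReal (Real.exp (-((β * v - α / v) ^ 2 / 2))) =
      ENNReal.ofReal β * ENNReal.ofReal (Real.exp (-((β * v - α / v) ^ 2 / 2))) +
        ENNReal.ofReal α * (ENNReal.ofReal (1 / v ^ 2) *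
          ENNReal.ofReal (Real.exp (-((β * v - α / v) ^ 2 / 2)))) := fun v => by
    rw [ENNReal.ofReal_add hβ.le (by positivity), add_mul, ← mul_assoc (ENNReal.ofReal α),
      ← ENNReal.ofReal_mul hα.le, mul_one_div]
  simp_rw [hsplit] at hsum
  rw [lintegral_add_left (by fun_prop), lintegral_const_mul _ (by fun_prop),
    lintegral_const_mul _ (by fun_prop), lintegral_exp_sub_div_inversion hα hβ, ← mul_assoc,
    ← ENNReal.ofReal_mul hβ.le, mul_div_cancel₀ _ hβ.ne', ← two_mul, ← mul_assoc,
    ← ENNReal.ofReal_ofNat, ← ENNReal.ofReal_mul (by norm_num)] at hsum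
  rw [ENNReal.ofReal_div_of_pos (by positivity), ← hsum, mul_comm,
    ENNReal.mul_div_cancel_right (by simpa using hα) ENNReal.ofReal_ne_top]

lemma lintegral_exp_sub_div (hα : 0 < α) (hβ : 0 < β) :
    ∫⁻ v in Set.Ioi (0 : ℝ), ENNReal.ofReal (Real.exp (-((β * v - α / v) ^ 2 / 2))) =
      ENNReal.ofReal (√(2 * Real.pi) / (2 * β)) := by
  rw [lintegral_exp_sub_div_inversion hα hβ, lintegral_inv_sq_mul_exp_sub_div hα hβ,
    ← ENNReal.ofReal_mul (by positivity)]
  congr 1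
  field_simp

lemma lintegral_one_add_mul_exp_sub_div (hα : 0 < α) (hβ : 0 < β) :
    ∫⁻ v in Set.Ioi (0 : ℝ), ENNReal.ofReal (1 + 1 / v ^ 2) *
      ENNReal.ofReal (Real.exp (-((β * v - α / v) ^ 2 / 2))) =
      ENNReal.ofReal ((α + β) / (2 * α * β) * √(2 * Real.pi)) := by
  have hsplit : ∀ v : ℝ, ENNReal.ofReal (1 + 1 / v ^ 2) = 1 + ENNReal.ofReal (1 / v ^ 2) :=
    fun v => by rw [ENNReal.ofReal_add zero_le_one (by positivity), ENNReal.ofReal_one]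
  simp_rw [hsplit, add_mul, one_mul]
  rw [lintegral_add_left (by fun_prop), lintegral_exp_sub_div hα hβ,
    lintegral_inv_sq_mul_exp_sub_div hα hβ, ← ENNReal.ofReal_add (by positivity) (by positivity)]
  congr 1
  field_simp

end CauchySchloemilch

lemma image_mul_sq_div_Ioi {t : ℝ} (ht : 0 < t) :
    (fun v : ℝ => t * v ^ 2 / (1 + v ^ 2)) '' Set.Ioi 0 = Set.Ioo 0 t := by
  ext s
  constructor
  · rintro ⟨v, hv, rfl⟩
    have := Set.mem_Ioi.1 hv
    refine ⟨by positivity, ?_⟩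
    rw [div_lt_iff₀ (by positivity)]
    nlinarith
  · rintro ⟨hs_pos, hs_lt⟩
    have : 0 < t - s := by linarith
    refine ⟨√(s / (t - s)), Set.mem_Ioi.2 (by positivity), ?_⟩
    simp only
    rw [Real.sq_sqrt (by positivity)]
    field_simp
    ring

lemma setLIntegral_Ioo_eq_lintegral_mul_sq_div {t : ℝ} (ht : 0 < t) (F : ℝ → ℝ≥0∞) :
    ∫⁻ s in Set.Ioo 0 t, F s = ∫⁻ v in Set.Ioi (0 : ℝ),
      ENNReal.ofReal (t * (2 * v) / (1 + v ^ 2) ^ 2) * F (t * v ^ 2 / (1 + v ^ 2)) := by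
  rw [← image_mul_sq_div_Ioi ht, lintegral_image_eq_lintegral_deriv_mul_of_monotoneOn
    (f' := fun v => t * (2 * v) / (1 + v ^ 2) ^ 2) measurableSet_Ioi]
  · intro v _
    have hne : (1 : ℝ) + v ^ 2 ≠ 0 := by positivity
    have h := ((hasDerivAt_pow 2 v).const_mul t).div ((hasDerivAt_pow 2 v).const_add 1) hne
    refine (h.congr_deriv ?_).hasDerivWithinAt
    field_simp
    push_cast
    ring
  · intro v hv w _ hvw
    have hv' : 0 < v := hv
    simp only
    rw [div_le_div_iff₀ (by positivity) (by positivity)]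
    have : v ^ 2 ≤ w ^ 2 := by gcongr
    nlinarith

lemma hittingDensity_mul_eq_zero_of_notMem {s t : ℝ} (hs : s ∉ Set.Ioo 0 t) (a b : ℝ) :
    ENNReal.ofReal (hittingDensity a s) * ENNReal.ofReal (hittingDensity b (t - s)) = 0 := by
  rcases le_or_gt s 0 with h | h
  · simp [hittingDensity_of_nonpos h]
  · have : t - s ≤ 0 := sub_nonpos.2 (not_lt.1 fun hst => hs ⟨h, hst⟩)
    simp [hittingDensity_of_nonpos this]

lemma lintegral_hittingDensity_mul_eq_setLIntegral (a b t : ℝ) :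
    ∫⁻ s, ENNReal.ofReal (hittingDensity a s) * ENNReal.ofReal (hittingDensity b (t - s)) =
      ∫⁻ s in Set.Ioo 0 t,
        ENNReal.ofReal (hittingDensity a s) * ENNReal.ofReal (hittingDensity b (t - s)) :=
  (setLIntegral_eq_of_support_subset fun _ hs =>
    not_not.1 fun hmem => hs (hittingDensity_mul_eq_zero_of_notMem hmem a b)).symm

lemma sq_sub_div_add_eq {t v : ℝ} (ht : 0 < t) (hv : 0 < v) (a b : ℝ) :
    (a + b) ^ 2 / (2 * t) + (b / √t * v - a / √t / v) ^ 2 / 2 =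
      a ^ 2 / (2 * (t * v ^ 2 / (1 + v ^ 2))) + b ^ 2 / (2 * (t / (1 + v ^ 2))) := by
  have hsq : (b / √t * v - a / √t / v) ^ 2 = (b * v - a / v) ^ 2 / t := by
    rw [← Real.sq_sqrt ht.le, Real.sqrt_sq (Real.sqrt_nonneg t)]
    have := Real.sqrt_pos.2 ht
    field_simp
  rw [hsq]
  field_simp
  ring

/-- The left-hand side comes from the substitution `s = t v² / (1 + v²)` in the convolution of
`hittingDensity a` and `hittingDensity b`. -/
lemma hittingDensity_mul_comp_mul_sq_div {t v : ℝ} (ht : 0 < t) (hv : 0 < v) (a b : ℝ) :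
    t * (2 * v) / (1 + v ^ 2) ^ 2 * (hittingDensity a (t * v ^ 2 / (1 + v ^ 2)) *
        hittingDensity b (t - t * v ^ 2 / (1 + v ^ 2))) =
      a * b / Real.pi / t ^ 2 * Real.exp (-((a + b) ^ 2 / (2 * t))) *
        ((1 + 1 / v ^ 2) * Real.exp (-((b / √t * v - a / √t / v) ^ 2 / 2))) := by
  have hts : t - t * v ^ 2 / (1 + v ^ 2) = t / (1 + v ^ 2) := by field_simp; ring
  have hsqrt_left : √(t * v ^ 2 / (1 + v ^ 2)) = √t * v / √(1 + v ^ 2) := by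
    rw [Real.sqrt_div (by positivity), Real.sqrt_mul ht.le, Real.sqrt_sq hv.le]
  have hsqrt_right : √(t / (1 + v ^ 2)) = √t / √(1 + v ^ 2) := Real.sqrt_div ht.le _
  have hexp : Real.exp (-((a + b) ^ 2 / (2 * t))) *
      Real.exp (-((b / √t * v - a / √t / v) ^ 2 / 2)) =
      Real.exp (-(a ^ 2 / (2 * (t * v ^ 2 / (1 + v ^ 2))))) *
        Real.exp (-(b ^ 2 / (2 * (t / (1 + v ^ 2))))) := by
    rw [← Real.exp_add, ← Real.exp_add, ← neg_add, ← neg_add, sq_sub_div_add_eq ht hv]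
  have hfactor : t * (2 * v) / (1 + v ^ 2) ^ 2 *
      (a / √(2 * Real.pi) / (t * v ^ 2 / (1 + v ^ 2) * (√t * v / √(1 + v ^ 2)))) *
      (b / √(2 * Real.pi) / (t / (1 + v ^ 2) * (√t / √(1 + v ^ 2)))) =
      a * b / Real.pi / t ^ 2 * (1 + 1 / v ^ 2) := by
    have hw : √(1 + v ^ 2) ^ 2 = 1 + v ^ 2 := Real.sq_sqrt (by positivity)
    have hq : √(2 * Real.pi) ^ 2 = 2 * Real.pi := Real.sq_sqrt (by positivity)
    have hr : √t ^ 2 = t := Real.sq_sqrt ht.le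
    have : 0 < √(1 + v ^ 2) := by positivity
    field_simp
    rw [hw, hq, hr]
    ring
  rw [hts, hittingDensity_of_pos (by positivity), hittingDensity_of_pos (by positivity),
    hsqrt_left, hsqrt_right]
  linear_combination hfactor * (Real.exp (-(a ^ 2 / (2 * (t * v ^ 2 / (1 + v ^ 2))))) *
    Real.exp (-(b ^ 2 / (2 * (t / (1 + v ^ 2)))))) -
    a * b / Real.pi / t ^ 2 * (1 + 1 / v ^ 2) * hexp

/-- Hitting times of successive levels are independent, so their densities convolve. -/
lemma lintegral_hittingDensity_mul {a b : ℝ} (ha : 0 < a) (hb : 0 < b) (t : ℝ) :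
    ∫⁻ s, ENNReal.ofReal (hittingDensity a s) * ENNReal.ofReal (hittingDensity b (t - s)) =
      ENNReal.ofReal (hittingDensity (a + b) t) := by
  rw [lintegral_hittingDensity_mul_eq_setLIntegral]
  rcases le_or_gt t 0 with ht | ht
  · simp [Set.Ioo_eq_empty_of_le ht, hittingDensity_of_nonpos ht]
  have hsubst : ∀ v ∈ Set.Ioi (0 : ℝ), ENNReal.ofReal (t * (2 * v) / (1 + v ^ 2) ^ 2) *
      (ENNReal.ofReal (hittingDensity a (t * v ^ 2 / (1 + v ^ 2))) *
        ENNReal.ofReal (hittingDensity b (t - t * v ^ 2 / (1 + v ^ 2)))) =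
      ENNReal.ofReal (a * b / Real.pi / t ^ 2 * Real.exp (-((a + b) ^ 2 / (2 * t)))) *
        (ENNReal.ofReal (1 + 1 / v ^ 2) *
          ENNReal.ofReal (Real.exp (-((b / √t * v - a / √t / v) ^ 2 / 2)))) := fun v hv => by
    have hv' : 0 < v := hv
    rw [← ENNReal.ofReal_mul (hittingDensity_nonneg ha.le _), ← ENNReal.ofReal_mul (by positivity),
      hittingDensity_mul_comp_mul_sq_div ht hv', ← ENNReal.ofReal_mul (by positivity),
      ← ENNReal.ofReal_mul (by positivity)]
  rw [setLIntegral_Ioo_eq_lintegral_mul_sq_div ht, setLIntegral_congr_fun measurableSet_Ioi hsubst,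
    lintegral_const_mul _ (by fun_prop),
    lintegral_one_add_mul_exp_sub_div (by positivity) (by positivity),
    ← ENNReal.ofReal_mul (by positivity), hittingDensity_of_pos ht]
  congr 1
  have hq : √(2 * Real.pi) ^ 2 = 2 * Real.pi := Real.sq_sqrt (by positivity)
  have hr : √t ^ 2 = t := Real.sq_sqrt ht.le
  have : 0 < √t := Real.sqrt_pos.2 ht
  field_simp
  rw [hr, mul_comm Real.pi 2, hq]
  ring

/-! ### Product measures with densities -/

section PiMeasure

variable {n : ℕ} {E : Fin n → Type*} [∀ i, MeasurableSpace (E i)] (ν : ∀ i, Measure (E i))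
  [∀ i, SigmaFinite (ν i)]

lemma lintegral_pi_fin_succ {E : Fin (n + 1) → Type*} [∀ i, MeasurableSpace (E i)]
    (ν : ∀ i, Measure (E i)) [∀ i, SigmaFinite (ν i)] {F : (∀ i, E i) → ℝ≥0∞}
    (hF : Measurable F) :
    ∫⁻ x, F x ∂(Measure.pi ν) =
      ∫⁻ a, ∫⁻ y, F (Fin.cons a y) ∂(Measure.pi fun i : Fin n => ν i.succ) ∂(ν 0) := by
  have h := (measurePreserving_piFinSuccAbove ν 0).symm
  rw [← h.lintegral_comp hF, lintegral_prod]
  swap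
  · exact (hF.comp h.measurable).aemeasurable
  exact lintegral_congr fun a => lintegral_congr fun y => congrArg F (Fin.insertNth_zero a y)

lemma lintegral_pi_prod {f : ∀ i, E i → ℝ≥0∞} (hf : ∀ i, Measurable (f i)) :
    ∫⁻ x, ∏ i, f i (x i) ∂(Measure.pi ν) = ∏ i, ∫⁻ a, f i a ∂(ν i) := by
  induction n with
  | zero => simp
  | succ n ih =>
    rw [lintegral_pi_fin_succ _ (by fun_prop)]
    simp only [Fin.prod_univ_succ, Fin.cons_zero, Fin.cons_succ]
    rw [← ih (fun i => ν i.succ) (fun i => hf i.succ), ← lintegral_mul_const _ (hf 0)]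
    refine lintegral_congr fun a => ?_
    rw [lintegral_const_mul _ (Finset.measurable_prod _ fun i _ => by
      have := hf i.succ; fun_prop)]

omit [∀ i, MeasurableSpace (E i)] in
lemma indicator_univ_pi_prod (s : ∀ i, Set (E i)) (f : ∀ i, E i → ℝ≥0∞) (x : ∀ i, E i) :
    (Set.univ.pi s).indicator (fun x => ∏ i, f i (x i)) x = ∏ i, (s i).indicator (f i) (x i) := by
  by_cases hx : x ∈ Set.univ.pi s
  · rw [Set.indicator_of_mem hx]
    exact Finset.prod_congr rfl fun i _ => (Set.indicator_of_mem (hx i trivial) _).symm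
  · rw [Set.indicator_of_notMem hx]
    simp only [Set.mem_univ_pi, not_forall] at hx
    obtain ⟨i, hi⟩ := hx
    exact (Finset.prod_eq_zero (Finset.mem_univ i) (Set.indicator_of_notMem hi _)).symm

lemma pi_withDensity {f : ∀ i, E i → ℝ≥0∞} (hf : ∀ i, Measurable (f i))
    [∀ i, SigmaFinite ((ν i).withDensity (f i))] :
    Measure.pi (fun i => (ν i).withDensity (f i)) =
      (Measure.pi ν).withDensity fun x => ∏ i, f i (x i) := by
  refine Measure.pi_eq fun s hs => ?_
  rw [withDensity_apply _ (.univ_pi hs), ← lintegral_indicator (.univ_pi hs)]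
  simp_rw [indicator_univ_pi_prod]
  rw [lintegral_pi_prod ν fun i => (hf i).indicator (hs i)]
  refine Finset.prod_congr rfl fun i _ => ?_
  rw [lintegral_indicator (hs i), withDensity_apply _ (hs i)]

end PiMeasure

/-! ### Exponential clocks -/

lemma lintegral_expMeasure_one {F : ℝ → ℝ≥0∞} (hF : Measurable F) :
    ∫⁻ y, F y ∂(expMeasure 1) = ∫⁻ y in Set.Ioi 0, ENNReal.ofReal (Real.exp (-y)) * F y := by
  have hpdf : expMeasure 1 = volume.withDensity (exponentialPDF 1) := rfl
  rw [hpdf, lintegral_withDensity_eq_lintegral_mul _ (by unfold exponentialPDF; fun_prop) hF,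
    setLIntegral_congr Ioi_ae_eq_Ici, ← lintegral_indicator measurableSet_Ici]
  refine lintegral_congr fun y => ?_
  by_cases hy : y ∈ Set.Ici (0 : ℝ)
  · rw [Set.indicator_of_mem hy, Pi.mul_apply, exponentialPDF_of_nonneg hy]
    simp only [one_mul]
  · rw [Set.indicator_of_notMem hy, Pi.mul_apply, exponentialPDF_of_neg (by simpa using hy),
      zero_mul]

instance : IsProbabilityMeasure (expMeasure 1) := isProbabilityMeasure_expMeasure one_pos

lemma expMeasure_one_eq_withDensity :
    expMeasure 1 = (volume.restrict (Set.Ioi 0)).withDensity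
      fun y => ENNReal.ofReal (Real.exp (-y)) := by
  refine Measure.ext_of_lintegral _ fun F hF => ?_
  rw [lintegral_expMeasure_one hF, lintegral_withDensity_eq_lintegral_mul _ (by fun_prop) hF]
  rfl

lemma ae_expMeasure_pos : ∀ᵐ y ∂(expMeasure 1), 0 < y := by
  rw [expMeasure_one_eq_withDensity]
  exact (withDensity_absolutelyContinuous _ _).ae_le (ae_restrict_mem measurableSet_Ioi)

/-- The law of the increment of the quantity `√(2 p y)` while the clock `y` runs for an exponential
time, starting from the quantity `l`: the amount by which a color of limiting proportion `p` grows
when it is chosen. -/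
def clockGap (p l : ℝ) : Measure ℝ := (expMeasure 1).map fun y => √(l ^ 2 + 2 * p * y) - l

instance (p l : ℝ) : IsProbabilityMeasure (clockGap p l) :=
  Measure.isProbabilityMeasure_map (by fun_prop)

lemma measurable_map_of_uncurry {α β γ : Type*} [MeasurableSpace α] [MeasurableSpace β]
    [MeasurableSpace γ] {ν : Measure β} [SFinite ν] {g : α → β → γ}
    (hg : Measurable (Function.uncurry g)) : Measurable fun x => ν.map (g x) := by
  refine Measure.measurable_of_measurable_coe _ fun s hs => ?_
  simp_rw [fun x => Measure.map_apply (μ := ν) (f := g x) (hg.comp measurable_prodMk_left) hs]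
  exact measurable_measure_prodMk_left (hg hs)

/-- The measures `clockGap p l` as a Markov kernel from the pairs `(p, l)`. -/
def clockGapKernel : Kernel (ℝ × ℝ) ℝ where
  toFun z := clockGap z.1 z.2
  measurable' := measurable_map_of_uncurry (by fun_prop)

instance : IsMarkovKernel clockGapKernel :=
  ⟨fun z => inferInstanceAs (IsProbabilityMeasure (clockGap z.1 z.2))⟩

lemma image_add_sq_sub_sq_div {p l : ℝ} (hp : 0 < p) (hl : 0 ≤ l) :
    (fun a : ℝ => ((a + l) ^ 2 - l ^ 2) / (2 * p)) '' Set.Ioi 0 = Set.Ioi 0 := by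
  ext y
  constructor
  · rintro ⟨a, ha : 0 < a, rfl⟩
    have : 0 < (a + l) ^ 2 - l ^ 2 := by nlinarith
    exact Set.mem_Ioi.2 (by positivity)
  · intro (hy : 0 < y)
    refine ⟨√(l ^ 2 + 2 * p * y) - l, Set.mem_Ioi.2 (sub_pos.2 (Real.lt_sqrt_of_sq_lt ?_)), ?_⟩
    · exact lt_add_of_pos_right _ (by positivity)
    · simp only [sub_add_cancel]
      rw [Real.sq_sqrt (by positivity)]
      field_simp
      ring

lemma lintegral_clockGap {p l : ℝ} (hp : 0 < p) (hl : 0 ≤ l) {F : ℝ → ℝ≥0∞} (hF : Measurable F) :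
    ∫⁻ a, F a ∂(clockGap p l) = ∫⁻ a in Set.Ioi 0, ENNReal.ofReal
      ((a + l) / p * Real.exp (-(((a + l) ^ 2 - l ^ 2) / (2 * p)))) * F a := by
  rw [clockGap, lintegral_map hF (by fun_prop), lintegral_expMeasure_one (by fun_prop)]
  conv_lhs => rw [← image_add_sq_sub_sq_div hp hl]
  rw [lintegral_image_eq_lintegral_deriv_mul_of_monotoneOn (f' := fun a => (a + l) / p)
    measurableSet_Ioi]
  · refine setLIntegral_congr_fun measurableSet_Ioi fun a (ha : 0 < a) => ?_
    have hsq : l ^ 2 + 2 * p * (((a + l) ^ 2 - l ^ 2) / (2 * p)) = (a + l) ^ 2 := by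
      field_simp
      ring
    rw [← mul_assoc, ← ENNReal.ofReal_mul (by positivity), hsq, Real.sqrt_sq (by positivity),
      add_sub_cancel_right]
  · intro a _
    have h := ((((hasDerivAt_id a).add_const l).pow 2).sub_const (l ^ 2)).div_const (2 * p)
    refine (h.congr_deriv ?_).hasDerivWithinAt
    simp only [id]
    field_simp
    norm_num
    ring
  · intro a (ha : 0 < a) b _ hab
    simp only
    gcongr

lemma clockGap_eq_withDensity {p l : ℝ} (hp : 0 < p) (hl : 0 ≤ l) :
    clockGap p l = (volume.restrict (Set.Ioi 0)).withDensity fun a => ENNReal.ofReal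
      ((a + l) / p * Real.exp (-(((a + l) ^ 2 - l ^ 2) / (2 * p)))) := by
  refine Measure.ext_of_lintegral _ fun F hF => ?_
  rw [lintegral_clockGap hp hl hF, lintegral_withDensity_eq_lintegral_mul _ (by fun_prop) hF]
  rfl

lemma gapMeasure_eq_clockGap {c : ℝ} (hc : 0 ≤ c) : gapMeasure c = clockGap 1 c := by
  rw [clockGap_eq_withDensity one_pos hc, gapMeasure]
  congr 1
  ext a
  congr 3 <;> ring

lemma ae_gapMeasure_pos (c : ℝ) : ∀ᵐ a ∂(gapMeasure c), 0 < a :=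
  (withDensity_absolutelyContinuous _ _).ae_le (ae_restrict_mem measurableSet_Ioi)

lemma lintegral_gapMeasure {c : ℝ} {F : ℝ → ℝ≥0∞} (hF : Measurable F) :
    ∫⁻ a, F a ∂(gapMeasure c) = ∫⁻ a in Set.Ioi 0, ENNReal.ofReal
      ((a + c) * Real.exp (-(1 / 2) * (a + c) ^ 2 + (1 / 2) * c ^ 2)) * F a := by
  rw [gapMeasure, lintegral_withDensity_eq_lintegral_mul _ (by fun_prop) hF]
  rfl

/-! ### Measures on the simplex -/

section Simplex

variable {d : ℕ}

lemma simplexPoint_last (x : Fin d → ℝ) : simplexPoint x (Fin.last d) = 1 - ∑ j, x j := by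
  simp [simplexPoint]

lemma simplexPoint_castSucc (x : Fin d → ℝ) (j : Fin d) : simplexPoint x j.castSucc = x j := by
  simp [simplexPoint]

lemma sum_simplexPoint (x : Fin d → ℝ) : ∑ i, simplexPoint x i = 1 := by
  simp [Fin.sum_univ_castSucc, simplexPoint_last, simplexPoint_castSucc]

lemma measurable_snoc :
    Measurable fun z : (Fin d → ℝ) × ℝ =>
      (Fin.snoc (α := fun _ => ℝ) z.1 z.2 : Fin (d + 1) → ℝ) := by
  refine measurable_pi_lambda _ fun i => Fin.lastCases ?_ (fun j => ?_) i
  · simp only [Fin.snoc_last]; fun_prop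
  · simp only [Fin.snoc_castSucc]; fun_prop

@[fun_prop]
lemma measurable_simplexPoint : Measurable (simplexPoint (d := d)) :=
  measurable_snoc.comp (measurable_id.prodMk (measurable_const.sub (by fun_prop)))

lemma measurableSet_pos {n : ℕ} : MeasurableSet {p : Fin n → ℝ | ∀ i, 0 < p i} := by
  simp only [Set.ofPred_forall]
  exact .iInter fun i => measurableSet_lt measurable_const (measurable_pi_apply i)

/-- Lebesgue measure on the hyperplane `∑ i, p i = 1`, in the first `d` coordinates; the reference
measure for densities on the simplex. -/
def hyperplaneMeasure (d : ℕ) : Measure (Fin (d + 1) → ℝ) :=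
  (volume : Measure (Fin d → ℝ)).map simplexPoint

instance : SFinite (hyperplaneMeasure d) := by
  unfold hyperplaneMeasure
  infer_instance

lemma lintegral_hyperplaneMeasure {F : (Fin (d + 1) → ℝ) → ℝ≥0∞} (hF : Measurable F) :
    ∫⁻ p, F p ∂(hyperplaneMeasure d) = ∫⁻ x : Fin d → ℝ, F (simplexPoint x) :=
  lintegral_map hF measurable_simplexPoint

lemma ae_hyperplaneMeasure_sum_eq_one : ∀ᵐ p ∂(hyperplaneMeasure d), ∑ i, p i = 1 := by
  refine (ae_map_iff measurable_simplexPoint.aemeasurable ?_).2 (ae_of_all _ sum_simplexPoint)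
  exact measurableSet_eq_fun (by fun_prop) measurable_const

/-- The density of the Dirichlet distribution with respect to `hyperplaneMeasure`. -/
def dirichletDensity (α : Fin (d + 1) → ℝ) : (Fin (d + 1) → ℝ) → ℝ≥0∞ :=
  {p | ∀ j, 0 < p j}.indicator fun p =>
    ENNReal.ofReal (Real.Gamma (∑ j, α j) / (∏ j, Real.Gamma (α j)) * ∏ j, p j ^ (α j - 1))

@[fun_prop]
lemma measurable_dirichletDensity (α : Fin (d + 1) → ℝ) : Measurable (dirichletDensity α) :=
  Measurable.indicator (by fun_prop) measurableSet_pos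

lemma dirichletDensity_eq_zero (α : Fin (d + 1) → ℝ) {p : Fin (d + 1) → ℝ}
    (hp : ¬ ∀ j, 0 < p j) : dirichletDensity α p = 0 :=
  Set.indicator_of_notMem (s := {p : Fin (d + 1) → ℝ | ∀ j, 0 < p j}) hp _

lemma dirichletDensity_of_pos (α : Fin (d + 1) → ℝ) {p : Fin (d + 1) → ℝ} (hp : ∀ j, 0 < p j) :
    dirichletDensity α p = ENNReal.ofReal
      (Real.Gamma (∑ j, α j) / (∏ j, Real.Gamma (α j)) * ∏ j, p j ^ (α j - 1)) :=
  Set.indicator_of_mem (s := {p : Fin (d + 1) → ℝ | ∀ j, 0 < p j}) hp _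

lemma dirichletMeasure_eq_withDensity (α : Fin (d + 1) → ℝ) :
    dirichletMeasure α = (hyperplaneMeasure d).withDensity (dirichletDensity α) := by
  ext s hs
  rw [dirichletMeasure, Measure.map_apply measurable_simplexPoint hs,
    withDensity_apply _ (measurable_simplexPoint hs), withDensity_apply _ hs, hyperplaneMeasure,
    setLIntegral_map hs (by fun_prop) measurable_simplexPoint]
  rfl

lemma ae_dirichletMeasure_pos (α : Fin (d + 1) → ℝ) :
    ∀ᵐ p ∂(dirichletMeasure α), (∀ i, 0 < p i) ∧ ∑ i, p i = 1 := by
  rw [dirichletMeasure_eq_withDensity, ae_withDensity_iff (by fun_prop)]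
  filter_upwards [ae_hyperplaneMeasure_sum_eq_one] with p hsum hp
  exact ⟨by_contra fun hpos => hp (dirichletDensity_eq_zero α hpos), hsum⟩

lemma lintegral_dirichletMeasure {α : Fin (d + 1) → ℝ} {F : (Fin (d + 1) → ℝ) → ℝ≥0∞}
    (hF : Measurable F) :
    ∫⁻ p, F p ∂(dirichletMeasure α) =
      ∫⁻ p, dirichletDensity α p * F p ∂(hyperplaneMeasure d) := by
  rw [dirichletMeasure_eq_withDensity, lintegral_withDensity_eq_lintegral_mul _ (by fun_prop) hF]
  rfl

end Simplex

/-! ### The posterior law of the limiting proportions -/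

section Posterior

variable {d : ℕ}

lemma lintegral_prod_hittingDensity {l : Fin (d + 1) → ℝ} (hl : ∀ i, 0 < l i) (t : ℝ) :
    ∫⁻ x : Fin d → ℝ, (∏ j : Fin d, ENNReal.ofReal (hittingDensity (l j.castSucc) (x j))) *
      ENNReal.ofReal (hittingDensity (l (Fin.last d)) (t - ∑ j, x j)) =
      ENNReal.ofReal (hittingDensity (∑ i, l i) t) := by
  induction d generalizing t with
  | zero => simp [volume_pi]
  | succ d ih =>
    have hcons : ∀ a : ℝ, ∫⁻ y : Fin d → ℝ, (∏ j : Fin (d + 1), ENNReal.ofReal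
        (hittingDensity (l j.castSucc) (Fin.cons (α := fun _ => ℝ) a y j))) *
        ENNReal.ofReal (hittingDensity (l (Fin.last (d + 1)))
          (t - ∑ j, Fin.cons (α := fun _ => ℝ) a y j)) =
        ENNReal.ofReal (hittingDensity (l 0) a) *
          ENNReal.ofReal (hittingDensity (∑ i : Fin (d + 1), l i.succ) (t - a)) := by
      intro a
      rw [← ih (l := fun i => l i.succ) (fun i => hl _), ← lintegral_const_mul _ (by fun_prop)]
      refine lintegral_congr fun y => ?_
      simp only [Fin.prod_univ_succ, Fin.sum_univ_succ, Fin.cons_zero, Fin.cons_succ, mul_assoc,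
        Fin.castSucc_zero, Fin.succ_castSucc, Fin.succ_last, sub_sub]
    rw [volume_pi, lintegral_pi_fin_succ _ (by fun_prop), ← volume_pi]
    simp_rw [hcons]
    rw [lintegral_hittingDensity_mul (hl 0) (Finset.sum_pos (fun i _ => hl _) (by simp)),
      Fin.sum_univ_succ l]

/-- The density of the law of the limiting proportions given the present quantities `l`, with
respect to `hyperplaneMeasure`. -/
def posteriorDensity (l p : Fin (d + 1) → ℝ) : ℝ≥0∞ :=
  ENNReal.ofReal ((∏ i, hittingDensity (l i) (p i)) / hittingDensity (∑ i, l i) 1)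

@[fun_prop]
lemma measurable_posteriorDensity {α : Type*} [MeasurableSpace α]
    {f g : α → Fin (d + 1) → ℝ} (hf : Measurable f) (hg : Measurable g) :
    Measurable fun x => posteriorDensity (f x) (g x) :=
  ((Finset.measurable_prod _ fun i _ => measurable_hittingDensity (by fun_prop)
    (by fun_prop)).div (measurable_hittingDensity (by fun_prop) measurable_const)).ennreal_ofReal

lemma posteriorDensity_eq_zero (l : Fin (d + 1) → ℝ) {p : Fin (d + 1) → ℝ}
    (hp : ¬ ∀ i, 0 < p i) : posteriorDensity l p = 0 := by
  push Not at hp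
  obtain ⟨i, hi⟩ := hp
  rw [posteriorDensity, Finset.prod_eq_zero (Finset.mem_univ i) (hittingDensity_of_nonpos hi _),
    zero_div, ENNReal.ofReal_zero]

/-- The law of the limiting proportions given that the present quantities are `l`. -/
def posterior (l : Fin (d + 1) → ℝ) : Measure (Fin (d + 1) → ℝ) :=
  (hyperplaneMeasure d).withDensity (posteriorDensity l)

lemma lintegral_posterior {l : Fin (d + 1) → ℝ} {F : (Fin (d + 1) → ℝ) → ℝ≥0∞}
    (hF : Measurable F) :
    ∫⁻ p, F p ∂(posterior l) = ∫⁻ p, posteriorDensity l p * F p ∂(hyperplaneMeasure d) := by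
  rw [posterior, lintegral_withDensity_eq_lintegral_mul _ (by fun_prop) hF]
  rfl

lemma measurable_lintegral_posterior {α : Type*} [MeasurableSpace α] {l : α → Fin (d + 1) → ℝ}
    {F : α → (Fin (d + 1) → ℝ) → ℝ≥0∞} (hl : Measurable l) (hF : Measurable (Function.uncurry F)) :
    Measurable fun x => ∫⁻ p, F x p ∂(posterior (l x)) := by
  have hFx : ∀ x, Measurable (F x) := fun x => hF.comp measurable_prodMk_left
  simp_rw [fun x => lintegral_posterior (l := l x) (hFx x)]
  exact Measurable.lintegral_prod_right'
    (f := fun z : α × (Fin (d + 1) → ℝ) => posteriorDensity (l z.1) z.2 * F z.1 z.2)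
    ((measurable_posteriorDensity (by fun_prop) (by fun_prop)).mul hF)

lemma isProbabilityMeasure_posterior {l : Fin (d + 1) → ℝ} (hl : ∀ i, 0 < l i) :
    IsProbabilityMeasure (posterior l) := by
  have hpos : 0 < hittingDensity (∑ i, l i) 1 :=
    hittingDensity_pos (Finset.sum_pos (fun i _ => hl _) (by simp)) one_pos
  have hdens : ∀ x : Fin d → ℝ, posteriorDensity l (simplexPoint x) =
      ((∏ j : Fin d, ENNReal.ofReal (hittingDensity (l j.castSucc) (x j))) *
      ENNReal.ofReal (hittingDensity (l (Fin.last d)) (1 - ∑ j, x j))) *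
      (ENNReal.ofReal (hittingDensity (∑ i, l i) 1))⁻¹ := by
    intro x
    rw [posteriorDensity, ENNReal.ofReal_div_of_pos hpos, div_eq_mul_inv,
      ENNReal.ofReal_prod_of_nonneg fun i _ => hittingDensity_nonneg (hl i).le _,
      Fin.prod_univ_castSucc]
    simp only [simplexPoint_last, simplexPoint_castSucc]
  refine ⟨?_⟩
  rw [posterior, withDensity_apply _ .univ, Measure.restrict_univ, lintegral_hyperplaneMeasure
    (by fun_prop)]
  simp_rw [hdens]
  rw [lintegral_mul_const _ (by fun_prop), lintegral_prod_hittingDensity hl 1,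
    ENNReal.mul_inv_cancel (by simpa using hpos) ENNReal.ofReal_ne_top]

end Posterior

/-! ### The law of the initial quantities -/

lemma image_sq_Ioi : (fun c : ℝ => c ^ 2) '' Set.Ioi 0 = Set.Ioi 0 := by
  ext y
  constructor
  · rintro ⟨c, hc : 0 < c, rfl⟩
    exact Set.mem_Ioi.2 (pow_pos hc 2)
  · intro (hy : 0 < y)
    exact ⟨√y, Set.mem_Ioi.2 (Real.sqrt_pos.2 hy), Real.sq_sqrt hy.le⟩

lemma lintegral_gammaMeasure {s r : ℝ} {F : ℝ → ℝ≥0∞} (hF : Measurable F) :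
    ∫⁻ y, F y ∂(gammaMeasure s r) = ∫⁻ y in Set.Ioi 0, gammaPDF s r y * F y := by
  rw [gammaMeasure, lintegral_withDensity_eq_lintegral_mul _ (by unfold gammaPDF; fun_prop) hF,
    setLIntegral_congr Ioi_ae_eq_Ici, ← lintegral_indicator measurableSet_Ici]
  refine lintegral_congr fun y => ?_
  by_cases hy : y ∈ Set.Ici (0 : ℝ)
  · rw [Set.indicator_of_mem hy, Pi.mul_apply]
  · rw [Set.indicator_of_notMem hy, Pi.mul_apply, gammaPDF_of_neg (by simpa using hy), zero_mul]

lemma lintegral_sqrt_gammaMeasure {s r : ℝ} (hs : 0 < s) {G : ℝ → ℝ≥0∞}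
    (hG : Measurable G) :
    ∫⁻ y, G (√y) ∂(gammaMeasure s r) = ∫⁻ c in Set.Ioi (0 : ℝ),
      ENNReal.ofReal (2 * (r ^ s / Real.Gamma s) * c ^ (2 * s - 1) * Real.exp (-(r * c ^ 2))) *
        G c := by
  have := Real.Gamma_pos_of_pos hs
  rw [lintegral_gammaMeasure (by fun_prop)]
  conv_lhs => rw [← image_sq_Ioi]
  rw [lintegral_image_eq_lintegral_deriv_mul_of_monotoneOn (f' := fun c => 2 * c)
    measurableSet_Ioi]
  · refine setLIntegral_congr_fun measurableSet_Ioi fun c (hc : 0 < c) => ?_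
    have hpow : c * (c ^ 2) ^ (s - 1) = c ^ (2 * s - 1) := by
      have hexp : 2 * s - 1 = 1 + ((2 : ℕ) : ℝ) * (s - 1) := by
        push_cast
        ring
      rw [← Real.rpow_natCast c 2, ← Real.rpow_mul hc.le, hexp, Real.rpow_add hc, Real.rpow_one]
    rw [gammaPDF_of_nonneg (by positivity), ← mul_assoc, ← ENNReal.ofReal_mul (by positivity),
      Real.sqrt_sq hc.le, ← hpow]
    congr 2
    ring
  · intro c _
    exact ((hasDerivAt_pow 2 c).congr_deriv (by norm_num)).hasDerivWithinAt
  · intro a (ha : 0 < a) b _ hab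
    simp only
    gcongr

section TotalAndProportions

variable {d : ℕ}

lemma lintegral_comp_smul_fin {c : ℝ} (hc : 0 < c) {G : (Fin d → ℝ) → ℝ≥0∞} (hG : Measurable G) :
    ENNReal.ofReal (c ^ d) * ∫⁻ x, G (c • x) = ∫⁻ y, G y := by
  rw [← lintegral_map (μ := volume) hG (by fun_prop), Measure.map_addHaar_smul _ hc.ne',
    lintegral_smul_measure, smul_eq_mul, ← mul_assoc, ← ENNReal.ofReal_mul (by positivity)]
  simp only [Module.finrank_fintype_fun_eq_card, Fintype.card_fin]
  rw [abs_of_pos (by positivity), mul_inv_cancel₀ (by positivity), ENNReal.ofReal_one, one_mul]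

lemma smul_simplexPoint (c : ℝ) (x : Fin d → ℝ) :
    c • simplexPoint x = Fin.snoc (α := fun _ => ℝ) (c • x) (c - ∑ j, (c • x) j) := by
  ext i
  refine Fin.lastCases ?_ (fun j => ?_) i
  · simp [simplexPoint_last, mul_sub, Finset.mul_sum]
  · simp [simplexPoint_castSucc]

lemma lintegral_fin_snoc {F : (Fin (d + 1) → ℝ) → ℝ≥0∞} (hF : Measurable F) :
    ∫⁻ x, F x = ∫⁻ y : Fin d → ℝ, ∫⁻ a : ℝ, F (Fin.snoc (α := fun _ => ℝ) y a) := by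
  have h := (volume_preserving_piFinSuccAbove (fun _ : Fin (d + 1) => ℝ) (Fin.last d)).symm
  rw [← h.lintegral_comp hF, Measure.volume_eq_prod, lintegral_prod_symm]
  · simp [MeasurableEquiv.piFinSuccAbove, Fin.insertNthEquiv, Fin.insertNth_last']
  · exact (hF.comp h.measurable).aemeasurable

lemma lintegral_eq_lintegral_lintegral_snoc_sub_sum {H : (Fin (d + 1) → ℝ) → ℝ≥0∞}
    (hH : Measurable H) :
    ∫⁻ l, H l = ∫⁻ c : ℝ, ∫⁻ y : Fin d → ℝ, H (Fin.snoc (α := fun _ => ℝ) y (c - ∑ j, y j)) := by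
  have hmeas : Measurable fun z : ℝ × (Fin d → ℝ) =>
      H (Fin.snoc (α := fun _ => ℝ) z.2 (z.1 - ∑ j, z.2 j)) :=
    hH.comp (measurable_snoc.comp (measurable_snd.prodMk (measurable_fst.sub (by fun_prop))))
  rw [lintegral_lintegral_swap hmeas.aemeasurable, lintegral_fin_snoc hH]
  exact lintegral_congr fun y => (lintegral_sub_right_eq_self (μ := volume)
    (fun a => H (Fin.snoc (α := fun _ => ℝ) y a)) (∑ j, y j)).symm

lemma lintegral_smul_hyperplaneMeasure {H : (Fin (d + 1) → ℝ) → ℝ≥0∞} (hH : Measurable H)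
    (hsupp : ∀ l, ¬ (∀ i, 0 < l i) → H l = 0) :
    ∫⁻ c in Set.Ioi (0 : ℝ), ENNReal.ofReal (c ^ d) * ∫⁻ p, H (c • p) ∂(hyperplaneMeasure d) =
      ∫⁻ l, H l := by
  have hslice : ∀ c ∈ Set.Ioi (0 : ℝ),
      ENNReal.ofReal (c ^ d) * ∫⁻ p, H (c • p) ∂(hyperplaneMeasure d) =
        ∫⁻ y : Fin d → ℝ, H (Fin.snoc (α := fun _ => ℝ) y (c - ∑ j, y j)) := by
    intro c hc
    rw [lintegral_hyperplaneMeasure (by fun_prop), ← lintegral_comp_smul_fin (Set.mem_Ioi.1 hc)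
      (G := fun y => H (Fin.snoc (α := fun _ => ℝ) y (c - ∑ j, y j)))
      (hH.comp (measurable_snoc.comp (measurable_id.prodMk (by fun_prop))))]
    simp only [smul_simplexPoint]
  rw [setLIntegral_congr_fun measurableSet_Ioi hslice,
    lintegral_eq_lintegral_lintegral_snoc_sub_sum hH]
  refine setLIntegral_eq_of_support_subset fun c hc => ?_
  by_contra hneg
  refine hc (lintegral_eq_zero_of_ae_eq_zero (ae_of_all _ fun y => hsupp _ fun hpos => hneg ?_))
  have hsum : 0 < ∑ i, Fin.snoc (α := fun _ => ℝ) y (c - ∑ j, y j) i :=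
    Finset.sum_pos (fun i _ => hpos i) (by simp)
  simpa [Fin.sum_univ_castSucc] using hsum

/-- The normalizing constant of `initialDensity`. -/
def initialConst (d : ℕ) : ℝ :=
  2 * ((1 / 2 : ℝ) ^ ((((d + 1 : ℕ) : ℝ) + 1) / 2) / Real.Gamma ((((d + 1 : ℕ) : ℝ) + 1) / 2)) *
    Real.Gamma ((d + 1 : ℕ) : ℝ)

lemma initialConst_pos (d : ℕ) : 0 < initialConst d := by
  have : 0 < Real.Gamma ((((d + 1 : ℕ) : ℝ) + 1) / 2) :=
    Real.Gamma_pos_of_pos (by positivity)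
  have : 0 < Real.Gamma ((d + 1 : ℕ) : ℝ) := Real.Gamma_pos_of_pos (by positivity)
  unfold initialConst
  positivity

/-- The density on `ℝ^(d+1)` of the initial quantities of the urn. -/
def initialDensity : (Fin (d + 1) → ℝ) → ℝ≥0∞ :=
  {l | ∀ i, 0 < l i}.indicator fun l =>
    ENNReal.ofReal (initialConst d * (∑ i, l i) * Real.exp (-((∑ i, l i) ^ 2 / 2)))

@[fun_prop]
lemma measurable_initialDensity : Measurable (initialDensity (d := d)) :=
  Measurable.indicator (by fun_prop) measurableSet_pos

lemma initialDensity_of_pos {l : Fin (d + 1) → ℝ} (hl : ∀ i, 0 < l i) :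
    initialDensity l =
      ENNReal.ofReal (initialConst d * (∑ i, l i) * Real.exp (-((∑ i, l i) ^ 2 / 2))) :=
  Set.indicator_of_mem (s := {l : Fin (d + 1) → ℝ | ∀ i, 0 < l i}) hl _

lemma initialDensity_eq_zero {l : Fin (d + 1) → ℝ} (hl : ¬ ∀ i, 0 < l i) : initialDensity l = 0 :=
  Set.indicator_of_notMem (s := {l : Fin (d + 1) → ℝ | ∀ i, 0 < l i}) hl _

lemma mul_dirichletDensity_one {c : ℝ} (hc : 0 < c) {p : Fin (d + 1) → ℝ} (hp : ∑ i, p i = 1) :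
    ENNReal.ofReal (initialConst d / Real.Gamma ((d + 1 : ℕ) : ℝ) * (c * c ^ d) *
        Real.exp (-(c ^ 2 / 2))) * dirichletDensity (fun _ => 1) p =
      ENNReal.ofReal (c ^ d) * initialDensity (c • p) := by
  have hscale : (∀ i, 0 < (c • p) i) ↔ ∀ i, 0 < p i :=
    forall_congr' fun i => mul_pos_iff_of_pos_left hc
  by_cases hpos : ∀ i, 0 < p i
  · have : 0 < Real.Gamma ((d + 1 : ℕ) : ℝ) := Real.Gamma_pos_of_pos (by positivity)
    have hK := initialConst_pos d
    have htotal : ∑ i, (c • p) i = c := by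
      simp [← Finset.mul_sum, hp]
    rw [dirichletDensity_of_pos _ hpos, initialDensity_of_pos (hscale.2 hpos), htotal,
      ← ENNReal.ofReal_mul (by positivity), ← ENNReal.ofReal_mul (by positivity)]
    simp only [Finset.sum_const, Finset.card_univ, Fintype.card_fin, nsmul_eq_mul, mul_one,
      Real.Gamma_one, Finset.prod_const_one, div_one, sub_self, Real.rpow_zero]
    congr 1
    field_simp
  · rw [dirichletDensity_eq_zero _ hpos, initialDensity_eq_zero (hscale.not.2 hpos), mul_zero,
      mul_zero]

end TotalAndProportions

namespace IsContinuousUrn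

variable {Ω : Type*} [MeasurableSpace Ω] {μ : Measure Ω} {d : ℕ}
  {L : ℕ → Ω → Fin (d + 1) → ℝ} {I : ℕ → Ω → Fin (d + 1)} {A : ℕ → Ω → ℝ}

lemma measurable_total_zero (h : IsContinuousUrn L I A μ) : Measurable (total L 0) := by
  have := h.measurable_initial
  unfold total
  fun_prop

lemma measurable_proportion_zero (h : IsContinuousUrn L I A μ) : Measurable (proportion L 0) :=
  measurable_pi_lambda _ fun i =>
    ((measurable_pi_apply i).comp h.measurable_initial).div h.measurable_total_zero

lemma lintegral_total_zero (h : IsContinuousUrn L I A μ) {G : ℝ → ℝ≥0∞} (hG : Measurable G) :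
    ∫⁻ ω, G (total L 0 ω) ∂μ = ∫⁻ c in Set.Ioi (0 : ℝ),
      ENNReal.ofReal (initialConst d / Real.Gamma ((d + 1 : ℕ) : ℝ) * (c * c ^ d) *
        Real.exp (-(c ^ 2 / 2))) * G c := by
  have hsqrt : ∫⁻ ω, G (total L 0 ω) ∂μ = ∫⁻ ω, G √(total L 0 ω ^ 2) ∂μ := by
    refine lintegral_congr_ae ?_
    filter_upwards [h.initial_nonneg] with ω hω
    have hnonneg : 0 ≤ total L 0 ω := Finset.sum_nonneg fun i _ => hω i
    rw [Real.sqrt_sq hnonneg]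
  have hΓ : Real.Gamma ((d + 1 : ℕ) : ℝ) ≠ 0 := (Real.Gamma_pos_of_pos (by positivity)).ne'
  rw [hsqrt, h.hasLaw_total_sq.lintegral_comp (f := fun y => G √y)
    (Measurable.aemeasurable (by fun_prop)), lintegral_sqrt_gammaMeasure (by positivity) hG]
  refine setLIntegral_congr_fun measurableSet_Ioi fun c _ => ?_
  have hpow : c ^ (2 * ((((d + 1 : ℕ) : ℝ) + 1) / 2) - 1) = c * c ^ d := by
    rw [← pow_succ', ← Real.rpow_natCast]
    congr 1
    ring
  rw [hpow, initialConst, mul_div_cancel_right₀ _ hΓ]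
  congr 5
  ring

lemma map_total_zero (h : IsContinuousUrn L I A μ) :
    μ.map (total L 0) = (volume.restrict (Set.Ioi 0)).withDensity fun c => ENNReal.ofReal
      (initialConst d / Real.Gamma ((d + 1 : ℕ) : ℝ) * (c * c ^ d) * Real.exp (-(c ^ 2 / 2))) := by
  refine Measure.ext_of_lintegral _ fun G hG => ?_
  rw [lintegral_map hG h.measurable_total_zero, h.lintegral_total_zero hG,
    lintegral_withDensity_eq_lintegral_mul _ (by fun_prop) hG]
  rfl

lemma ae_total_zero_pos (h : IsContinuousUrn L I A μ) : ∀ᵐ ω ∂μ, 0 < total L 0 ω := by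
  refine ae_of_ae_map h.measurable_total_zero.aemeasurable ?_
  rw [h.map_total_zero]
  exact (withDensity_absolutelyContinuous _ _).ae_le (ae_restrict_mem measurableSet_Ioi)

lemma lintegral_initial_eq_lintegral_smul [IsProbabilityMeasure μ] (h : IsContinuousUrn L I A μ)
    {F : (Fin (d + 1) → ℝ) → ℝ≥0∞} (hF : Measurable F) :
    ∫⁻ ω, F (L 0 ω) ∂μ =
      ∫⁻ ω, ∫⁻ p, F (total L 0 ω • p) ∂(dirichletMeasure fun _ => 1) ∂μ := by
  have hC := h.measurable_total_zero
  have hP := h.measurable_proportion_zero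
  have hFm : Measurable fun z : ℝ × (Fin (d + 1) → ℝ) => F (z.1 • z.2) := by fun_prop
  have : IsProbabilityMeasure (μ.map (proportion L 0)) :=
    Measure.isProbabilityMeasure_map hP.aemeasurable
  have hsmul : ∫⁻ ω, F (L 0 ω) ∂μ = ∫⁻ ω, F (total L 0 ω • proportion L 0 ω) ∂μ := by
    refine lintegral_congr_ae ?_
    filter_upwards [h.ae_total_zero_pos] with ω hω
    congr 1
    ext i
    simp only [Pi.smul_apply, proportion, smul_eq_mul]
    field_simp
  rw [hsmul, ← lintegral_map (f := fun z : ℝ × (Fin (d + 1) → ℝ) => F (z.1 • z.2)) hFm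
    (hC.prodMk hP), (indepFun_iff_map_prod_eq_prod_map_map hC.aemeasurable hP.aemeasurable).1
    h.indep_initial, lintegral_prod _ hFm.aemeasurable, lintegral_map
    (Measurable.lintegral_prod_right' hFm) hC, h.hasLaw_proportion.map_eq]

lemma lintegral_initial [IsProbabilityMeasure μ] (h : IsContinuousUrn L I A μ)
    {F : (Fin (d + 1) → ℝ) → ℝ≥0∞} (hF : Measurable F) :
    ∫⁻ ω, F (L 0 ω) ∂μ = ∫⁻ l, initialDensity l * F l := by
  have : IsProbabilityMeasure (dirichletMeasure fun _ : Fin (d + 1) => (1 : ℝ)) := by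
    rw [← h.hasLaw_proportion.map_eq]
    exact Measure.isProbabilityMeasure_map h.measurable_proportion_zero.aemeasurable
  rw [h.lintegral_initial_eq_lintegral_smul hF, h.lintegral_total_zero
    (G := fun c => ∫⁻ p, F (c • p) ∂(dirichletMeasure fun _ => 1))
    (Measurable.lintegral_prod_right' (f := fun z : ℝ × (Fin (d + 1) → ℝ) => F (z.1 • z.2))
      (by fun_prop)),
    ← lintegral_smul_hyperplaneMeasure (by fun_prop) fun l hl => by
      rw [initialDensity_eq_zero hl, zero_mul]]
  refine setLIntegral_congr_fun measurableSet_Ioi fun c hc => ?_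
  rw [lintegral_dirichletMeasure (by fun_prop), ← lintegral_const_mul _ (by fun_prop),
    ← lintegral_const_mul _ (by fun_prop)]
  refine lintegral_congr_ae ?_
  filter_upwards [ae_hyperplaneMeasure_sum_eq_one] with p hp
  rw [← mul_assoc (ENNReal.ofReal _), ← mul_assoc (ENNReal.ofReal _),
    mul_dirichletDensity_one hc hp]

lemma map_initial [IsProbabilityMeasure μ] (h : IsContinuousUrn L I A μ) :
    μ.map (L 0) = volume.withDensity initialDensity := by
  refine Measure.ext_of_lintegral _ fun F hF => ?_
  rw [lintegral_map hF h.measurable_initial, h.lintegral_initial hF,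
    lintegral_withDensity_eq_lintegral_mul _ (by fun_prop) hF]
  rfl

lemma ae_initial_pos [IsProbabilityMeasure μ] (h : IsContinuousUrn L I A μ) :
    ∀ᵐ ω ∂μ, ∀ i, 0 < L 0 ω i := by
  refine ae_of_ae_map (p := fun l => ∀ i, 0 < l i) h.measurable_initial.aemeasurable ?_
  rw [h.map_initial, ae_withDensity_iff (by fun_prop)]
  exact ae_of_all _ fun l hl => by_contra fun hpos => hl (initialDensity_eq_zero hpos)

end IsContinuousUrn

/-! ### Bayes formulas -/

section Bayes

variable {d : ℕ}

lemma hittingDensity_add {l a t : ℝ} (hl : 0 < l) (ht : 0 < t) :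
    hittingDensity (l + a) t =
      (a + l) / l * Real.exp (-(((a + l) ^ 2 - l ^ 2) / (2 * t))) * hittingDensity l t := by
  have hexp : Real.exp (-((l + a) ^ 2 / (2 * t))) =
      Real.exp (-(((a + l) ^ 2 - l ^ 2) / (2 * t))) * Real.exp (-(l ^ 2 / (2 * t))) := by
    rw [← Real.exp_add]
    congr 1
    ring
  rw [hittingDensity_of_pos ht, hittingDensity_of_pos ht, hexp]
  field_simp
  ring

lemma sum_update_add (l : Fin (d + 1) → ℝ) (i : Fin (d + 1)) (a : ℝ) :
    ∑ j, Function.update l i (l i + a) j = ∑ j, l j + a := by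
  rw [Finset.sum_update_of_mem (Finset.mem_univ i), Finset.sdiff_singleton_eq_erase,
    ← Finset.add_sum_erase _ l (Finset.mem_univ i)]
  ring

lemma prod_hittingDensity_update {l p : Fin (d + 1) → ℝ} {i : Fin (d + 1)} (hl : 0 < l i)
    (hp : 0 < p i) (a : ℝ) :
    ∏ j, hittingDensity (Function.update l i (l i + a) j) (p j) =
      (a + l i) / l i * Real.exp (-(((a + l i) ^ 2 - l i ^ 2) / (2 * p i))) *
        ∏ j, hittingDensity (l j) (p j) := by
  rw [← Finset.mul_prod_erase _ _ (Finset.mem_univ i), Function.update_self,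
    ← Finset.mul_prod_erase _ (fun j => hittingDensity (l j) (p j)) (Finset.mem_univ i),
    hittingDensity_add hl hp, mul_assoc]
  congr 2
  refine Finset.prod_congr rfl fun j hj => ?_
  rw [Function.update_of_ne (Finset.ne_of_mem_erase hj)]

lemma posteriorDensity_update {l p : Fin (d + 1) → ℝ} (hl : ∀ j, 0 < l j) (hp : ∀ j, 0 < p j)
    (i : Fin (d + 1)) {a : ℝ} (ha : 0 < a) :
    posteriorDensity l p * (ENNReal.ofReal (p i) * ENNReal.ofReal ((a + l i) / p i *
      Real.exp (-(((a + l i) ^ 2 - l i ^ 2) / (2 * p i))))) =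
    ENNReal.ofReal (l i / ∑ j, l j) * (ENNReal.ofReal ((a + ∑ j, l j) *
      Real.exp (-(1 / 2) * (a + ∑ j, l j) ^ 2 + (1 / 2) * (∑ j, l j) ^ 2)) *
      posteriorDensity (Function.update l i (l i + a)) p) := by
  have hC : 0 < ∑ j, l j := Finset.sum_pos (fun i _ => hl i) (by simp)
  have hli := hl i
  have hpi := hp i
  have hprod : 0 < ∏ j, hittingDensity (l j) (p j) :=
    Finset.prod_pos fun j _ => hittingDensity_pos (hl j) (hp j)
  have hden : 0 < hittingDensity (∑ j, l j) 1 := hittingDensity_pos hC one_pos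
  have hexp : -(1 / 2) * (a + ∑ j, l j) ^ 2 + (1 / 2) * (∑ j, l j) ^ 2 =
      -(((a + ∑ j, l j) ^ 2 - (∑ j, l j) ^ 2) / (2 * 1)) := by ring
  rw [posteriorDensity, posteriorDensity, sum_update_add, prod_hittingDensity_update hli hpi,
    hittingDensity_add hC one_pos, hexp, ← ENNReal.ofReal_mul hpi.le,
    ← ENNReal.ofReal_mul (by positivity), ← ENNReal.ofReal_mul (by positivity),
    ← ENNReal.ofReal_mul (by positivity)]
  congr 1
  field_simp

lemma posteriorDensity_mul_lintegral_clockGap {l : Fin (d + 1) → ℝ} (hl : ∀ j, 0 < l j)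
    (p : Fin (d + 1) → ℝ) (i : Fin (d + 1)) {F : ℝ → ℝ≥0∞} (hF : Measurable F) :
    posteriorDensity l p * (ENNReal.ofReal (p i) * ∫⁻ a, F a ∂(clockGap (p i) (l i))) =
      ENNReal.ofReal (l i / ∑ j, l j) * ∫⁻ a,
        posteriorDensity (Function.update l i (l i + a)) p * F a ∂(gapMeasure (∑ j, l j)) := by
  by_cases hp : ∀ j, 0 < p j
  · rw [lintegral_clockGap (hp i) (hl i).le hF, lintegral_gapMeasure (by fun_prop),
      ← mul_assoc, ← lintegral_const_mul _ (by fun_prop), ← lintegral_const_mul _ (by fun_prop)]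
    refine setLIntegral_congr_fun measurableSet_Ioi fun a ha => ?_
    have hupdate := congrArg (· * F a) (posteriorDensity_update hl hp i ha)
    simpa only [mul_assoc] using hupdate
  · simp_rw [posteriorDensity_eq_zero _ hp, zero_mul, lintegral_zero, mul_zero]

lemma measurable_lintegral_clockGap {α : Type*} [MeasurableSpace α] {q l : α → ℝ}
    {F : α → ℝ → ℝ≥0∞} (hq : Measurable q) (hl : Measurable l)
    (hF : Measurable (Function.uncurry F)) :
    Measurable fun x => ∫⁻ a, F x a ∂(clockGap (q x) (l x)) :=
  Measurable.lintegral_kernel_prod_right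
    (κ := clockGapKernel.comap (fun x => (q x, l x)) (hq.prodMk hl)) hF

lemma lintegral_posteriorDensity_clockGap {l : Fin (d + 1) → ℝ} (hl : ∀ j, 0 < l j)
    (i : Fin (d + 1)) {F : (Fin (d + 1) → ℝ) → ℝ → ℝ≥0∞} (hF : Measurable (Function.uncurry F)) :
    ∫⁻ p, posteriorDensity l p * (ENNReal.ofReal (p i) * ∫⁻ a, F p a ∂(clockGap (p i) (l i)))
        ∂(hyperplaneMeasure d) =
      ENNReal.ofReal (l i / ∑ j, l j) *
        ∫⁻ a, (∫⁻ p, F p a ∂(posterior (Function.update l i (l i + a))))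
          ∂(gapMeasure (∑ j, l j)) := by
  have : SFinite (gapMeasure (∑ j, l j)) := by
    unfold gapMeasure
    infer_instance
  have hdens : Measurable fun z : (Fin (d + 1) → ℝ) × ℝ =>
      posteriorDensity (Function.update l i (l i + z.2)) z.1 * F z.1 z.2 :=
    (measurable_posteriorDensity (by fun_prop) measurable_fst).mul hF
  have hp : ∀ p, Measurable (F p) := fun p => hF.comp measurable_prodMk_left
  have ha : ∀ a, Measurable fun p => F p a := fun a => hF.comp measurable_prodMk_right
  simp_rw [fun p => posteriorDensity_mul_lintegral_clockGap hl p i (hp p),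
    fun a => lintegral_posterior (l := Function.update l i (l i + a)) (ha a)]
  rw [lintegral_const_mul _ (Measurable.lintegral_prod_right' hdens),
    lintegral_lintegral_swap hdens.aemeasurable]

/-- Drawing `p` from the posterior, then a color with law `p` and an addition from its clock,
amounts to making a step of the urn, then drawing `p` from the updated posterior. -/
lemma lintegral_posterior_step {l : Fin (d + 1) → ℝ} (hl : ∀ j, 0 < l j)
    {F : Fin (d + 1) → (Fin (d + 1) → ℝ) → ℝ → ℝ≥0∞}
    (hF : ∀ i, Measurable (Function.uncurry (F i))) :
    ∫⁻ p, ∑ i, ENNReal.ofReal (p i) * ∫⁻ a, F i p a ∂(clockGap (p i) (l i)) ∂(posterior l) =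
      ∑ i, ENNReal.ofReal (l i / ∑ j, l j) *
        ∫⁻ a, (∫⁻ p, F i p a ∂(posterior (Function.update l i (l i + a))))
          ∂(gapMeasure (∑ j, l j)) := by
  have hclock : ∀ i, Measurable fun p : Fin (d + 1) → ℝ =>
      ENNReal.ofReal (p i) * ∫⁻ a, F i p a ∂(clockGap (p i) (l i)) := fun i =>
    Measurable.mul (by fun_prop)
      (measurable_lintegral_clockGap (measurable_pi_apply i) measurable_const (hF i))
  rw [lintegral_finsetSum _ fun i _ => hclock i]
  simp_rw [fun i => lintegral_posterior (l := l) (hclock i),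
    fun i => lintegral_posteriorDensity_clockGap hl i (hF i)]

lemma initialConst_eq (d : ℕ) :
    Real.Gamma (((d + 1 : ℕ) : ℝ) / 2) / √Real.pi ^ (d + 1) =
      initialConst d * √(2 * Real.pi) / √(2 * Real.pi) ^ (d + 1) := by
  have hduplication := Real.Gamma_mul_Gamma_add_half (((d + 1 : ℕ) : ℝ) / 2)
  have hhalf : ((d + 1 : ℕ) : ℝ) / 2 + 1 / 2 = (((d + 1 : ℕ) : ℝ) + 1) / 2 := by ring
  have htwice : 2 * (((d + 1 : ℕ) : ℝ) / 2) = ((d + 1 : ℕ) : ℝ) := by ring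
  have htwo : (2 : ℝ) ^ (1 - ((d + 1 : ℕ) : ℝ)) = (2 ^ d)⁻¹ := by
    rw [← Real.rpow_natCast, ← Real.rpow_neg (by norm_num)]
    congr 1
    push_cast
    ring
  have hhalfpow : (1 / 2 : ℝ) ^ ((((d + 1 : ℕ) : ℝ) + 1) / 2) = (√2 ^ (d + 2))⁻¹ := by
    rw [one_div, Real.inv_rpow (by norm_num), Real.sqrt_eq_rpow, ← Real.rpow_natCast,
      ← Real.rpow_mul (by norm_num)]
    congr 2
    push_cast
    ring
  rw [hhalf, htwice, htwo] at hduplication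
  have : 0 < Real.Gamma ((((d + 1 : ℕ) : ℝ) + 1) / 2) := Real.Gamma_pos_of_pos (by positivity)
  have : 0 < √Real.pi := Real.sqrt_pos.2 Real.pi_pos
  have hΓd : Real.Gamma ((d + 1 : ℕ) : ℝ) = Real.Gamma (((d + 1 : ℕ) : ℝ) / 2) *
      Real.Gamma ((((d + 1 : ℕ) : ℝ) + 1) / 2) * 2 ^ d / √Real.pi := by
    rw [hduplication]
    field_simp
  have htwopow : (2 : ℝ) ^ d = √2 ^ (2 * d) := by rw [pow_mul, Real.sq_sqrt (by norm_num)]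
  have hsqrt : √2 * √2 = (2 : ℝ) := Real.mul_self_sqrt (by norm_num)
  have : 0 < √(2 : ℝ) := by positivity
  rw [initialConst, hΓd, hhalfpow, Real.sqrt_mul (by norm_num), htwopow]
  field_simp
  generalize √(2 : ℝ) = r at hsqrt ⊢
  rw [← hsqrt]
  ring

lemma hittingDensity_eq_mul_rpow {l t : ℝ} (ht : 0 < t) :
    hittingDensity l t = (√(2 * Real.pi))⁻¹ * t ^ ((1 / 2 : ℝ) - 1) *
      (l / t * Real.exp (-(l ^ 2 / (2 * t)))) := by
  have : 0 < √t := Real.sqrt_pos.2 ht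
  rw [hittingDensity_of_pos ht, Real.rpow_sub ht, Real.rpow_one, ← Real.sqrt_eq_rpow]
  field_simp
  rw [Real.sq_sqrt ht.le]

lemma dirichletDensity_mul_prod {l : Fin (d + 1) → ℝ} (hl : ∀ i, 0 < l i) (p : Fin (d + 1) → ℝ) :
    dirichletDensity (fun _ => 1 / 2) p *
        ENNReal.ofReal (∏ i, (l i / p i * Real.exp (-(l i ^ 2 / (2 * p i))))) =
      initialDensity l * posteriorDensity l p := by
  by_cases hp : ∀ j, 0 < p j
  · have hC : 0 < ∑ i, l i := Finset.sum_pos (fun i _ => hl i) (by simp)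
    have hhalf : ∑ _j : Fin (d + 1), (1 / 2 : ℝ) = ((d + 1 : ℕ) : ℝ) / 2 := by
      simp only [Finset.sum_const, Finset.card_univ, Fintype.card_fin, nsmul_eq_mul]
      ring
    have hpow : 0 ≤ ∏ j, p j ^ ((1 / 2 : ℝ) - 1) :=
      Finset.prod_nonneg fun j _ => Real.rpow_nonneg (hp j).le _
    have : 0 < Real.Gamma (((d + 1 : ℕ) : ℝ) / 2) := Real.Gamma_pos_of_pos (by positivity)
    have hK := initialConst_pos d
    rw [dirichletDensity_of_pos _ hp, initialDensity_of_pos hl, posteriorDensity, hhalf,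
      Finset.prod_congr rfl fun i _ => hittingDensity_eq_mul_rpow (hp i)]
    simp only [Finset.prod_const, Finset.card_univ, Fintype.card_fin, Real.Gamma_one_half_eq,
      Finset.prod_mul_distrib]
    rw [initialConst_eq, ← ENNReal.ofReal_mul (by positivity),
      ← ENNReal.ofReal_mul (by positivity), hittingDensity_of_pos one_pos]
    congr 1
    simp only [Real.sqrt_one, mul_one, inv_pow]
    field_simp
  · rw [dirichletDensity_eq_zero _ hp, posteriorDensity_eq_zero _ hp, zero_mul, mul_zero]

lemma lintegral_pi_clockGap_zero {p : Fin (d + 1) → ℝ} (hp : ∀ i, 0 < p i)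
    {F : (Fin (d + 1) → ℝ) → ℝ≥0∞} (hF : Measurable F) :
    ∫⁻ l, F l ∂(Measure.pi fun i => clockGap (p i) 0) = ∫⁻ l in {l | ∀ i, 0 < l i},
      ENNReal.ofReal (∏ i, (l i / p i * Real.exp (-(l i ^ 2 / (2 * p i))))) * F l := by
  have hpi : (Set.univ.pi fun _ : Fin (d + 1) => Set.Ioi (0 : ℝ)) = {l | ∀ i, 0 < l i} := by
    ext l
    simp
  have hdens : ∀ i, clockGap (p i) 0 = (volume.restrict (Set.Ioi 0)).withDensity fun a =>
      ENNReal.ofReal (a / p i * Real.exp (-(a ^ 2 / (2 * p i)))) := fun i => by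
    simp [clockGap_eq_withDensity (hp i) le_rfl]
  have : ∀ i, SigmaFinite ((volume.restrict (Set.Ioi (0 : ℝ))).withDensity fun a =>
      ENNReal.ofReal (a / p i * Real.exp (-(a ^ 2 / (2 * p i))))) := fun i => by
    rw [← hdens]
    infer_instance
  simp_rw [hdens]
  rw [pi_withDensity _ fun i => by fun_prop, ← Measure.restrict_pi_pi, ← volume_pi, hpi,
    lintegral_withDensity_eq_lintegral_mul _ (by fun_prop) hF]
  refine setLIntegral_congr_fun measurableSet_pos fun l hl => ?_
  rw [Pi.mul_apply, ENNReal.ofReal_prod_of_nonneg fun i _ => mul_nonneg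
    (div_nonneg (le_of_lt (hl i)) (hp i).le) (Real.exp_pos _).le]

lemma lintegral_dirichletMeasure_half {F : (Fin (d + 1) → ℝ) → (Fin (d + 1) → ℝ) → ℝ≥0∞}
    (hF : Measurable (Function.uncurry F)) :
    ∫⁻ p, ∫⁻ l, F l p ∂(Measure.pi fun i => clockGap (p i) 0) ∂(dirichletMeasure fun _ => 1 / 2) =
      ∫⁻ l, initialDensity l * ∫⁻ p, F l p ∂(posterior l) := by
  have hF' : ∀ p, Measurable fun l => F l p := fun p => hF.comp measurable_prodMk_right
  have hdens : Measurable fun z : (Fin (d + 1) → ℝ) × (Fin (d + 1) → ℝ) => ENNReal.ofReal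
      (∏ i, (z.2 i / z.1 i * Real.exp (-(z.2 i ^ 2 / (2 * z.1 i))))) * F z.2 z.1 :=
    Measurable.mul (by fun_prop) (hF.comp measurable_swap)
  calc
    _ = ∫⁻ p, (∫⁻ l in {l | ∀ i, 0 < l i}, ENNReal.ofReal
          (∏ i, (l i / p i * Real.exp (-(l i ^ 2 / (2 * p i))))) * F l p)
        ∂(dirichletMeasure fun _ => 1 / 2) := by
      refine lintegral_congr_ae ?_
      filter_upwards [ae_dirichletMeasure_pos _] with p hp
      exact lintegral_pi_clockGap_zero hp.1 (hF' p)
    _ = ∫⁻ p, (∫⁻ l in {l | ∀ i, 0 < l i}, dirichletDensity (fun _ => 1 / 2) p * (ENNReal.ofReal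
          (∏ i, (l i / p i * Real.exp (-(l i ^ 2 / (2 * p i))))) * F l p))
        ∂(hyperplaneMeasure d) := by
      rw [lintegral_dirichletMeasure (Measurable.lintegral_prod_right' hdens)]
      exact lintegral_congr fun p =>
        (lintegral_const_mul _ (hdens.comp measurable_prodMk_left)).symm
    _ = ∫⁻ l in {l | ∀ i, 0 < l i}, ∫⁻ p, dirichletDensity (fun _ => 1 / 2) p * (ENNReal.ofReal
          (∏ i, (l i / p i * Real.exp (-(l i ^ 2 / (2 * p i))))) * F l p)
        ∂(hyperplaneMeasure d) :=
      lintegral_lintegral_swap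
        (Measurable.mul (by fun_prop) hdens).aemeasurable
    _ = ∫⁻ l in {l | ∀ i, 0 < l i}, initialDensity l * ∫⁻ p, F l p ∂(posterior l) := by
      refine setLIntegral_congr_fun measurableSet_pos fun l hl => ?_
      have hFl : Measurable (F l) := hF.comp measurable_prodMk_left
      simp_rw [← mul_assoc, dirichletDensity_mul_prod hl]
      rw [lintegral_posterior hFl, ← lintegral_const_mul _ (by fun_prop)]
      simp_rw [mul_assoc]
    _ = _ := setLIntegral_eq_of_support_subset fun l hl =>
      by_contra fun hpos => hl (by simp only [initialDensity_eq_zero hpos, zero_mul])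

end Bayes

/-! ### Conditional laws -/

section Conditioning

variable {Ω 𝓧 𝓨 : Type*} [MeasurableSpace Ω] [MeasurableSpace 𝓧] [MeasurableSpace 𝓨]
  {μ : Measure Ω} {X : Ω → 𝓧} {Y : Ω → 𝓨} {κ : Kernel 𝓧 𝓨}

lemma hasCondDistrib_of_condExp [IsFiniteMeasure μ] [StandardBorelSpace 𝓨] [Nonempty 𝓨]
    [IsMarkovKernel κ] (hX : Measurable X) (hY : Measurable Y)
    (hκ : ∀ B, MeasurableSet B →
      μ⟦Y ⁻¹' B | MeasurableSpace.comap X inferInstance⟧ =ᵐ[μ] fun ω => (κ (X ω)).real B) :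
    HasCondDistrib Y X κ μ := by
  refine ⟨(hX.prodMk hY).aemeasurable, ?_⟩
  rw [← compProd_map_condDistrib hY.aemeasurable]
  refine Measure.ext_prod fun {S B} hS hB => ?_
  rw [Measure.compProd_apply_prod hS hB, Measure.compProd_apply_prod hS hB,
    setLIntegral_map hS (Kernel.measurable_coe _ hB) hX,
    setLIntegral_map hS (Kernel.measurable_coe _ hB) hX]
  refine lintegral_congr_ae (ae_restrict_of_ae ?_)
  filter_upwards [condDistrib_ae_eq_condExp hX hY hB, hκ B hB] with ω hcond hω
  rwa [← measureReal_eq_measureReal_iff, hcond]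

lemma condExp_of_hasCondDistrib [IsFiniteMeasure μ] [StandardBorelSpace 𝓨] [Nonempty 𝓨]
    [IsFiniteKernel κ] (hX : Measurable X) (hY : Measurable Y) (hκ : HasCondDistrib Y X κ μ)
    {B : Set 𝓨} (hB : MeasurableSet B) :
    μ⟦Y ⁻¹' B | MeasurableSpace.comap X inferInstance⟧ =ᵐ[μ] fun ω => (κ (X ω)).real B := by
  have hκX := ae_of_ae_map hX.aemeasurable
    (condDistrib_ae_eq_of_measure_eq_compProd_of_measurable hX hY hκ.map_eq)
  filter_upwards [condDistrib_ae_eq_condExp hX hY hB, hκX] with ω hcond hω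
  rw [← hcond, hω]

lemma hasCondDistrib_of_condExp_singleton [IsFiniteMeasure μ] {ι : Type*} [Countable ι] [Nonempty ι]
    [MeasurableSpace ι] [MeasurableSingletonClass ι] {I : Ω → ι} {κ : Kernel 𝓧 ι}
    [IsMarkovKernel κ] (hX : Measurable X) (hI : Measurable I)
    (hκ : ∀ i, μ⟦I ⁻¹' {i} | MeasurableSpace.comap X inferInstance⟧ =ᵐ[μ]
      fun ω => (κ (X ω)).real {i}) :
    HasCondDistrib I X κ μ := by
  refine hasCondDistrib_of_condExp hX hI fun B hB => ?_
  have hcond : ∀ᵐ ω ∂μ, condDistrib I X μ (X ω) = κ (X ω) := by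
    have hsingleton : ∀ᵐ ω ∂μ, ∀ i, (condDistrib I X μ (X ω)).real {i} = (κ (X ω)).real {i} :=
      ae_all_iff.2 fun i =>
        (condDistrib_ae_eq_condExp hX hI (measurableSet_singleton i)).trans (hκ i)
    filter_upwards [hsingleton] with ω hω
    exact Measure.ext_of_singleton fun i => (measureReal_eq_measureReal_iff).1 (hω i)
  filter_upwards [condDistrib_ae_eq_condExp hX hI hB, hcond] with ω hω hκω
  rw [← hω, hκω]

lemma lintegral_of_hasCondDistrib [SFinite μ] [IsSFiniteKernel κ] (hX : Measurable X)
    (hκ : HasCondDistrib Y X κ μ) {F : 𝓧 → 𝓨 → ℝ≥0∞} (hF : Measurable (Function.uncurry F)) :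
    ∫⁻ ω, F (X ω) (Y ω) ∂μ = ∫⁻ ω, ∫⁻ y, F (X ω) y ∂(κ (X ω)) ∂μ :=
  calc
    _ = ∫⁻ z, Function.uncurry F z ∂(μ.map X ⊗ₘ κ) := hκ.lintegral_comp hF.aemeasurable
    _ = ∫⁻ x, ∫⁻ y, F x y ∂(κ x) ∂(μ.map X) := Measure.lintegral_compProd hF
    _ = _ := lintegral_map (Measurable.lintegral_kernel_prod_right hF) hX

lemma ae_of_hasCondDistrib (hX : Measurable X)
    (hκ : HasCondDistrib Y X κ μ) {S : Set 𝓨} (hS : MeasurableSet S)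
    (hae : ∀ᵐ ω ∂μ, ∀ᵐ y ∂(κ (X ω)), y ∈ S) : ∀ᵐ ω ∂μ, Y ω ∈ S := by
  have hmeas : MeasurableSet {x | ∀ᵐ y ∂(κ x), y ∈ S} :=
    Kernel.measurable_coe κ hS.compl (measurableSet_singleton 0)
  have hpair : ∀ᵐ z ∂(μ.map fun ω => (X ω, Y ω)), z.2 ∈ S := by
    rw [hκ.map_eq]
    exact Measure.ae_compProd_of_ae_ae (measurable_snd hS)
      ((ae_map_iff hX.aemeasurable hmeas).2 hae)
  exact ae_of_ae_map hκ.aemeasurable hpair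

end Conditioning

/-! ### The path of an urn -/

variable {d : ℕ}

lemma measurableSet_nonneg_sum_eq_one {n : ℕ} :
    MeasurableSet {p : Fin n → ℝ | (∀ i, 0 ≤ p i) ∧ ∑ i, p i = 1} := by
  have hnonneg : MeasurableSet {p : Fin n → ℝ | ∀ i, 0 ≤ p i} := by
    simp only [Set.ofPred_forall]
    exact .iInter fun i => measurableSet_le measurable_const (measurable_pi_apply i)
  exact hnonneg.inter (measurableSet_eq_fun (by fun_prop) measurable_const)

open scoped Classical in
/-- The law of a color chosen with probabilities `p`. Vectors `p` which are not probability vectors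
are sent to a Dirac mass, so that `categorical` is a Markov kernel. -/
def categorical : Kernel (Fin (d + 1) → ℝ) (Fin (d + 1)) :=
  Kernel.piecewise measurableSet_nonneg_sum_eq_one
    { toFun := fun p => ∑ i, ENNReal.ofReal (p i) • Measure.dirac i
      measurable' := by
        refine Measure.measurable_of_measurable_coe _ fun s _ => ?_
        simp only [Measure.coe_finsetSum, Finset.sum_apply, Measure.smul_apply, smul_eq_mul]
        fun_prop }
    (Kernel.const _ (Measure.dirac 0))

lemma categorical_apply {p : Fin (d + 1) → ℝ} (hp : ∀ i, 0 ≤ p i) (hsum : ∑ i, p i = 1) :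
    categorical p = ∑ i, ENNReal.ofReal (p i) • Measure.dirac i :=
  if_pos ⟨hp, hsum⟩

instance : IsMarkovKernel (categorical (d := d)) := by
  refine ⟨fun p => ?_⟩
  by_cases hp : (∀ i, 0 ≤ p i) ∧ ∑ i, p i = 1
  · rw [categorical_apply hp.1 hp.2]
    refine ⟨?_⟩
    simp only [Measure.coe_finsetSum, Finset.sum_apply, Measure.smul_apply, smul_eq_mul,
      measure_univ, mul_one]
    rw [← ENNReal.ofReal_sum_of_nonneg fun i _ => hp.1 i, hp.2, ENNReal.ofReal_one]
  · have hdirac : categorical p = Measure.dirac 0 := if_neg hp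
    rw [hdirac]
    infer_instance

lemma lintegral_categorical {p : Fin (d + 1) → ℝ} (hp : ∀ i, 0 ≤ p i) (hsum : ∑ i, p i = 1)
    (F : Fin (d + 1) → ℝ≥0∞) : ∫⁻ i, F i ∂(categorical p) = ∑ i, ENNReal.ofReal (p i) * F i := by
  rw [categorical_apply hp hsum, lintegral_finsetSum_measure]
  simp only [lintegral_smul_measure, lintegral_dirac, smul_eq_mul]

lemma categorical_real_singleton {p : Fin (d + 1) → ℝ} (hp : ∀ i, 0 ≤ p i) (hsum : ∑ i, p i = 1)
    (i : Fin (d + 1)) : (categorical p).real {i} = p i := by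
  have hsingleton := lintegral_categorical hp hsum (Set.indicator {i} 1)
  rw [lintegral_indicator_one (measurableSet_singleton i)] at hsingleton
  rw [measureReal_def, hsingleton, Finset.sum_eq_single i]
  · simp [hp i]
  · intro j _ hj
    simp [hj]
  · simp

lemma measurable_update_add {α : Type*} [MeasurableSpace α]
    {f : α → Fin (d + 1) → ℝ} {i : α → Fin (d + 1)} {a : α → ℝ} (hf : Measurable f)
    (hi : Measurable i) (ha : Measurable a) :
    Measurable fun x => Function.update (f x) (i x) (f x (i x) + a x) := by
  refine measurable_pi_lambda _ fun j => ?_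
  have hfj : Measurable fun x => f x j := (measurable_pi_apply j).comp hf
  have hite : (fun x => Function.update (f x) (i x) (f x (i x) + a x) j) =
      fun x => if i x = j then f x j + a x else f x j := by
    ext x
    by_cases hij : i x = j
    · subst hij
      simp
    · simp [hij, Function.update_of_ne (Ne.symm hij)]
  rw [hite]
  exact Measurable.ite (hi (measurableSet_singleton j)) (hfj.add ha) hfj

/-- The space of paths of an urn: the initial quantities, then the successive choices and
additions. -/
abbrev UrnPath (d : ℕ) : Type := (Fin (d + 1) → ℝ) × (ℕ → Fin (d + 1) × ℝ)

namespace UrnPath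

/-- The quantities after `n` steps along a path. -/
def L : ℕ → UrnPath d → Fin (d + 1) → ℝ
  | 0, z => z.1
  | n + 1, z => Function.update (L n z) (z.2 n).1 (L n z (z.2 n).1 + (z.2 n).2)

/-- The color chosen at step `n + 1` along a path. -/
def I (n : ℕ) (z : UrnPath d) : Fin (d + 1) := (z.2 n).1

/-- The quantity added at step `n + 1` along a path. -/
def A (n : ℕ) (z : UrnPath d) : ℝ := (z.2 n).2

/-- The path that chooses the color `s.1` and adds the quantity `s.2` at step `n + 1`, and follows
`z` at the other steps. -/
def set (n : ℕ) (z : UrnPath d) (s : Fin (d + 1) × ℝ) : UrnPath d :=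
  (z.1, Function.update z.2 n s)

/-- The path that follows `z` up to step `n`, and then adds nothing to the color `0` forever. -/
def trunc (n : ℕ) (z : UrnPath d) : UrnPath d := (z.1, fun k => if k < n then z.2 k else (0, 0))

@[fun_prop]
lemma measurable_I (n : ℕ) : Measurable (I (d := d) n) := by
  unfold I
  fun_prop

@[fun_prop]
lemma measurable_A (n : ℕ) : Measurable (A (d := d) n) := by
  unfold A
  fun_prop

@[fun_prop]
lemma measurable_L (n : ℕ) : Measurable (L (d := d) n) := by
  induction n with
  | zero => exact measurable_fst
  | succ n ih => exact measurable_update_add ih (measurable_I n) (measurable_A n)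

@[fun_prop]
lemma measurable_total (n : ℕ) : Measurable (total (L (d := d)) n) := by
  unfold total
  fun_prop

@[fun_prop]
lemma measurable_proportion (n : ℕ) : Measurable (proportion (L (d := d)) n) := by
  unfold proportion
  fun_prop

@[fun_prop]
lemma measurable_set (n : ℕ) :
    Measurable fun y : UrnPath d × (Fin (d + 1) × ℝ) => set n y.1 y.2 := by
  unfold set
  refine Measurable.prodMk (by fun_prop) (measurable_pi_lambda _ fun k => ?_)
  by_cases hk : k = n
  · subst hk
    simp only [Function.update_self]
    fun_prop
  · simp only [Function.update_of_ne hk]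
    fun_prop

@[fun_prop]
lemma measurable_trunc (n : ℕ) : Measurable (trunc (d := d) n) := by
  unfold trunc
  refine Measurable.prodMk (by fun_prop) (measurable_pi_lambda _ fun k => ?_)
  split_ifs <;> fun_prop

lemma trunc_succ (n : ℕ) (z : UrnPath d) :
    trunc (n + 1) z = set n (trunc n z) (I n z, A n z) := by
  refine Prod.ext rfl (funext fun k => ?_)
  by_cases hk : k = n
  · subst hk
    simp [trunc, set, I, A]
  · have hlt : k < n + 1 ↔ k < n := by omega
    simp only [trunc, set, Function.update_of_ne hk, hlt]

lemma L_congr {n : ℕ} {z z' : UrnPath d} (hinitial : z.1 = z'.1)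
    (hsteps : ∀ k < n, z.2 k = z'.2 k) : L n z = L n z' := by
  induction n with
  | zero => exact hinitial
  | succ n ih =>
    simp only [L]
    rw [ih fun k hk => hsteps k (by omega), hsteps n (by omega)]

lemma L_trunc (n : ℕ) (z : UrnPath d) : L n (trunc n z) = L n z :=
  L_congr rfl fun k hk => by simp [trunc, hk]

lemma L_succ_set (n : ℕ) (z : UrnPath d) (s : Fin (d + 1) × ℝ) :
    L (n + 1) (set n z s) = Function.update (L n z) s.1 (L n z s.1 + s.2) := by
  have hL : L n (set n z s) = L n z :=
    L_congr rfl fun k hk => by simp [set, Function.update_of_ne hk.ne]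
  simp only [L, hL]
  simp [set]

end UrnPath

lemma total_pos {Ω : Type*} {L : ℕ → Ω → Fin (d + 1) → ℝ} {n : ℕ} {ω : Ω}
    (hL : ∀ i, 0 < L n ω i) : 0 < total L n ω :=
  Finset.sum_pos (fun i _ => hL i) Finset.univ_nonempty

section PathOf

variable {Ω : Type*} (L : ℕ → Ω → Fin (d + 1) → ℝ) (I : ℕ → Ω → Fin (d + 1)) (A : ℕ → Ω → ℝ)

/-- The path of an urn, as a random variable. -/
def pathOf (ω : Ω) : UrnPath d := (L 0 ω, fun k => (I k ω, A k ω))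

/-- The path truncated after step `n`, as a function of the history `past L I A n`. -/
def pastPath (n : ℕ) (y : (Fin (d + 1) → ℝ) × (Fin n → Fin (d + 1) × ℝ)) : UrnPath d :=
  (y.1, fun k => if hk : k < n then y.2 ⟨k, hk⟩ else (0, 0))

@[fun_prop]
lemma measurable_pastPath (n : ℕ) : Measurable (pastPath (d := d) n) := by
  unfold pastPath
  refine Measurable.prodMk (by fun_prop) (measurable_pi_lambda _ fun k => ?_)
  split_ifs <;> fun_prop

lemma pastPath_past (n : ℕ) (ω : Ω) :
    pastPath n (past L I A n ω) = UrnPath.trunc n (pathOf L I A ω) := by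
  refine Prod.ext rfl (funext fun k => ?_)
  by_cases hk : k < n <;> simp [UrnPath.trunc, pathOf, pastPath, past, hk]

end PathOf

namespace IsContinuousUrn

variable {Ω : Type*} [MeasurableSpace Ω] {μ : Measure Ω}
  {L : ℕ → Ω → Fin (d + 1) → ℝ} {I : ℕ → Ω → Fin (d + 1)} {A : ℕ → Ω → ℝ}

lemma measurable_pathOf (h : IsContinuousUrn L I A μ) : Measurable (pathOf L I A) := by
  have hL := h.measurable_initial
  have hI := h.measurable_index
  have hA := h.measurable_addition
  unfold pathOf
  fun_prop

lemma measurable_past (h : IsContinuousUrn L I A μ) (n : ℕ) : Measurable (past L I A n) := by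
  have hL := h.measurable_initial
  have hI := h.measurable_index
  have hA := h.measurable_addition
  unfold past
  fun_prop

lemma L_pathOf (h : IsContinuousUrn L I A μ) (n : ℕ) (ω : Ω) :
    UrnPath.L n (pathOf L I A ω) = L n ω := by
  induction n with
  | zero => rfl
  | succ n ih =>
    rw [h.succ_eq n ω, UrnPath.L, ih]
    rfl

lemma L_pastPath (h : IsContinuousUrn L I A μ) (n : ℕ) (ω : Ω) :
    UrnPath.L n (pastPath n (past L I A n ω)) = L n ω := by
  rw [pastPath_past, UrnPath.L_trunc, h.L_pathOf]

lemma total_pastPath (h : IsContinuousUrn L I A μ) (n : ℕ) (ω : Ω) :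
    total UrnPath.L n (pastPath n (past L I A n ω)) = total L n ω := by
  simp only [total, h.L_pastPath]

lemma proportion_pastPath (h : IsContinuousUrn L I A μ) (n : ℕ) (ω : Ω) :
    proportion UrnPath.L n (pastPath n (past L I A n ω)) = proportion L n ω := by
  ext i
  simp only [proportion, h.L_pastPath, h.total_pastPath]

lemma hasCondDistrib_addition [IsProbabilityMeasure μ] (h : IsContinuousUrn L I A μ) {n : ℕ}
    (hpos : ∀ᵐ ω ∂μ, ∀ i, 0 < L n ω i) :
    HasCondDistrib (A n) (fun ω => (past L I A n ω, I n ω))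
      (clockGapKernel.comap (fun y => (1, total UrnPath.L n (pastPath n y.1))) (by fun_prop))
      μ := by
  refine hasCondDistrib_of_condExp ((h.measurable_past n).prodMk (h.measurable_index n))
    (h.measurable_addition n) fun B hB => ?_
  filter_upwards [h.addition_cond n B hB, hpos] with ω hcond hω
  rw [hcond, gapMeasure_eq_clockGap (total_pos hω).le, Kernel.comap_apply,
    h.total_pastPath]
  rfl

lemma ae_L_pos [IsProbabilityMeasure μ] (h : IsContinuousUrn L I A μ) (n : ℕ) :
    ∀ᵐ ω ∂μ, ∀ i, 0 < L n ω i := by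
  induction n with
  | zero => exact h.ae_initial_pos
  | succ n ih =>
    have hA : ∀ᵐ ω ∂μ, A n ω ∈ Set.Ioi 0 := by
      refine ae_of_hasCondDistrib ((h.measurable_past n).prodMk (h.measurable_index n))
        (h.hasCondDistrib_addition ih) measurableSet_Ioi ?_
      filter_upwards [ih] with ω hω
      rw [Kernel.comap_apply, h.total_pastPath]
      change ∀ᵐ a ∂(clockGap 1 (total L n ω)), 0 < a
      rw [← gapMeasure_eq_clockGap (total_pos hω).le]
      exact ae_gapMeasure_pos _
    filter_upwards [ih, hA] with ω hω hAω i
    rw [h.succ_eq]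
    by_cases hi : i = I n ω
    · subst hi
      simpa using add_pos (hω (I n ω)) hAω
    · rw [Function.update_of_ne hi]
      exact hω i

lemma ae_proportion_nonneg_sum_eq_one [IsProbabilityMeasure μ] (h : IsContinuousUrn L I A μ)
    (n : ℕ) :
    ∀ᵐ ω ∂μ, (∀ i, 0 ≤ proportion L n ω i) ∧ ∑ i, proportion L n ω i = 1 := by
  filter_upwards [h.ae_L_pos n] with ω hω
  refine ⟨fun i => (div_pos (hω i) (total_pos hω)).le, ?_⟩
  simp only [proportion]
  rw [← Finset.sum_div]
  exact div_self (total_pos hω).ne'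

lemma hasCondDistrib_index [IsProbabilityMeasure μ] (h : IsContinuousUrn L I A μ) (n : ℕ) :
    HasCondDistrib (I n) (past L I A n)
      (categorical.comap (fun y => proportion UrnPath.L n (pastPath n y)) (by fun_prop)) μ := by
  refine hasCondDistrib_of_condExp_singleton (h.measurable_past n) (h.measurable_index n)
    fun i => ?_
  filter_upwards [h.index_cond n i, h.ae_proportion_nonneg_sum_eq_one n] with ω hcond hω
  rw [hcond, Kernel.comap_apply, h.proportion_pastPath, categorical_real_singleton hω.1 hω.2]

lemma lintegral_trunc_succ [IsProbabilityMeasure μ] (h : IsContinuousUrn L I A μ) (n : ℕ)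
    {F : UrnPath d → ℝ≥0∞} (hF : Measurable F) :
    ∫⁻ ω, F (UrnPath.trunc (n + 1) (pathOf L I A ω)) ∂μ =
      ∫⁻ ω, ∑ i, ENNReal.ofReal (proportion L n ω i) *
        ∫⁻ a, F (UrnPath.set n (UrnPath.trunc n (pathOf L I A ω)) (i, a))
          ∂(gapMeasure (total L n ω)) ∂μ := by
  let step (y : ((Fin (d + 1) → ℝ) × (Fin n → Fin (d + 1) × ℝ)) × Fin (d + 1)) (a : ℝ) : ℝ≥0∞ :=
    F (UrnPath.set n (pastPath n y.1) (y.2, a))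
  have hstep : Measurable (Function.uncurry step) :=
    hF.comp ((UrnPath.measurable_set n).comp
      (((measurable_pastPath n).comp (by fun_prop)).prodMk (by fun_prop)))
  let c (y : ((Fin (d + 1) → ℝ) × (Fin n → Fin (d + 1) × ℝ)) × Fin (d + 1)) : ℝ :=
    total UrnPath.L n (pastPath n y.1)
  have hgap : Measurable fun y => ∫⁻ a, step y a ∂(clockGap 1 (c y)) :=
    measurable_lintegral_clockGap measurable_const (by fun_prop) hstep
  calc ∫⁻ ω, F (UrnPath.trunc (n + 1) (pathOf L I A ω)) ∂μ
      = ∫⁻ ω, step (past L I A n ω, I n ω) (A n ω) ∂μ := by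
        simp only [UrnPath.trunc_succ, step, pastPath_past]
        rfl
    _ = ∫⁻ ω, ∫⁻ a, step (past L I A n ω, I n ω) a ∂(clockGap 1 (c (past L I A n ω, I n ω))) ∂μ :=
        lintegral_of_hasCondDistrib ((h.measurable_past n).prodMk (h.measurable_index n))
          (h.hasCondDistrib_addition (h.ae_L_pos n)) hstep
    _ = ∫⁻ ω, ∫⁻ i, (∫⁻ a, step (past L I A n ω, i) a ∂(clockGap 1 (c (past L I A n ω, i))))
          ∂(categorical (proportion UrnPath.L n (pastPath n (past L I A n ω)))) ∂μ :=
        lintegral_of_hasCondDistrib (h.measurable_past n) (h.hasCondDistrib_index n)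
          (F := fun x i => ∫⁻ a, step (x, i) a ∂(clockGap 1 (c (x, i)))) hgap
    _ = _ := by
        refine lintegral_congr_ae ?_
        filter_upwards [h.ae_L_pos n, h.ae_proportion_nonneg_sum_eq_one n] with ω hpos hω
        rw [h.proportion_pastPath, lintegral_categorical hω.1 hω.2]
        simp only [step, c, h.total_pastPath, pastPath_past,
          gapMeasure_eq_clockGap (total_pos hpos).le]

end IsContinuousUrn

/-! ### Independent sequences -/

lemma measurable_eval_of_countable {α β ι : Type*} [MeasurableSpace α] [MeasurableSpace β]
    [MeasurableSpace ι] [Countable ι] [MeasurableSingletonClass ι] {f : α → ι → β} {g : α → ι}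
    (hf : ∀ i, Measurable fun x => f x i) (hg : Measurable g) : Measurable fun x => f x (g x) :=
  (measurable_from_prod_countable_left (f := fun z : α × ι => f z.1 z.2) hf).comp
    (measurable_id.prodMk hg)

section InfinitePi

variable {ι : Type*} [DecidableEq ι] {X : ι → Type*} [∀ i, MeasurableSpace (X i)]
  (ρ : ∀ i, Measure (X i)) [∀ i, IsProbabilityMeasure (ρ i)] (j : ι)

lemma map_update_infinitePi :
    ((Measure.infinitePi ρ).prod (ρ j)).map (fun z => Function.update z.1 j z.2) =
      Measure.infinitePi ρ := by
  refine Measure.eq_infinitePi _ fun s t ht => ?_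
  have hbox : (fun z : (∀ i, X i) × X j => Function.update z.1 j z.2) ⁻¹' (s : Set ι).pi t =
      ((s.erase j : Finset ι) : Set ι).pi t ×ˢ (if j ∈ s then t j else Set.univ) := by
    ext z
    simp only [Set.mem_preimage, Set.mem_pi, Finset.mem_coe, Set.mem_prod, Finset.mem_erase]
    constructor
    · intro hz
      refine ⟨fun k hk => by simpa [Function.update_of_ne hk.1] using hz k hk.2, ?_⟩
      split_ifs with hj
      · simpa using hz j hj
      · trivial
    · rintro ⟨hz, hzj⟩ k hk
      by_cases hkj : k = j
      · subst hkj
        simpa [hk] using hzj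
      · simpa [Function.update_of_ne hkj] using hz k ⟨hkj, hk⟩
  rw [Measure.map_apply measurable_update' (.pi s.countable_toSet fun _ _ => ht _), hbox,
    Measure.prod_prod, Measure.infinitePi_pi _ fun i _ => ht i]
  split_ifs with hj
  · rw [mul_comm, Finset.mul_prod_erase s (fun i => ρ i (t i)) hj]
  · rw [measure_univ, mul_one, Finset.erase_eq_of_notMem hj]

lemma lintegral_update_infinitePi {F : (∀ i, X i) → ℝ≥0∞} (hF : Measurable F) :
    ∫⁻ x, ∫⁻ y, F (Function.update x j y) ∂(ρ j) ∂(Measure.infinitePi ρ) =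
      ∫⁻ x, F x ∂(Measure.infinitePi ρ) := by
  conv_rhs => rw [← map_update_infinitePi ρ j]
  rw [lintegral_map hF measurable_update',
    lintegral_prod (fun z : (∀ i, X i) × X j => F (Function.update z.1 j z.2))
      (hF.comp measurable_update').aemeasurable]

lemma lintegral_infinitePi_resample {F : (∀ i, X i) → X j → ℝ≥0∞}
    (hF : Measurable (Function.uncurry F)) (hF_update : ∀ x y, F (Function.update x j y) = F x) :
    ∫⁻ x, F x (x j) ∂(Measure.infinitePi ρ) =
      ∫⁻ x, ∫⁻ y, F x y ∂(ρ j) ∂(Measure.infinitePi ρ) := by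
  rw [← lintegral_update_infinitePi ρ j (F := fun x => F x (x j))
    (hF.comp (by fun_prop : Measurable fun x : ∀ i, X i => (x, x j)))]
  simp only [hF_update, Function.update_self]

end InfinitePi

/-- The law of a sequence of independent random variables of law `κ x`, as a kernel in `x`. -/
def iidKernel {𝓧 𝓨 : Type*} [MeasurableSpace 𝓧] [MeasurableSpace 𝓨] (κ : Kernel 𝓧 𝓨)
    [IsMarkovKernel κ] : Kernel 𝓧 (ℕ → 𝓨) where
  toFun x := Measure.infinitePi fun _ => κ x
  measurable' := by
    refine .measure_of_isPiSystem_of_isProbabilityMeasure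
      (generateFrom_squareCylinders (ι := ℕ) (α := fun _ => 𝓨)).symm
      (isPiSystem_squareCylinders (fun _ => MeasurableSpace.isPiSystem_measurableSet)
        fun _ => .univ) ?_
    rintro _ ⟨s, t, ht, rfl⟩
    have ht_meas : ∀ i, MeasurableSet (t i) := by simpa using ht
    simp only [Measure.infinitePi_pi _ fun i _ => ht_meas i]
    exact Finset.measurable_prod _ fun i _ => κ.measurable_coe (ht_meas i)

instance {𝓧 𝓨 : Type*} [MeasurableSpace 𝓧] [MeasurableSpace 𝓨] (κ : Kernel 𝓧 𝓨)
    [IsMarkovKernel κ] : IsMarkovKernel (iidKernel κ) :=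
  ⟨fun x => inferInstanceAs (IsProbabilityMeasure (Measure.infinitePi fun _ => κ x))⟩

/-- The law of a sequence of independent unit exponential variables. -/
def expSeq : Measure (ℕ → ℝ) := Measure.infinitePi fun _ => expMeasure 1

instance : IsProbabilityMeasure expSeq := by
  unfold expSeq
  infer_instance

lemma map_eval_expSeq (k : ℕ) : expSeq.map (fun x => x k) = expMeasure 1 :=
  Measure.infinitePi_map_eval _ k

lemma ae_expSeq_pos : ∀ᵐ x ∂expSeq, ∀ k, 0 < x k := by
  rw [ae_all_iff]
  intro k
  exact ae_of_ae_map (measurable_pi_apply k).aemeasurable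
    ((map_eval_expSeq k).symm ▸ ae_expMeasure_pos)

lemma jumpTime_succ (x : ℕ → ℝ) (k : ℕ) : jumpTime x (k + 1) = jumpTime x k + x (k + 1) :=
  Finset.sum_range_succ ..

@[fun_prop]
lemma measurable_jumpTime (k : ℕ) : Measurable fun x => jumpTime x k := by
  unfold jumpTime
  fun_prop

lemma jumpTime_pos {x : ℕ → ℝ} (hx : ∀ k, 0 < x k) (k : ℕ) : 0 < jumpTime x k :=
  Finset.sum_pos (fun j _ => hx j) ⟨0, by simp⟩

/-! ### The urn driven by independent clocks -/

/-- The colors chosen at the successive steps, and for each color the successive inter-jump times of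
its clock. -/
abbrev UrnNoise (d : ℕ) : Type := (ℕ → Fin (d + 1)) × (Fin (d + 1) → ℕ → ℝ)

/-- The path of the urn that chooses the colors `c` and in which the quantity of each color `i`,
after `k` choices of that color, is `√(2 p_i t)`, where `t` is the `k`-th jump time of the point
process with inter-jump times `e i`. -/
def clockPath (p : Fin (d + 1) → ℝ) (c : ℕ → Fin (d + 1)) (e : Fin (d + 1) → ℕ → ℝ) : UrnPath d :=
  (fun i => √(2 * p i * jumpTime (e i) 0), fun n =>
    (c n, √(2 * p (c n) * jumpTime (e (c n)) (Nat.count (c · = c n) n + 1)) -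
      √(2 * p (c n) * jumpTime (e (c n)) (Nat.count (c · = c n) n))))

lemma L_clockPath (p : Fin (d + 1) → ℝ) (c : ℕ → Fin (d + 1)) (e : Fin (d + 1) → ℕ → ℝ) (n : ℕ)
    (i : Fin (d + 1)) :
    UrnPath.L n (clockPath p c e) i = √(2 * p i * jumpTime (e i) (Nat.count (c · = i) n)) := by
  induction n with
  | zero => simp [UrnPath.L, clockPath]
  | succ n ih =>
    rw [UrnPath.L, Nat.count_succ]
    by_cases hi : c n = i
    · subst hi
      simp only [clockPath, Function.update_self, if_true]
      rw [← clockPath, ih, add_sub_cancel]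
    · have hi' : i ≠ ((clockPath p c e).2 n).1 := Ne.symm hi
      rw [Function.update_of_ne hi', ih, if_neg hi, add_zero]

lemma count_congr_of_lt {c c' : ℕ → Fin (d + 1)} {n : ℕ} (hc : ∀ k < n, c k = c' k)
    (i : Fin (d + 1)) : Nat.count (c · = i) n = Nat.count (c' · = i) n := by
  induction n with
  | zero => simp
  | succ n ih =>
    rw [Nat.count_succ, Nat.count_succ, ih fun k hk => hc k (by omega), hc n (by omega)]

lemma jumpTime_congr {x y : ℕ → ℝ} {k : ℕ} (hxy : ∀ j ≤ k, x j = y j) :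
    jumpTime x k = jumpTime y k :=
  Finset.sum_congr rfl fun j hj => hxy j (Nat.lt_succ_iff.1 (Finset.mem_range.1 hj))

lemma trunc_clockPath_congr (p : Fin (d + 1) → ℝ) {c c' : ℕ → Fin (d + 1)}
    {e e' : Fin (d + 1) → ℕ → ℝ} {n : ℕ} (hc : ∀ k < n, c k = c' k)
    (he : ∀ i, ∀ k ≤ Nat.count (c · = i) n, e i k = e' i k) :
    UrnPath.trunc n (clockPath p c e) = UrnPath.trunc n (clockPath p c' e') := by
  have hjump (i : Fin (d + 1)) {k : ℕ} (hk : k ≤ Nat.count (c · = i) n) :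
      jumpTime (e i) k = jumpTime (e' i) k :=
    jumpTime_congr fun j hj => he i j (hj.trans hk)
  refine Prod.ext (funext fun i => ?_) (funext fun k => ?_)
  · simp only [UrnPath.trunc, clockPath]
    rw [hjump i (Nat.zero_le _)]
  · by_cases hk : k < n
    · have hcount : Nat.count (c · = c k) k + 1 ≤ Nat.count (c · = c k) n :=
        Nat.count_strict_mono rfl hk
      simp only [UrnPath.trunc, clockPath, hk, if_true]
      rw [hjump _ hcount, hjump _ (Nat.le_of_succ_le hcount), hc k hk,
        count_congr_of_lt fun j hj => hc j (hj.trans hk)]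
    · simp [UrnPath.trunc, hk]

lemma measurable_count (i : Fin (d + 1)) (n : ℕ) :
    Measurable fun c : ℕ → Fin (d + 1) => Nat.count (c · = i) n := by
  induction n with
  | zero => simp
  | succ n ih =>
    simp only [Nat.count_succ]
    exact ih.add (.ite (measurableSet_eq_fun (by fun_prop) measurable_const) measurable_const
      measurable_const)

lemma measurable_clockPath :
    Measurable fun z : (Fin (d + 1) → ℝ) × UrnNoise d =>
      clockPath z.1 z.2.1 z.2.2 := by
  have hsqrt (n k : ℕ) :
      Measurable fun z : (Fin (d + 1) → ℝ) × UrnNoise d =>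
        √(2 * z.1 (z.2.1 n) *
          jumpTime (z.2.2 (z.2.1 n)) (Nat.count (z.2.1 · = z.2.1 n) n + k)) := by
    refine measurable_eval_of_countable (ι := Fin (d + 1)) (g := fun z => z.2.1 n)
      (f := fun (z : (Fin (d + 1) → ℝ) × UrnNoise d) i =>
        √(2 * z.1 i * jumpTime (z.2.2 i) (Nat.count (z.2.1 · = i) n + k)))
      (fun i => ?_) (by fun_prop)
    refine measurable_eval_of_countable (ι := ℕ) (g := fun z => Nat.count (z.2.1 · = i) n)
      (f := fun (z : (Fin (d + 1) → ℝ) × UrnNoise d) m =>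
        √(2 * z.1 i * jumpTime (z.2.2 i) (m + k)))
      (fun m => by fun_prop) ((measurable_count i n).comp (by fun_prop))
  unfold clockPath
  refine Measurable.prodMk (by fun_prop) (measurable_pi_lambda _ fun n => ?_)
  exact Measurable.prodMk (by fun_prop) ((hsqrt n 1).sub (hsqrt n 0))

/-- The law of the colors and the clocks that drive the urn, given the limit proportions: the colors
are chosen independently according to them, and the clocks are independent unit Poisson processes,
described by their inter-jump times. -/
def noiseKernel : Kernel (Fin (d + 1) → ℝ) (UrnNoise d) :=
  iidKernel categorical ×ₖ Kernel.const _ (Measure.infinitePi fun _ => expSeq)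

instance : IsMarkovKernel (noiseKernel (d := d)) := by
  unfold noiseKernel
  infer_instance

/-- The law of the path of the urn, given the limit proportions. -/
def pathKernel : Kernel (Fin (d + 1) → ℝ) (UrnPath d) :=
  (Kernel.id ×ₖ noiseKernel).map fun z => clockPath z.1 z.2.1 z.2.2

instance : IsMarkovKernel (pathKernel (d := d)) :=
  Kernel.IsMarkovKernel.map _ measurable_clockPath

lemma noiseKernel_apply (p : Fin (d + 1) → ℝ) :
    noiseKernel p = (Measure.infinitePi fun _ => categorical p).prod
      (Measure.infinitePi fun _ => expSeq) :=
  Kernel.prod_apply ..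

lemma map_fst_noiseKernel (p : Fin (d + 1) → ℝ) :
    (noiseKernel p).map Prod.fst = Measure.infinitePi fun _ => categorical p := by
  rw [noiseKernel_apply, Measure.map_fst_prod, measure_univ, one_smul]

lemma map_snd_noiseKernel (p : Fin (d + 1) → ℝ) :
    (noiseKernel p).map Prod.snd = Measure.infinitePi fun _ => expSeq := by
  rw [noiseKernel_apply, Measure.map_snd_prod, measure_univ, one_smul]

lemma pathKernel_apply (p : Fin (d + 1) → ℝ) :
    pathKernel p = (noiseKernel p).map fun w => clockPath p w.1 w.2 := by
  rw [pathKernel, Kernel.map_apply _ measurable_clockPath, Kernel.prod_apply, Kernel.id_apply,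
    Measure.dirac_prod, Measure.map_map measurable_clockPath (by fun_prop)]
  rfl

@[fun_prop]
lemma measurable_clockPath_apply (p : Fin (d + 1) → ℝ) :
    Measurable fun w : UrnNoise d => clockPath p w.1 w.2 :=
  measurable_clockPath.comp measurable_prodMk_left

lemma lintegral_pathKernel (p : Fin (d + 1) → ℝ) {F : UrnPath d → ℝ≥0∞} (hF : Measurable F) :
    ∫⁻ z, F z ∂(pathKernel p) = ∫⁻ w, F (clockPath p w.1 w.2) ∂(noiseKernel p) := by
  rw [pathKernel_apply, lintegral_map hF (by fun_prop)]

lemma ae_noiseKernel_pos (p : Fin (d + 1) → ℝ) :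
    ∀ᵐ w ∂(noiseKernel p), ∀ i k, 0 < w.2 i k := by
  refine ae_of_ae_map (p := fun e : Fin (d + 1) → ℕ → ℝ => ∀ i k, 0 < e i k) (by fun_prop) ?_
  rw [map_snd_noiseKernel, ae_all_iff]
  exact fun i => (measurePreserving_eval_infinitePi (fun _ => expSeq) i).quasiMeasurePreserving.ae
    ae_expSeq_pos

/-! ### The law of the first steps -/

lemma lintegral_clocks_resample (i : Fin (d + 1)) (k : ℕ)
    {F : (Fin (d + 1) → ℕ → ℝ) → ℝ → ℝ≥0∞} (hF : Measurable (Function.uncurry F))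
    (hF_update : ∀ e a, F (Function.update e i (Function.update (e i) k a)) = F e) :
    ∫⁻ e, F e (e i k) ∂(Measure.infinitePi fun _ => expSeq) =
      ∫⁻ e, ∫⁻ a, F e a ∂(expMeasure 1) ∂(Measure.infinitePi fun _ => expSeq) := by
  have hresample (e : Fin (d + 1) → ℕ → ℝ) :
      ∫⁻ x, F (Function.update e i x) (x k) ∂expSeq =
        ∫⁻ x, ∫⁻ a, F (Function.update e i x) a ∂(expMeasure 1) ∂expSeq := by
    refine lintegral_infinitePi_resample _ k (F := fun x a => F (Function.update e i x) a)
      (hF.comp (((measurable_update e).comp measurable_fst).prodMk measurable_snd)) fun x a => ?_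
    simpa using hF_update (Function.update e i x) a
  rw [← lintegral_update_infinitePi _ i (F := fun e => F e (e i k)) (hF.comp (by fun_prop :
      Measurable fun e : Fin (d + 1) → ℕ → ℝ => (e, e i k))),
    ← lintegral_update_infinitePi _ i (F := fun e => ∫⁻ a, F e a ∂(expMeasure 1))
      hF.lintegral_prod_right']
  simp only [Function.update_self]
  exact lintegral_congr hresample

lemma lintegral_noiseKernel_resample_color {p : Fin (d + 1) → ℝ} (hp : ∀ i, 0 ≤ p i)
    (hsum : ∑ i, p i = 1) (n : ℕ) {F : UrnNoise d → Fin (d + 1) → ℝ≥0∞}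
    (hF : ∀ i, Measurable fun w => F w i)
    (hF_update : ∀ c e j, F (Function.update c n j, e) = F (c, e)) :
    ∫⁻ w, F w (w.1 n) ∂(noiseKernel p) =
      ∫⁻ w, ∑ i, ENNReal.ofReal (p i) * F w i ∂(noiseKernel p) := by
  have hF_joint : Measurable fun z : UrnNoise d × Fin (d + 1) => F z.1 z.2 :=
    measurable_from_prod_countable_left hF
  rw [noiseKernel_apply, lintegral_prod_symm' _ (measurable_eval_of_countable hF (by fun_prop)),
    lintegral_prod_symm' _ (Finset.measurable_sum _ fun i _ => (hF i).const_mul _)]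
  refine lintegral_congr fun e => ?_
  rw [lintegral_infinitePi_resample _ n (F := fun c => F (c, e)) (hF_joint.comp
    (by fun_prop : Measurable fun z : (ℕ → Fin (d + 1)) × Fin (d + 1) => ((z.1, e), z.2)))
    fun c j => hF_update c e j]
  simp only [lintegral_categorical hp hsum]

lemma lintegral_noiseKernel_resample_clock (p : Fin (d + 1) → ℝ) (i : Fin (d + 1))
    {k : (ℕ → Fin (d + 1)) → ℕ} (hk : Measurable k) {F : UrnNoise d → ℝ → ℝ≥0∞}
    (hF : Measurable (Function.uncurry F))
    (hF_update : ∀ c e a,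
      F (c, Function.update e i (Function.update (e i) (k c) a)) = F (c, e)) :
    ∫⁻ w, F w (w.2 i (k w.1)) ∂(noiseKernel p) =
      ∫⁻ w, ∫⁻ a, F w a ∂(expMeasure 1) ∂(noiseKernel p) := by
  have hgap : Measurable fun w : UrnNoise d => w.2 i (k w.1) :=
    measurable_eval_of_countable (f := fun (w : UrnNoise d) j => w.2 i j) (by fun_prop)
      (hk.comp measurable_fst)
  rw [noiseKernel_apply,
    lintegral_prod (fun w : UrnNoise d => F w (w.2 i (k w.1)))
      (hF.comp (measurable_id.prodMk hgap)).aemeasurable,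
    lintegral_prod (fun w : UrnNoise d => ∫⁻ a, F w a ∂(expMeasure 1))
      hF.lintegral_prod_right'.aemeasurable]
  exact lintegral_congr fun c => lintegral_clocks_resample i (k c) (F := fun e => F (c, e))
    (hF.comp (by fun_prop : Measurable fun z : (Fin (d + 1) → ℕ → ℝ) × ℝ => ((c, z.1), z.2)))
    (hF_update c)

/-- The color of step `n + 1` and the next inter-jump time of its clock are independent of
everything that does not depend on them. -/
lemma lintegral_noiseKernel_resample {p : Fin (d + 1) → ℝ} (hp : ∀ i, 0 ≤ p i)
    (hsum : ∑ i, p i = 1) (n : ℕ) {F : UrnNoise d → Fin (d + 1) → ℝ → ℝ≥0∞}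
    (hF : ∀ i, Measurable fun z : UrnNoise d × ℝ => F z.1 i z.2)
    (hF_color : ∀ c e j, F (Function.update c n j, e) = F (c, e))
    (hF_clock : ∀ c e i a, F (c, Function.update e i
      (Function.update (e i) (Nat.count (c · = i) n + 1) a)) = F (c, e)) :
    ∫⁻ w, F w (w.1 n) (w.2 (w.1 n) (Nat.count (w.1 · = w.1 n) n + 1)) ∂(noiseKernel p) =
      ∫⁻ w, ∑ i, ENNReal.ofReal (p i) * ∫⁻ a, F w i a ∂(expMeasure 1) ∂(noiseKernel p) := by
  have hcount (i : Fin (d + 1)) :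
      Measurable fun c : ℕ → Fin (d + 1) => Nat.count (c · = i) n + 1 :=
    (measurable_count i n).add_const 1
  have hnext (i : Fin (d + 1)) :
      Measurable fun w : UrnNoise d => F w i (w.2 i (Nat.count (w.1 · = i) n + 1)) :=
    (hF i).comp (measurable_id.prodMk (measurable_eval_of_countable
      (f := fun (w : UrnNoise d) k => w.2 i k) (by fun_prop) ((hcount i).comp measurable_fst)))
  have hresampled (i : Fin (d + 1)) :
      Measurable fun w : UrnNoise d => ∫⁻ a, F w i a ∂(expMeasure 1) :=
    (hF i).lintegral_prod_right'
  rw [lintegral_noiseKernel_resample_color hp hsum n (F := fun w i =>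
      F w i (w.2 i (Nat.count (w.1 · = i) n + 1))) hnext fun c e j => ?_,
    lintegral_finsetSum _ fun i _ => (hnext i).const_mul _,
    lintegral_finsetSum _ fun i _ => (hresampled i).const_mul _]
  · refine Finset.sum_congr rfl fun i _ => ?_
    rw [lintegral_const_mul _ (hnext i), lintegral_const_mul _ (hresampled i),
      lintegral_noiseKernel_resample_clock p i (hcount i) (F := fun w => F w i) (hF i)
        fun c e a => congrFun (hF_clock c e i a) i]
  · ext i
    dsimp only
    rw [hF_color, count_congr_of_lt fun k (hk : k < n) => Function.update_of_ne hk.ne j c]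

lemma trunc_clockPath_update_color (p : Fin (d + 1) → ℝ) (c : ℕ → Fin (d + 1))
    (e : Fin (d + 1) → ℕ → ℝ) (n : ℕ) (j : Fin (d + 1)) :
    UrnPath.trunc n (clockPath p (Function.update c n j) e) =
      UrnPath.trunc n (clockPath p c e) :=
  trunc_clockPath_congr p (fun _ hk => Function.update_of_ne hk.ne j c) fun _ _ _ => rfl

lemma trunc_clockPath_update_clock (p : Fin (d + 1) → ℝ) (c : ℕ → Fin (d + 1))
    (e : Fin (d + 1) → ℕ → ℝ) (n : ℕ) (i : Fin (d + 1)) (a : ℝ) :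
    UrnPath.trunc n (clockPath p c (Function.update e i
        (Function.update (e i) (Nat.count (c · = i) n + 1) a))) =
      UrnPath.trunc n (clockPath p c e) := by
  refine trunc_clockPath_congr p (fun _ _ => rfl) fun j k hk => ?_
  by_cases hj : j = i
  · subst hj
    simp [Function.update_of_ne (Nat.lt_succ_of_le hk).ne]
  · rw [Function.update_of_ne hj]

lemma lintegral_trunc_succ_pathKernel {p : Fin (d + 1) → ℝ} (hp : ∀ i, 0 ≤ p i)
    (hsum : ∑ i, p i = 1) (n : ℕ) {F : UrnPath d → ℝ≥0∞} (hF : Measurable F) :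
    ∫⁻ z, F (UrnPath.trunc (n + 1) z) ∂(pathKernel p) =
      ∫⁻ z, ∑ i, ENNReal.ofReal (p i) *
        ∫⁻ a, F (UrnPath.set n (UrnPath.trunc n z) (i, a)) ∂(clockGap (p i) (UrnPath.L n z i))
          ∂(pathKernel p) := by
  let G (z : UrnPath d) (i : Fin (d + 1)) (y : ℝ) : ℝ≥0∞ :=
    F (UrnPath.set n z (i, √(UrnPath.L n z i ^ 2 + 2 * p i * y) - UrnPath.L n z i))
  have hG (i : Fin (d + 1)) : Measurable fun x : UrnPath d × ℝ => G x.1 i x.2 := by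
    simp only [G]
    fun_prop
  have hgap (z : UrnPath d) (i : Fin (d + 1)) :
      ∫⁻ a, F (UrnPath.set n (UrnPath.trunc n z) (i, a)) ∂(clockGap (p i) (UrnPath.L n z i)) =
        ∫⁻ a, G (UrnPath.trunc n z) i a ∂(expMeasure 1) := by
    rw [clockGap, lintegral_map (by fun_prop) (by fun_prop)]
    simp only [G, UrnPath.L_trunc]
  have hnext : ∀ᵐ w ∂(noiseKernel p), F (UrnPath.trunc (n + 1) (clockPath p w.1 w.2)) =
      G (UrnPath.trunc n (clockPath p w.1 w.2)) (w.1 n)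
        (w.2 (w.1 n) (Nat.count (w.1 · = w.1 n) n + 1)) := by
    filter_upwards [ae_noiseKernel_pos p] with w hw
    have hjump := (jumpTime_pos (hw (w.1 n)) (Nat.count (w.1 · = w.1 n) n)).le
    simp only [G, UrnPath.L_trunc, UrnPath.trunc_succ, L_clockPath]
    rw [Real.sq_sqrt (mul_nonneg (mul_nonneg zero_le_two (hp _)) hjump), ← mul_add, ← jumpTime_succ]
    rfl
  have (i : Fin (d + 1)) :
      Measurable fun z : UrnPath d => ∫⁻ a, G (UrnPath.trunc n z) i a ∂(expMeasure 1) :=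
    (hG i).lintegral_prod_right'.comp (UrnPath.measurable_trunc n)
  simp only [hgap]
  rw [lintegral_pathKernel p (by fun_prop), lintegral_pathKernel p (by fun_prop),
    lintegral_congr_ae hnext]
  refine lintegral_noiseKernel_resample hp hsum n
    (F := fun w => G (UrnPath.trunc n (clockPath p w.1 w.2)))
    (fun i => (hG i).comp (by fun_prop : Measurable fun x : UrnNoise d × ℝ =>
      (UrnPath.trunc n (clockPath p x.1.1 x.1.2), x.2)))
    (fun c e j => ?_) (fun c e i a => ?_)
  · simp only [trunc_clockPath_update_color]
  · simp only [trunc_clockPath_update_clock]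

lemma map_initial_pathKernel {p : Fin (d + 1) → ℝ} :
    (pathKernel p).map Prod.fst = Measure.pi fun i => clockGap (p i) 0 := by
  have hgap (i : Fin (d + 1)) :
      expSeq.map (fun x => √(2 * p i * jumpTime x 0)) = clockGap (p i) 0 := by
    rw [clockGap, ← map_eval_expSeq 0, Measure.map_map (by fun_prop) (by fun_prop)]
    congr 1
    ext x
    simp [jumpTime]
  calc (pathKernel p).map Prod.fst
      = (noiseKernel p).map fun w i => √(2 * p i * jumpTime (w.2 i) 0) := by
        rw [pathKernel_apply, Measure.map_map (by fun_prop) (by fun_prop)]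
        rfl
    _ = (Measure.infinitePi fun _ => expSeq).map fun e i => √(2 * p i * jumpTime (e i) 0) := by
        rw [← map_snd_noiseKernel p, Measure.map_map (by fun_prop) (by fun_prop)]
        rfl
    _ = Measure.pi fun i => clockGap (p i) 0 := by
        rw [Measure.infinitePi_map_pi (f := fun i x => √(2 * p i * jumpTime x 0)) _ (by fun_prop)]
        simp only [hgap, Measure.infinitePi_eq_pi]

/-! ### The urn as a mixture -/

namespace UrnPath

lemma tendsto_trunc (z : UrnPath d) : Tendsto (fun n => trunc n z) atTop (𝓝 z) := by
  refine Tendsto.prodMk_nhds tendsto_const_nhds (tendsto_pi_nhds.2 fun k => ?_)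
  refine tendsto_const_nhds.congr' ?_
  filter_upwards [eventually_gt_atTop k] with n hn
  simp [hn]

lemma ext_of_lintegral_trunc {ρ σ : Measure (UrnPath d)} [IsFiniteMeasure ρ] [IsFiniteMeasure σ]
    (h : ∀ n, ∀ F : UrnPath d → ℝ≥0∞, Measurable F →
      ∫⁻ z, F (trunc n z) ∂ρ = ∫⁻ z, F (trunc n z) ∂σ) : ρ = σ := by
  refine ext_of_forall_lintegral_eq_of_IsFiniteMeasure fun f => ?_
  have hf : Measurable fun z => (f z : ℝ≥0∞) := f.continuous.measurable.coe_nnreal_ennreal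
  have hlim (τ : Measure (UrnPath d)) [IsFiniteMeasure τ] :
      Tendsto (fun n => ∫⁻ z, f (trunc n z) ∂τ) atTop (𝓝 (∫⁻ z, f z ∂τ)) := by
    refine tendsto_lintegral_of_dominated_convergence (fun _ => (nndist f 0 : ℝ≥0∞))
      (fun n => hf.comp (measurable_trunc n)) (fun n => ae_of_all _ fun z => ?_)
      (by simp [ENNReal.mul_eq_top]) (ae_of_all _ fun z => ?_)
    · exact ENNReal.coe_le_coe.2 (BoundedContinuousFunction.NNReal.upper_bound f _)
    · exact (ENNReal.continuous_coe.comp f.continuous).continuousAt.tendsto.comp (tendsto_trunc z)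
  exact tendsto_nhds_unique (hlim ρ) ((hlim σ).congr fun n => (h n _ hf).symm)

end UrnPath

lemma measurable_lintegral_clockGap_set (n : ℕ) {F : UrnPath d → (Fin (d + 1) → ℝ) → ℝ≥0∞}
    (hF : Measurable (Function.uncurry F)) :
    Measurable (Function.uncurry fun (z : UrnPath d) (p : Fin (d + 1) → ℝ) =>
      ∑ i, ENNReal.ofReal (p i) *
        ∫⁻ a, F (UrnPath.set n z (i, a)) p ∂(clockGap (p i) (UrnPath.L n z i))) := by
  refine Finset.measurable_sum _ fun i _ => (by fun_prop : Measurable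
    fun x : UrnPath d × (Fin (d + 1) → ℝ) => ENNReal.ofReal (x.2 i)).mul
      (measurable_lintegral_clockGap (by fun_prop) (by fun_prop) ?_)
  exact hF.comp (by fun_prop : Measurable fun y : (UrnPath d × (Fin (d + 1) → ℝ)) × ℝ =>
    (UrnPath.set n y.1.1 (i, y.2), y.1.2))

lemma lintegral_posterior_set (n : ℕ) {z : UrnPath d} (hz : ∀ i, 0 < UrnPath.L n z i)
    {F : UrnPath d → (Fin (d + 1) → ℝ) → ℝ≥0∞} (hF : Measurable (Function.uncurry F)) :
    ∫⁻ p, ∑ i, ENNReal.ofReal (p i) *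
        ∫⁻ a, F (UrnPath.set n z (i, a)) p ∂(clockGap (p i) (UrnPath.L n z i))
          ∂(posterior (UrnPath.L n z)) =
      ∑ i, ENNReal.ofReal (UrnPath.L n z i / ∑ j, UrnPath.L n z j) *
        ∫⁻ a, (∫⁻ p, F (UrnPath.set n z (i, a)) p
          ∂(posterior (UrnPath.L (n + 1) (UrnPath.set n z (i, a)))))
          ∂(gapMeasure (∑ j, UrnPath.L n z j)) := by
  simp only [UrnPath.L_succ_set]
  exact lintegral_posterior_step hz (F := fun i p a => F (UrnPath.set n z (i, a)) p) fun i =>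
    hF.comp (by fun_prop : Measurable fun x : (Fin (d + 1) → ℝ) × ℝ =>
      (UrnPath.set n z (i, x.2), x.1))

namespace IsContinuousUrn

variable {Ω : Type*} [MeasurableSpace Ω] {μ : Measure Ω} [IsProbabilityMeasure μ]
  {L : ℕ → Ω → Fin (d + 1) → ℝ} {I : ℕ → Ω → Fin (d + 1)} {A : ℕ → Ω → ℝ}

lemma lintegral_trunc_zero_mixture (h : IsContinuousUrn L I A μ)
    {F : UrnPath d → (Fin (d + 1) → ℝ) → ℝ≥0∞} (hF : Measurable (Function.uncurry F)) :
    ∫⁻ p, (∫⁻ z, F (UrnPath.trunc 0 z) p ∂(pathKernel p)) ∂(dirichletMeasure fun _ => 1 / 2) =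
      ∫⁻ ω, ∫⁻ p, F (UrnPath.trunc 0 (pathOf L I A ω)) p ∂(posterior (L 0 ω)) ∂μ := by
  let G (l p : Fin (d + 1) → ℝ) : ℝ≥0∞ := F (l, fun _ => (0, 0)) p
  have hG : Measurable (Function.uncurry G) :=
    hF.comp (by fun_prop : Measurable fun x : (Fin (d + 1) → ℝ) × (Fin (d + 1) → ℝ) =>
      (((x.1, fun _ => (0, 0)) : UrnPath d), x.2))
  have htrunc (z : UrnPath d) (p : Fin (d + 1) → ℝ) : F (UrnPath.trunc 0 z) p = G z.1 p := by
    simp [UrnPath.trunc, G]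
  have hpath (p : Fin (d + 1) → ℝ) : ∫⁻ z, G z.1 p ∂(pathKernel p) =
      ∫⁻ l, G l p ∂(Measure.pi fun i => clockGap (p i) 0) := by
    rw [← map_initial_pathKernel,
      lintegral_map (f := fun l => G l p) (hG.comp measurable_prodMk_right) measurable_fst]
  simp only [htrunc, hpath, lintegral_dirichletMeasure_half hG, pathOf]
  exact (h.lintegral_initial (measurable_lintegral_posterior measurable_id hG)).symm

/-- With `p` standing for the parameter of the mixture, this says that the conditional law of `p`
given the history up to step `n` is `posterior (L n)`. -/
lemma lintegral_trunc_mixture (h : IsContinuousUrn L I A μ) (n : ℕ)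
    {F : UrnPath d → (Fin (d + 1) → ℝ) → ℝ≥0∞} (hF : Measurable (Function.uncurry F)) :
    ∫⁻ p, (∫⁻ z, F (UrnPath.trunc n z) p ∂(pathKernel p)) ∂(dirichletMeasure fun _ => 1 / 2) =
      ∫⁻ ω, ∫⁻ p, F (UrnPath.trunc n (pathOf L I A ω)) p ∂(posterior (L n ω)) ∂μ := by
  induction n generalizing F with
  | zero => exact h.lintegral_trunc_zero_mixture hF
  | succ n ih =>
    let next (z : UrnPath d) (p : Fin (d + 1) → ℝ) : ℝ≥0∞ := ∑ i, ENNReal.ofReal (p i) *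
      ∫⁻ a, F (UrnPath.set n z (i, a)) p ∂(clockGap (p i) (UrnPath.L n z i))
    let cond (z : UrnPath d) : ℝ≥0∞ := ∫⁻ p, F z p ∂(posterior (UrnPath.L (n + 1) z))
    have hcond : Measurable cond := measurable_lintegral_posterior (UrnPath.measurable_L _) hF
    calc ∫⁻ p, (∫⁻ z, F (UrnPath.trunc (n + 1) z) p ∂(pathKernel p))
          ∂(dirichletMeasure fun _ => 1 / 2)
        = ∫⁻ p, (∫⁻ z, next (UrnPath.trunc n z) p ∂(pathKernel p))
            ∂(dirichletMeasure fun _ => 1 / 2) := by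
          refine lintegral_congr_ae ?_
          filter_upwards [ae_dirichletMeasure_pos _] with p hp
          rw [lintegral_trunc_succ_pathKernel (fun i => (hp.1 i).le) hp.2 n (F := fun z => F z p)
            (hF.comp measurable_prodMk_right)]
          simp only [next, UrnPath.L_trunc]
      _ = ∫⁻ ω, ∫⁻ p, next (UrnPath.trunc n (pathOf L I A ω)) p ∂(posterior (L n ω)) ∂μ :=
          ih (measurable_lintegral_clockGap_set n hF)
      _ = ∫⁻ ω, ∑ i, ENNReal.ofReal (proportion L n ω i) *
            ∫⁻ a, cond (UrnPath.set n (UrnPath.trunc n (pathOf L I A ω)) (i, a))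
              ∂(gapMeasure (total L n ω)) ∂μ := by
          refine lintegral_congr_ae ?_
          filter_upwards [h.ae_L_pos n] with ω hω
          have hL : UrnPath.L n (UrnPath.trunc n (pathOf L I A ω)) = L n ω := by
            rw [UrnPath.L_trunc, h.L_pathOf]
          simp only [proportion, total, ← hL] at hω ⊢
          exact lintegral_posterior_set n hω hF
      _ = ∫⁻ ω, ∫⁻ p, F (UrnPath.trunc (n + 1) (pathOf L I A ω)) p
            ∂(posterior (L (n + 1) ω)) ∂μ := by
          rw [← h.lintegral_trunc_succ n hcond]
          simp only [cond, UrnPath.L_trunc, h.L_pathOf]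

lemma isProbabilityMeasure_dirichletMeasure_half (h : IsContinuousUrn L I A μ) :
    IsProbabilityMeasure (dirichletMeasure fun _ : Fin (d + 1) => 1 / 2) := by
  have hmass := h.lintegral_trunc_mixture 0 (F := fun _ _ => 1) measurable_const
  have hposterior : ∫⁻ ω, posterior (L 0 ω) Set.univ ∂μ = 1 := by
    rw [lintegral_congr_ae (g := fun _ => 1), lintegral_one, measure_univ]
    filter_upwards [h.ae_L_pos 0] with ω hω
    exact (isProbabilityMeasure_posterior hω).measure_univ
  simp only [lintegral_one, measure_univ, hposterior] at hmass
  exact ⟨hmass⟩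

lemma map_pathOf (h : IsContinuousUrn L I A μ) :
    μ.map (pathOf L I A) = pathKernel ∘ₘ (dirichletMeasure fun _ => 1 / 2) := by
  have := h.isProbabilityMeasure_dirichletMeasure_half
  have := Measure.isFiniteMeasure_map μ (pathOf L I A)
  refine UrnPath.ext_of_lintegral_trunc fun n F hF => ?_
  have htrunc : Measurable fun z => F (UrnPath.trunc n z) := hF.comp (UrnPath.measurable_trunc n)
  rw [lintegral_map htrunc h.measurable_pathOf, Measure.lintegral_bind (by fun_prop) (by fun_prop),
    h.lintegral_trunc_mixture n (F := fun z _ => F z) (hF.comp measurable_fst)]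
  refine lintegral_congr_ae ?_
  filter_upwards [h.ae_L_pos n] with ω hω
  have := isProbabilityMeasure_posterior hω
  rw [lintegral_const, measure_univ, mul_one]

end IsContinuousUrn

/-! ### Sums of independent exponential variables -/

lemma ae_tendsto_average_infinitePi {𝓨 : Type*} [MeasurableSpace 𝓨] {ρ : Measure 𝓨}
    [IsProbabilityMeasure ρ] {f : 𝓨 → ℝ} (hf : Measurable f) (hint : Integrable f ρ) :
    ∀ᵐ x ∂(Measure.infinitePi fun _ : ℕ => ρ),
      Tendsto (fun n : ℕ => (∑ k ∈ Finset.range n, f (x k)) / n) atTop (𝓝 (∫ y, f y ∂ρ)) := by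
  have heval (k : ℕ) := measurePreserving_eval_infinitePi (fun _ : ℕ => ρ) k
  have hindep : iIndepFun (fun (k : ℕ) (x : ℕ → 𝓨) => f (x k)) (Measure.infinitePi fun _ => ρ) :=
    iIndepFun_infinitePi (X := fun _ y => f y) fun _ => hf
  have hident (k : ℕ) : IdentDistrib (fun x : ℕ → 𝓨 => f (x k)) (fun x => f (x 0))
      (Measure.infinitePi fun _ => ρ) (Measure.infinitePi fun _ => ρ) :=
    (IdentDistrib.mk (heval k).aemeasurable (heval 0).aemeasurable
      ((heval k).map_eq.trans (heval 0).map_eq.symm)).comp hf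
  have hmean : ∫ x, f (x 0) ∂(Measure.infinitePi fun _ : ℕ => ρ) = ∫ y, f y ∂ρ := by
    conv_rhs => rw [← (heval 0).map_eq]
    rw [integral_map (heval 0).aemeasurable hf.aestronglyMeasurable]
  rw [← hmean]
  exact strong_law_ae_real (fun (k : ℕ) (x : ℕ → 𝓨) => f (x k))
    ((heval 0).integrable_comp_of_integrable hint) (fun i j hij => hindep.indepFun hij) hident

lemma lintegral_id_expMeasure : ∫⁻ y, ENNReal.ofReal y ∂(expMeasure 1) = 1 := by
  have hGamma := Real.Gamma_eq_integral (s := 2) (by norm_num)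
  rw [Real.Gamma_two] at hGamma
  rw [lintegral_expMeasure_one (by fun_prop), ← ENNReal.ofReal_one, hGamma,
    ofReal_integral_eq_lintegral_ofReal (Real.GammaIntegral_convergent (by norm_num))]
  · refine setLIntegral_congr_fun measurableSet_Ioi fun y _ => ?_
    rw [← ENNReal.ofReal_mul (Real.exp_pos _).le]
    norm_num
  · filter_upwards [self_mem_ae_restrict measurableSet_Ioi] with y hy
    exact mul_nonneg (Real.exp_pos _).le (Real.rpow_nonneg (Set.mem_Ioi.1 hy).le _)

lemma integrable_id_expMeasure : Integrable (fun y : ℝ => y) (expMeasure 1) := by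
  refine ⟨measurable_id.aestronglyMeasurable, ?_⟩
  rw [hasFiniteIntegral_iff_ofReal (ae_expMeasure_pos.mono fun y hy => hy.le),
    lintegral_id_expMeasure]
  exact ENNReal.one_lt_top

lemma integral_id_expMeasure : ∫ y, y ∂(expMeasure 1) = 1 := by
  rw [integral_eq_lintegral_of_nonneg_ae (ae_expMeasure_pos.mono fun y hy => hy.le)
    measurable_id.aestronglyMeasurable, lintegral_id_expMeasure, ENNReal.toReal_one]

lemma ae_tendsto_jumpTime_div_expSeq :
    ∀ᵐ x ∂expSeq, Tendsto (fun k : ℕ => jumpTime x k / (k + 1)) atTop (𝓝 1) := by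
  have hslln := ae_tendsto_average_infinitePi measurable_id integrable_id_expMeasure
  filter_upwards [hslln] with x hx
  rw [integral_congr_ae (ae_of_all _ fun _ => id_def _), integral_id_expMeasure] at hx
  simpa [jumpTime, Function.comp_def] using hx.comp (tendsto_add_atTop_nat 1)

lemma ae_tendsto_jumpTime_expSeq : ∀ᵐ x ∂expSeq, Tendsto (jumpTime x) atTop atTop := by
  filter_upwards [ae_tendsto_jumpTime_div_expSeq] with x hx
  have hlinear : Tendsto (fun k : ℕ => (k : ℝ) + 1) atTop atTop :=
    tendsto_atTop_add_const_right _ _ tendsto_natCast_atTop_atTop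
  refine (hx.pos_mul_atTop one_pos hlinear).congr fun k => ?_
  exact div_mul_cancel₀ _ k.cast_add_one_ne_zero

/-! ### Counting jumps -/

@[fun_prop]
lemma measurable_jumpCount (s t : ℝ) : Measurable (jumpCount s t) :=
  measurable_ncard.comp (measurable_set_iff.2 fun k =>
    (measurable_jumpTime k measurableSet_Ioc).mem)

lemma finite_jumps {x : ℕ → ℝ} (hx : Tendsto (jumpTime x) atTop atTop) (s t : ℝ) :
    {k : ℕ | jumpTime x k ∈ Set.Ioc s t}.Finite := by
  obtain ⟨N, hN⟩ := eventually_atTop.1 (hx.eventually_gt_atTop t)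
  refine (Set.finite_lt_nat N).subset fun k hk => ?_
  by_contra hNk
  exact absurd hk.2 (not_le.2 (hN k (not_lt.1 hNk)))

/-- The sequence of inter-jump times with a first one `a` put in front of `x`. -/
def consSeq (a : ℝ) (x : ℕ → ℝ) : ℕ → ℝ
  | 0 => a
  | k + 1 => x k

lemma measurable_consSeq : Measurable fun z : ℝ × (ℕ → ℝ) => consSeq z.1 z.2 := by
  refine measurable_pi_lambda _ fun k => ?_
  cases k <;> simp only [consSeq] <;> fun_prop

lemma jumpTime_consSeq_zero (a : ℝ) (x : ℕ → ℝ) : jumpTime (consSeq a x) 0 = a := by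
  simp [jumpTime, consSeq]

lemma jumpTime_consSeq_succ (a : ℝ) (x : ℕ → ℝ) (k : ℕ) :
    jumpTime (consSeq a x) (k + 1) = a + jumpTime x k := by
  rw [jumpTime, Finset.sum_range_succ', jumpTime, add_comm]
  rfl

lemma jumpTime_consSeq_add (a c : ℝ) (x : ℕ → ℝ) (k : ℕ) :
    jumpTime (consSeq (a + c) x) k = jumpTime (consSeq a x) k + c := by
  cases k with
  | zero => simp only [jumpTime_consSeq_zero]
  | succ k => simp only [jumpTime_consSeq_succ, add_right_comm]

lemma jumpTime_consSeq_succ_mem_Ioc {a s t : ℝ} {x : ℕ → ℝ} {k : ℕ} :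
    jumpTime (consSeq a x) (k + 1) ∈ Set.Ioc s t ↔ jumpTime x k ∈ Set.Ioc (s - a) (t - a) := by
  rw [jumpTime_consSeq_succ, Set.mem_Ioc, Set.mem_Ioc, sub_lt_iff_lt_add', le_sub_iff_add_le']

lemma jumpCount_consSeq_of_mem {a s t : ℝ} {x : ℕ → ℝ} (ha : a ∈ Set.Ioc s t)
    (hx : Tendsto (jumpTime x) atTop atTop) :
    jumpCount s t (consSeq a x) = jumpCount (s - a) (t - a) x + 1 := by
  have hjumps : {k : ℕ | jumpTime (consSeq a x) k ∈ Set.Ioc s t} =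
      insert 0 (Nat.succ '' {k : ℕ | jumpTime x k ∈ Set.Ioc (s - a) (t - a)}) := by
    ext k
    cases k with
    | zero => simpa [jumpTime_consSeq_zero] using ha
    | succ k => simpa using jumpTime_consSeq_succ_mem_Ioc
  rw [jumpCount, hjumps, Set.ncard_insert_of_notMem (by simp) ((finite_jumps hx _ _).image _),
    Set.ncard_image_of_injective _ Nat.succ_injective, jumpCount]

lemma jumpCount_consSeq_of_notMem {a s t : ℝ} {x : ℕ → ℝ} (ha : a ∉ Set.Ioc s t) :
    jumpCount s t (consSeq a x) = jumpCount (s - a) (t - a) x := by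
  have hjumps : {k : ℕ | jumpTime (consSeq a x) k ∈ Set.Ioc s t} =
      Nat.succ '' {k : ℕ | jumpTime x k ∈ Set.Ioc (s - a) (t - a)} := by
    ext k
    cases k with
    | zero => simpa [jumpTime_consSeq_zero] using ha
    | succ k => simpa using jumpTime_consSeq_succ_mem_Ioc
  rw [jumpCount, hjumps, Set.ncard_image_of_injective _ Nat.succ_injective, jumpCount]

lemma jumpCount_consSeq_add (a c s t : ℝ) (x : ℕ → ℝ) :
    jumpCount s t (consSeq (a + c) x) = jumpCount (s - c) (t - c) (consSeq a x) := by
  simp only [jumpCount, jumpTime_consSeq_add, Set.mem_Ioc, sub_lt_iff_lt_add, le_sub_iff_add_le]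

lemma jumpCount_eq_of_nonpos {x : ℕ → ℝ} (hx : ∀ k, 0 < x k) {s : ℝ} (hs : s ≤ 0) (t : ℝ) :
    jumpCount s t x = jumpCount 0 t x := by
  have hpos := jumpTime_pos hx
  simp only [jumpCount, Set.mem_Ioc, hpos, fun k => hs.trans_lt (hpos k)]

lemma jumpCount_consSeq_eq_zero {a s t : ℝ} {x : ℕ → ℝ} (hx : ∀ k, 0 < x k) (ha : t < a) :
    jumpCount s t (consSeq a x) = 0 := by
  have hlate (k : ℕ) : t < jumpTime (consSeq a x) k := by
    cases k with
    | zero => rwa [jumpTime_consSeq_zero]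
    | succ k =>
      rw [jumpTime_consSeq_succ]
      linarith [jumpTime_pos hx k]
  simp [jumpCount, fun k => (hlate k).not_ge]

/-- The numbers of jumps in the successive intervals `(t k, t (k + 1)]`. -/
def jumpCounts (t : ℕ → ℝ) (x : ℕ → ℝ) : ℕ → ℕ := fun k => jumpCount (t k) (t (k + 1)) x

@[fun_prop]
lemma measurable_jumpCounts (t : ℕ → ℝ) : Measurable (jumpCounts t) :=
  measurable_pi_lambda _ fun _ => measurable_jumpCount _ _

lemma jumpCounts_consSeq_of_le {a : ℝ} {t : ℕ → ℝ} (ha : ∀ k, a ≤ t k) (x : ℕ → ℝ) :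
    jumpCounts t (consSeq a x) = jumpCounts (fun k => t k - a) x :=
  funext fun k => jumpCount_consSeq_of_notMem fun ha_mem => (ha k).not_gt ha_mem.1

lemma jumpCounts_consSeq_add (a c : ℝ) (t x : ℕ → ℝ) :
    jumpCounts t (consSeq (a + c) x) = jumpCounts (fun k => t k - c) (consSeq a x) :=
  funext fun _ => jumpCount_consSeq_add ..

/-! ### Independence of the increments -/

lemma eq_infinitePi_of_range {𝓨 : Type*} [MeasurableSpace 𝓨] {ρ : ℕ → Measure 𝓨}
    [∀ k, IsProbabilityMeasure (ρ k)] {ν : Measure (ℕ → 𝓨)}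
    (hν : ∀ (n : ℕ) (B : ℕ → Set 𝓨), (∀ k, MeasurableSet (B k)) →
      ν ((Finset.range n : Set ℕ).pi B) = ∏ k ∈ Finset.range n, ρ k (B k)) :
    ν = Measure.infinitePi ρ := by
  classical
  refine Measure.eq_infinitePi _ fun s B hB => ?_
  obtain ⟨n, hn⟩ := s.exists_nat_subset_range
  let B' (k : ℕ) : Set 𝓨 := if k ∈ s then B k else Set.univ
  have hB' (k : ℕ) : MeasurableSet (B' k) := by
    by_cases hk : k ∈ s <;> simp [B', hk, hB k]
  have hbox : (s : Set ℕ).pi B = (Finset.range n : Set ℕ).pi B' := by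
    ext x
    refine ⟨fun hx k _ => ?_, fun hx k hk => ?_⟩
    · by_cases hk : k ∈ s
      · simpa [B', hk] using hx k hk
      · simp [B', hk]
    · simpa [B', Finset.mem_coe.1 hk] using hx k (hn hk)
  rw [hbox, hν n B' hB', ← Finset.prod_subset hn fun k _ hk => by simp [B', hk]]
  exact Finset.prod_congr rfl fun k hk => by simp [B', hk]

lemma mem_pi_range_succ {𝓨 : Type*} {n : ℕ} {B : ℕ → Set 𝓨} {x : ℕ → 𝓨} :
    x ∈ (Finset.range (n + 1) : Set ℕ).pi B ↔
      x 0 ∈ B 0 ∧ (fun k => x (k + 1)) ∈ (Finset.range n : Set ℕ).pi fun k => B (k + 1) := by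
  simp only [Set.mem_pi, Finset.mem_coe, Finset.mem_range, Nat.forall_lt_succ_left]

lemma map_consSeq_expSeq :
    ((expMeasure 1).prod expSeq).map (fun z => consSeq z.1 z.2) = expSeq := by
  refine eq_infinitePi_of_range fun n B hB => ?_
  rw [Measure.map_apply measurable_consSeq (.pi (Finset.countable_toSet _) fun k _ => hB k)]
  cases n with
  | zero => simp
  | succ n =>
    have hbox : (fun z : ℝ × (ℕ → ℝ) => consSeq z.1 z.2) ⁻¹' (Finset.range (n + 1) : Set ℕ).pi B =
        B 0 ×ˢ (Finset.range n : Set ℕ).pi fun k => B (k + 1) :=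
      Set.ext fun z => mem_pi_range_succ
    rw [hbox, Measure.prod_prod, expSeq, Measure.infinitePi_pi _ fun k _ => hB (k + 1),
      Finset.prod_range_succ', mul_comm]

lemma setLIntegral_Ioi_exp_shift (c : ℝ) (Φ : ℝ → ℝ≥0∞) :
    ∫⁻ a in Set.Ioi c, ENNReal.ofReal (Real.exp (-a)) * Φ a =
      ENNReal.ofReal (Real.exp (-c)) *
        ∫⁻ b in Set.Ioi 0, ENNReal.ofReal (Real.exp (-b)) * Φ (b + c) := by
  rw [← lintegral_const_mul' _ _ ENNReal.ofReal_ne_top, ← lintegral_indicator measurableSet_Ioi,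
    ← lintegral_indicator measurableSet_Ioi, ← lintegral_add_right_eq_self _ c]
  refine lintegral_congr fun b => ?_
  by_cases hb : 0 < b
  · rw [Set.indicator_of_mem (by simpa using hb), Set.indicator_of_mem (by simpa using hb),
      ← mul_assoc, ← ENNReal.ofReal_mul (Real.exp_pos _).le, ← Real.exp_add, neg_add_rev]
  · rw [Set.indicator_of_notMem (by simpa using hb), Set.indicator_of_notMem (by simpa using hb)]

lemma expSeq_eq_lintegral_consSeq {E : Set (ℕ → ℝ)} (hE : MeasurableSet E) :
    expSeq E = ∫⁻ a in Set.Ioi 0, ENNReal.ofReal (Real.exp (-a)) *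
      expSeq {x | consSeq a x ∈ E} := by
  have hpre := measurable_consSeq hE
  conv_lhs => rw [← map_consSeq_expSeq]
  rw [Measure.map_apply measurable_consSeq hE, Measure.prod_apply hpre,
    lintegral_expMeasure_one (measurable_measure_prodMk_left hpre)]
  rfl

lemma expSeq_eq_add_lintegral_consSeq {T : ℝ} (hT : 0 ≤ T) {E : Set (ℕ → ℝ)}
    (hE : MeasurableSet E) :
    expSeq E = (∫⁻ a in Set.Ioc 0 T, ENNReal.ofReal (Real.exp (-a)) *
        expSeq {x | consSeq a x ∈ E}) +
      ENNReal.ofReal (Real.exp (-T)) * ∫⁻ b in Set.Ioi 0, ENNReal.ofReal (Real.exp (-b)) *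
        expSeq {x | consSeq (b + T) x ∈ E} := by
  rw [expSeq_eq_lintegral_consSeq hE, ← setLIntegral_Ioi_exp_shift T
      fun a => expSeq {x | consSeq a x ∈ E}, ← Set.Ioc_union_Ioi_eq_Ioi hT,
    lintegral_union measurableSet_Ioi (Set.Ioc_disjoint_Ioi le_rfl)]

lemma lintegral_exp_mul_poissonMeasure {T : ℝ} (hT : 0 ≤ T) (n : ℕ) :
    ∫⁻ a in Set.Ioc 0 T, ENNReal.ofReal (Real.exp (-a)) * poissonMeasure (T - a).toNNReal {n} =
      poissonMeasure T.toNNReal {n + 1} := by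
  have hintegrand : ∀ a ∈ Set.Ioc 0 T, ENNReal.ofReal (Real.exp (-a)) *
      poissonMeasure (T - a).toNNReal {n} =
      ENNReal.ofReal (Real.exp (-T) / n.factorial * (T - a) ^ n) := by
    intro a ha
    rw [poissonMeasure_singleton, Real.coe_toNNReal _ (sub_nonneg.2 ha.2),
      ← ENNReal.ofReal_mul (Real.exp_pos _).le, mul_div_assoc, ← mul_assoc, ← Real.exp_add,
      mul_div_assoc', div_mul_eq_mul_div]
    ring_nf
  have hnonneg : ∀ᵐ a ∂(volume.restrict (Set.Ioc 0 T)),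
      0 ≤ Real.exp (-T) / n.factorial * (T - a) ^ n := by
    filter_upwards [self_mem_ae_restrict measurableSet_Ioc] with a ha
    have := sub_nonneg.2 ha.2
    positivity
  have hcont : Continuous fun a : ℝ => Real.exp (-T) / n.factorial * (T - a) ^ n := by fun_prop
  rw [setLIntegral_congr_fun measurableSet_Ioc hintegrand, ← ofReal_integral_eq_lintegral_ofReal
    (hcont.integrableOn_Icc.mono_set Set.Ioc_subset_Icc_self) hnonneg,
    ← intervalIntegral.integral_of_le hT, intervalIntegral.integral_const_mul,
    intervalIntegral.integral_comp_sub_left (fun x => x ^ n) T, integral_pow,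
    poissonMeasure_singleton, Real.coe_toNNReal _ hT, Nat.factorial_succ]
  congr 1
  push_cast
  simp only [sub_self, sub_zero, ne_eq, Nat.succ_ne_zero, not_false_eq_true, zero_pow]
  field_simp

lemma measurableSet_jumpCount_and {T : ℝ} {t : ℕ → ℝ} {B : Set ℕ} {S : Set (ℕ → ℕ)}
    (hS : MeasurableSet S) : MeasurableSet {x | jumpCount 0 T x ∈ B ∧ jumpCounts t x ∈ S} :=
  (measurable_jumpCount 0 T .of_discrete).inter (measurable_jumpCounts t hS)

lemma expSeq_jumpCount_zero_and {T : ℝ} (hT : 0 ≤ T) (t : ℕ → ℝ) {S : Set (ℕ → ℕ)}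
    (hS : MeasurableSet S) :
    expSeq {x | jumpCount 0 T x ∈ ({0} : Set ℕ) ∧ jumpCounts t x ∈ S} =
      poissonMeasure T.toNNReal {0} * expSeq {x | jumpCounts (fun k => t k - T) x ∈ S} := by
  have hearly : ∀ a ∈ Set.Ioc 0 T, ENNReal.ofReal (Real.exp (-a)) * expSeq {x | consSeq a x ∈
      {x | jumpCount 0 T x ∈ ({0} : Set ℕ) ∧ jumpCounts t x ∈ S}} = 0 := by
    intro a ha
    refine mul_eq_zero_of_right _ (measure_eq_zero_iff_ae_notMem.2 ?_)
    filter_upwards [ae_tendsto_jumpTime_expSeq] with x hx hmem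
    have hzero : jumpCount 0 T (consSeq a x) = 0 := hmem.1
    rw [jumpCount_consSeq_of_mem ha hx] at hzero
    exact Nat.succ_ne_zero _ hzero
  have hlate : ∀ b ∈ Set.Ioi (0 : ℝ), ENNReal.ofReal (Real.exp (-b)) *
      expSeq {x | consSeq (b + T) x ∈
        {x | jumpCount 0 T x ∈ ({0} : Set ℕ) ∧ jumpCounts t x ∈ S}} =
      ENNReal.ofReal (Real.exp (-b)) *
        expSeq {x | consSeq b x ∈ {x | jumpCounts (fun k => t k - T) x ∈ S}} := by
    intro b hb
    congr 1
    refine measure_congr ?_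
    filter_upwards [ae_expSeq_pos] with x hx
    refine propext ((and_iff_right ?_).trans ?_)
    · exact jumpCount_consSeq_eq_zero hx (lt_add_of_pos_left T hb)
    · rw [jumpCounts_consSeq_add]
      rfl
  rw [expSeq_eq_add_lintegral_consSeq hT (measurableSet_jumpCount_and hS),
    setLIntegral_congr_fun measurableSet_Ioc hearly, lintegral_zero, zero_add,
    setLIntegral_congr_fun measurableSet_Ioi hlate,
    ← expSeq_eq_lintegral_consSeq (E := {x | jumpCounts (fun k => t k - T) x ∈ S})
      (measurable_jumpCounts _ hS), poissonMeasure_singleton, Real.coe_toNNReal _ hT]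
  simp

lemma expSeq_jumpCount_succ_and {T : ℝ} (hT : 0 ≤ T) {t : ℕ → ℝ} (ht : ∀ k, T ≤ t k)
    {S : Set (ℕ → ℕ)} (hS : MeasurableSet S) (n : ℕ) :
    expSeq {x | jumpCount 0 T x ∈ ({n + 1} : Set ℕ) ∧ jumpCounts t x ∈ S} =
      ∫⁻ a in Set.Ioc 0 T, ENNReal.ofReal (Real.exp (-a)) *
        expSeq {x | jumpCount 0 (T - a) x ∈ ({n} : Set ℕ) ∧
          jumpCounts (fun k => t k - a) x ∈ S} := by
  have hearly : ∀ a ∈ Set.Ioc 0 T, ENNReal.ofReal (Real.exp (-a)) * expSeq {x | consSeq a x ∈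
      {x | jumpCount 0 T x ∈ ({n + 1} : Set ℕ) ∧ jumpCounts t x ∈ S}} =
      ENNReal.ofReal (Real.exp (-a)) * expSeq {x | jumpCount 0 (T - a) x ∈ ({n} : Set ℕ) ∧
        jumpCounts (fun k => t k - a) x ∈ S} := by
    intro a ha
    congr 1
    refine measure_congr ?_
    filter_upwards [ae_expSeq_pos, ae_tendsto_jumpTime_expSeq] with x hx hx_tendsto
    refine propext (and_congr ?_ ?_)
    · rw [jumpCount_consSeq_of_mem ha hx_tendsto, zero_sub,
        jumpCount_eq_of_nonpos hx (neg_nonpos.2 ha.1.le)]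
      exact Nat.succ_inj
    · rw [jumpCounts_consSeq_of_le fun k => ha.2.trans (ht k)]
  have hlate : ∀ b ∈ Set.Ioi (0 : ℝ), ENNReal.ofReal (Real.exp (-b)) *
      expSeq {x | consSeq (b + T) x ∈
        {x | jumpCount 0 T x ∈ ({n + 1} : Set ℕ) ∧ jumpCounts t x ∈ S}} = 0 := by
    intro b hb
    refine mul_eq_zero_of_right _ (measure_eq_zero_iff_ae_notMem.2 ?_)
    filter_upwards [ae_expSeq_pos] with x hx hmem
    have hsucc : jumpCount 0 T (consSeq (b + T) x) = n + 1 := hmem.1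
    rw [jumpCount_consSeq_eq_zero hx (lt_add_of_pos_left T hb)] at hsucc
    exact Nat.succ_ne_zero _ hsucc.symm
  rw [expSeq_eq_add_lintegral_consSeq hT (measurableSet_jumpCount_and hS),
    setLIntegral_congr_fun measurableSet_Ioi hlate, lintegral_zero, mul_zero, add_zero,
    setLIntegral_congr_fun measurableSet_Ioc hearly]

lemma expSeq_jumpCount_singleton_and (n : ℕ) {T : ℝ} (hT : 0 ≤ T) {t : ℕ → ℝ}
    (ht : ∀ k, T ≤ t k) {S : Set (ℕ → ℕ)} (hS : MeasurableSet S) :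
    expSeq {x | jumpCount 0 T x ∈ ({n} : Set ℕ) ∧ jumpCounts t x ∈ S} =
      poissonMeasure T.toNNReal {n} * expSeq {x | jumpCounts (fun k => t k - T) x ∈ S} := by
  induction n generalizing T t with
  | zero => exact expSeq_jumpCount_zero_and hT t hS
  | succ n ih =>
    have hstep : ∀ a ∈ Set.Ioc 0 T, ENNReal.ofReal (Real.exp (-a)) *
        expSeq {x | jumpCount 0 (T - a) x ∈ ({n} : Set ℕ) ∧ jumpCounts (fun k => t k - a) x ∈ S} =
        ENNReal.ofReal (Real.exp (-a)) * poissonMeasure (T - a).toNNReal {n} *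
          expSeq {x | jumpCounts (fun k => t k - T) x ∈ S} := by
      intro a ha
      rw [ih (sub_nonneg.2 ha.2) fun k => sub_le_sub_right (ht k) a, mul_assoc]
      simp only [sub_sub_sub_cancel_right]
    rw [expSeq_jumpCount_succ_and hT ht hS, setLIntegral_congr_fun measurableSet_Ioc hstep,
      lintegral_mul_const' _ _ (measure_ne_top _ _), lintegral_exp_mul_poissonMeasure hT]

/-- Memorylessness: the process restarts afresh at time `T`. -/
lemma expSeq_jumpCount_and {T : ℝ} (hT : 0 ≤ T) {t : ℕ → ℝ} (ht : ∀ k, T ≤ t k) (B : Set ℕ)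
    {S : Set (ℕ → ℕ)} (hS : MeasurableSet S) :
    expSeq {x | jumpCount 0 T x ∈ B ∧ jumpCounts t x ∈ S} =
      poissonMeasure T.toNNReal B * expSeq {x | jumpCounts (fun k => t k - T) x ∈ S} := by
  have hlaw : (expSeq.restrict {x | jumpCounts t x ∈ S}).map (jumpCount 0 T) =
      expSeq {x | jumpCounts (fun k => t k - T) x ∈ S} • poissonMeasure T.toNNReal := by
    refine Measure.ext_of_singleton fun n => ?_
    rw [Measure.map_apply (by fun_prop) .of_discrete, Measure.restrict_apply
      (measurable_jumpCount 0 T .of_discrete), Measure.smul_apply, smul_eq_mul, mul_comm]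
    exact expSeq_jumpCount_singleton_and n hT ht hS
  rw [mul_comm, ← smul_eq_mul, ← Measure.smul_apply, ← hlaw,
    Measure.map_apply (by fun_prop) .of_discrete,
    Measure.restrict_apply (measurable_jumpCount 0 T .of_discrete)]
  rfl

lemma expSeq_jumpCounts_sub {T : ℝ} (hT : 0 ≤ T) {t : ℕ → ℝ} (ht : ∀ k, T ≤ t k)
    {S : Set (ℕ → ℕ)} (hS : MeasurableSet S) :
    expSeq {x | jumpCounts (fun k => t k - T) x ∈ S} = expSeq {x | jumpCounts t x ∈ S} := by
  simpa using (expSeq_jumpCount_and hT ht Set.univ hS).symm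

lemma expSeq_jumpCounts_mem_pi (n : ℕ) {t : ℕ → ℝ} (ht_zero : 0 ≤ t 0) (ht : Monotone t)
    (B : ℕ → Set ℕ) :
    expSeq {x | jumpCounts t x ∈ (Finset.range n : Set ℕ).pi B} =
      ∏ k ∈ Finset.range n, poissonMeasure (t (k + 1) - t k).toNNReal (B k) := by
  have hbox (n : ℕ) (B : ℕ → Set ℕ) : MeasurableSet ((Finset.range n : Set ℕ).pi B) :=
    .pi (Finset.countable_toSet _) fun _ _ => .of_discrete
  induction n generalizing t B with
  | zero => simp
  | succ n ih =>
    have hle (k : ℕ) : t 1 ≤ t (k + 1) := ht (Nat.succ_le_succ (Nat.zero_le k))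
    have hrestart := expSeq_jumpCount_and (sub_nonneg.2 (ht zero_le_one))
      (fun k => sub_le_sub_right (hle k) (t 0)) (B 0) (hbox n fun k => B (k + 1))
    simp only [sub_sub_sub_cancel_right] at hrestart
    rw [← expSeq_jumpCounts_sub ht_zero (fun k => ht (Nat.zero_le k)) (hbox _ _)]
    simp only [mem_pi_range_succ, jumpCounts, zero_add, sub_self]
    rw [Finset.prod_range_succ', mul_comm,
      ← ih (t := fun k => t (k + 1)) (ht_zero.trans (ht zero_le_one))
        (fun i j hij => ht (Nat.succ_le_succ hij)),
      ← expSeq_jumpCounts_sub (ht_zero.trans (ht zero_le_one)) hle (hbox _ _)]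
    exact hrestart

lemma map_jumpCounts_expSeq {t : ℕ → ℝ} (ht_zero : 0 ≤ t 0) (ht : Monotone t) :
    expSeq.map (jumpCounts t) =
      Measure.infinitePi fun k => poissonMeasure (t (k + 1) - t k).toNNReal := by
  refine eq_infinitePi_of_range fun n B hB => ?_
  rw [Measure.map_apply (by fun_prop) (.pi (Finset.countable_toSet _) fun k _ => hB k)]
  exact expSeq_jumpCounts_mem_pi n ht_zero ht B

/-! ### The Poisson process of rate `t` at time `t` -/

/-- The inter-jump times of the process of rate `t` at time `t` whose `k`-th jump time is
`√(2 s)`, where `s` is the `k`-th jump time of the process with inter-jump times `e`. -/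
def rateGaps (e : ℕ → ℝ) : ℕ → ℝ
  | 0 => √(2 * jumpTime e 0)
  | k + 1 => √(2 * jumpTime e (k + 1)) - √(2 * jumpTime e k)

@[fun_prop]
lemma measurable_rateGaps : Measurable rateGaps := by
  refine measurable_pi_lambda _ fun k => ?_
  cases k <;> simp only [rateGaps] <;> fun_prop

lemma jumpTime_rateGaps (e : ℕ → ℝ) (k : ℕ) : jumpTime (rateGaps e) k = √(2 * jumpTime e k) := by
  induction k with
  | zero => simp [jumpTime, rateGaps]
  | succ k ih => rw [jumpTime_succ, ih, rateGaps, add_sub_cancel]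

lemma rateGaps_pos {e : ℕ → ℝ} (he : ∀ k, 0 < e k) : ∀ k, 0 < rateGaps e k
  | 0 => Real.sqrt_pos.2 (mul_pos two_pos (jumpTime_pos he 0))
  | k + 1 => by
    rw [rateGaps, sub_pos, jumpTime_succ]
    exact Real.sqrt_lt_sqrt (mul_nonneg zero_le_two (jumpTime_pos he k).le)
      (by linarith [he (k + 1)])

lemma jumpCount_rateGaps (e : ℕ → ℝ) {s t : ℝ} (hs : 0 ≤ s) (ht : 0 ≤ t) :
    jumpCount s t (rateGaps e) = jumpCount (s ^ 2 / 2) (t ^ 2 / 2) e := by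
  simp only [jumpCount, Set.mem_Ioc, jumpTime_rateGaps, Real.lt_sqrt hs, Real.sqrt_le_left ht,
    div_lt_iff₀' (zero_lt_two' ℝ), le_div_iff₀' (zero_lt_two' ℝ)]

/-- The law of the inter-jump times of the Poisson process of rate `t` at time `t`, obtained from
the one of unit rate by the change of time `t ↦ √(2 t)`. -/
def rateLaw : Measure (ℕ → ℝ) := expSeq.map rateGaps

instance : IsProbabilityMeasure rateLaw :=
  Measure.isProbabilityMeasure_map measurable_rateGaps.aemeasurable

lemma ae_rateLaw_pos : ∀ᵐ x ∂rateLaw, ∀ k, 0 < x k := by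
  have hmeas : MeasurableSet {x : ℕ → ℝ | ∀ k, 0 < x k} := by
    simp only [Set.ofPred_forall]
    exact .iInter fun k => measurableSet_lt measurable_const (measurable_pi_apply k)
  rw [rateLaw, ae_map_iff measurable_rateGaps.aemeasurable hmeas]
  filter_upwards [ae_expSeq_pos] with e he using rateGaps_pos he

lemma ae_tendsto_jumpTime_rateLaw : ∀ᵐ x ∂rateLaw, Tendsto (jumpTime x) atTop atTop := by
  have hmeas : MeasurableSet {x : ℕ → ℝ | Tendsto (jumpTime x) atTop atTop} :=
    measurableSet_tendsto atTop fun k => measurable_jumpTime k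
  rw [rateLaw, ae_map_iff measurable_rateGaps.aemeasurable hmeas]
  filter_upwards [ae_tendsto_jumpTime_expSeq] with e he
  rw [funext (jumpTime_rateGaps e)]
  exact Real.tendsto_sqrt_atTop.comp (he.const_mul_atTop two_pos)

lemma map_jumpCounts_rateLaw {t : ℕ → ℝ} (ht_zero : 0 ≤ t 0) (ht : Monotone t) :
    rateLaw.map (jumpCounts t) =
      Measure.infinitePi fun k => poissonMeasure (∫ u in t k..t (k + 1), u).toNNReal := by
  have ht_nonneg (k : ℕ) : 0 ≤ t k := ht_zero.trans (ht (Nat.zero_le k))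
  have hcounts : jumpCounts t ∘ rateGaps = jumpCounts fun k => t k ^ 2 / 2 :=
    funext fun e => funext fun k => jumpCount_rateGaps e (ht_nonneg _) (ht_nonneg _)
  have hmono : Monotone fun k => t k ^ 2 / 2 := fun i j hij =>
    div_le_div_of_nonneg_right (pow_le_pow_left₀ (ht_nonneg i) (ht hij) 2) zero_le_two
  rw [rateLaw, Measure.map_map (by fun_prop) (by fun_prop), hcounts,
    map_jumpCounts_expSeq (by positivity) hmono]
  simp only [integral_id, sub_div]

lemma hasLaw_jumpCount_rateLaw {t : ℕ → ℝ} (ht_zero : 0 ≤ t 0) (ht : Monotone t) (k : ℕ) :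
    HasLaw (jumpCount (t k) (t (k + 1)))
      (poissonMeasure (∫ u in t k..t (k + 1), u).toNNReal) rateLaw := by
  refine ⟨by fun_prop, ?_⟩
  rw [← Measure.infinitePi_map_eval
      (fun k => poissonMeasure (∫ u in t k..t (k + 1), u).toNNReal) k,
    ← map_jumpCounts_rateLaw ht_zero ht, Measure.map_map (by fun_prop) (by fun_prop)]
  rfl

lemma isPoissonInterJumpLaw_rateLaw : IsPoissonInterJumpLaw (fun t => t) rateLaw where
  isProbabilityMeasure := inferInstance
  pos := ae_rateLaw_pos
  tendsto_jumpTime := ae_tendsto_jumpTime_rateLaw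
  hasLaw_jumpCount s t hs hst := by
    have hmono : Monotone fun k => if k = 0 then s else t := by
      refine monotone_nat_of_le_succ fun k => ?_
      by_cases hk : k = 0 <;> simp [hk, hst]
    simpa using hasLaw_jumpCount_rateLaw (by simpa using hs) hmono 0
  indep_jumpCount t ht_zero ht := by
    rw [iIndepFun_iff_map_fun_eq_infinitePi_map fun k => measurable_jumpCount _ _]
    simp only [(hasLaw_jumpCount_rateLaw ht_zero ht _).map_eq]
    exact map_jumpCounts_rateLaw ht_zero ht

/-! ### Long-run behavior of the clock-driven urn -/

lemma ae_tendsto_count_categorical {p : Fin (d + 1) → ℝ} (hp : ∀ i, 0 ≤ p i)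
    (hsum : ∑ i, p i = 1) :
    ∀ᵐ c ∂(Measure.infinitePi fun _ : ℕ => categorical p), ∀ i,
      Tendsto (fun n : ℕ => (Nat.count (c · = i) n : ℝ) / n) atTop (𝓝 (p i)) := by
  refine ae_all_iff.2 fun i => ?_
  have hmeas : Measurable (Set.indicator ({i} : Set (Fin (d + 1))) (1 : Fin (d + 1) → ℝ)) :=
    measurable_one.indicator (measurableSet_singleton i)
  have haverage := ae_tendsto_average_infinitePi (ρ := categorical p) hmeas
    (Integrable.of_finite (f := Set.indicator {i} 1))
  rw [integral_indicator_one (measurableSet_singleton i),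
    categorical_real_singleton hp hsum] at haverage
  filter_upwards [haverage] with c hc
  simpa [Nat.count_eq_card_filter_range, Set.indicator_apply, Finset.sum_boole] using hc

lemma tendsto_count_atTop {c : ℕ → Fin (d + 1)} {i : Fin (d + 1)} {r : ℝ} (hr : 0 < r)
    (hcount : Tendsto (fun n : ℕ => (Nat.count (c · = i) n : ℝ) / n) atTop (𝓝 r)) :
    Tendsto (Nat.count (c · = i)) atTop atTop := by
  refine (tendsto_natCast_atTop_iff (R := ℝ)).1
    ((hcount.pos_mul_atTop hr tendsto_natCast_atTop_atTop).congr' ?_)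
  filter_upwards [eventually_ne_atTop 0] with n hn
  exact div_mul_cancel₀ _ (Nat.cast_ne_zero.2 hn)

lemma infinite_of_tendsto_count_atTop {q : ℕ → Prop} [DecidablePred q]
    (hcount : Tendsto (Nat.count q) atTop atTop) : {n | q n}.Infinite := by
  intro hfinite
  obtain ⟨n, hn⟩ := (hcount.eventually_gt_atTop hfinite.toFinset.card).exists
  refine hn.not_ge ?_
  rw [Nat.count_eq_card_filter_range]
  exact Finset.card_le_card fun k hk => by simpa using (Finset.mem_filter.1 hk).2

lemma tendsto_proportion_of_tendsto_div_sqrt {p : Fin (d + 1) → ℝ} (hsum : ∑ i, p i = 1)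
    {z : UrnPath d} {r : ℝ} (hr : r ≠ 0)
    (hL : ∀ i, Tendsto (fun n : ℕ => UrnPath.L n z i / √n) atTop (𝓝 (r * p i))) :
    Tendsto (fun n => proportion UrnPath.L n z) atTop (𝓝 p) := by
  have htotal : Tendsto (fun n : ℕ => total UrnPath.L n z / √n) atTop (𝓝 r) := by
    have hsum_lim := tendsto_finsetSum Finset.univ fun i _ => hL i
    rw [← Finset.mul_sum, hsum, mul_one] at hsum_lim
    simpa only [total, Finset.sum_div] using hsum_lim
  refine tendsto_pi_nhds.2 fun i => ?_
  have hratio := (hL i).div htotal hr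
  rw [mul_div_cancel_left₀ _ hr] at hratio
  refine hratio.congr' ?_
  filter_upwards [eventually_gt_atTop 0] with n hn
  have hsqrt : (0 : ℝ) < √n := Real.sqrt_pos.2 (Nat.cast_pos.2 hn)
  exact div_div_div_cancel_right₀ hsqrt.ne' _ _

lemma tendsto_L_clockPath_div_sqrt {p : Fin (d + 1) → ℝ} {c : ℕ → Fin (d + 1)}
    {e : Fin (d + 1) → ℕ → ℝ} {i : Fin (d + 1)} (hp : 0 < p i)
    (hcount : Tendsto (fun n : ℕ => (Nat.count (c · = i) n : ℝ) / n) atTop (𝓝 (p i)))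
    (hclock : Tendsto (fun k => jumpTime (e i) k / (k + 1)) atTop (𝓝 1)) :
    Tendsto (fun n : ℕ => UrnPath.L n (clockPath p c e) i / √n) atTop (𝓝 (√2 * p i)) := by
  have hcount_succ :
      Tendsto (fun n : ℕ => ((Nat.count (c · = i) n : ℝ) + 1) / n) atTop (𝓝 (p i)) := by
    simpa only [add_div, add_zero] using hcount.add tendsto_one_div_atTop_nhds_zero_nat
  have htime : Tendsto (fun n : ℕ => jumpTime (e i) (Nat.count (c · = i) n) / n) atTop
      (𝓝 (p i)) := by
    have hmul := (hclock.comp (tendsto_count_atTop hp hcount)).mul hcount_succ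
    rw [one_mul] at hmul
    exact hmul.congr fun n => div_mul_div_cancel₀ (by positivity)
  have hsqrt := (htime.const_mul (2 * p i)).sqrt
  rw [mul_assoc, Real.sqrt_mul zero_le_two, Real.sqrt_mul_self hp.le] at hsqrt
  refine hsqrt.congr fun n => ?_
  rw [L_clockPath, ← mul_div_assoc, Real.sqrt_div' _ n.cast_nonneg]

section

variable {p : Fin (d + 1) → ℝ} (hp : ∀ i, 0 < p i) (hsum : ∑ i, p i = 1)
include hp hsum

lemma ae_noiseKernel_tendsto_count :
    ∀ᵐ w ∂(noiseKernel p), ∀ i,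
      Tendsto (fun n : ℕ => (Nat.count (w.1 · = i) n : ℝ) / n) atTop (𝓝 (p i)) := by
  have hcount := ae_tendsto_count_categorical (fun i => (hp i).le) hsum
  rw [← map_fst_noiseKernel] at hcount
  exact ae_of_ae_map measurable_fst.aemeasurable hcount

lemma ae_noiseKernel_infinite : ∀ᵐ w ∂(noiseKernel p), ∀ i, {n | w.1 n = i}.Infinite := by
  filter_upwards [ae_noiseKernel_tendsto_count hp hsum] with w hw i
  exact infinite_of_tendsto_count_atTop (tendsto_count_atTop (hp i) (hw i))

lemma ae_pathKernel_tendsto_proportion :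
    ∀ᵐ z ∂(pathKernel p), Tendsto (fun n => proportion UrnPath.L n z) atTop (𝓝 p) := by
  have hclock : ∀ᵐ w ∂(noiseKernel p), ∀ i,
      Tendsto (fun k => jumpTime (w.2 i) k / (k + 1)) atTop (𝓝 1) := by
    refine ae_all_iff.2 fun i => ?_
    have hclock := ae_tendsto_jumpTime_div_expSeq
    rw [← Measure.infinitePi_map_eval (fun _ : Fin (d + 1) => expSeq) i,
      ← map_snd_noiseKernel p, Measure.map_map (by fun_prop) (by fun_prop)] at hclock
    exact ae_of_ae_map (by fun_prop) hclock
  rw [pathKernel_apply, ae_map_iff (by fun_prop)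
    (measurableSet_tendsto_fun (fun n => by fun_prop) measurable_const)]
  filter_upwards [ae_noiseKernel_tendsto_count hp hsum, hclock] with w hcount hclock
  exact tendsto_proportion_of_tendsto_div_sqrt hsum (by positivity)
    fun i => tendsto_L_clockPath_div_sqrt (hp i) (hcount i) (hclock i)

end

lemma UrnPath.measurableSet_infinite :
    MeasurableSet {z : UrnPath d | ∀ i, {n | UrnPath.I n z = i}.Infinite} := by
  simp only [← Nat.frequently_atTop_iff_infinite, Filter.frequently_atTop]
  measurability

/-! ### The additions to each color -/

lemma nth_eq_iff_of_ne_zero {q : ℕ → Prop} [DecidablePred q] {k n : ℕ} (hn : n ≠ 0) :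
    Nat.nth q k = n ↔ q n ∧ Nat.count q n = k := by
  constructor
  · rintro rfl
    exact ⟨Nat.nth_mem_of_ne_zero hn, Nat.count_nth (Nat.lt_card_toFinset_of_nth_ne_zero hn)⟩
  · rintro ⟨hq, rfl⟩
    exact Nat.nth_count hq

lemma measurable_nth_eq (i : Fin (d + 1)) (k : ℕ) :
    Measurable fun c : ℕ → Fin (d + 1) => Nat.nth (c · = i) k := by
  have hne (n : ℕ) (hn : n ≠ 0) :
      MeasurableSet ((fun c : ℕ → Fin (d + 1) => Nat.nth (c · = i) k) ⁻¹' {n}) := by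
    have hpre : (fun c : ℕ → Fin (d + 1) => Nat.nth (c · = i) k) ⁻¹' {n} =
        (fun c => c n) ⁻¹' {i} ∩ (fun c => Nat.count (c · = i) n) ⁻¹' {k} :=
      Set.ext fun c => nth_eq_iff_of_ne_zero hn
    rw [hpre]
    exact (measurable_pi_apply n (measurableSet_singleton i)).inter
      (measurable_count i n (measurableSet_singleton k))
  refine measurable_to_countable' fun n => ?_
  rcases eq_or_ne n 0 with rfl | hn
  · have hpre : (fun c : ℕ → Fin (d + 1) => Nat.nth (c · = i) k) ⁻¹' {0} =
        (⋃ n, ⋃ (_ : n ≠ 0), (fun c : ℕ → Fin (d + 1) => Nat.nth (c · = i) k) ⁻¹' {n})ᶜ := by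
      ext c
      simp only [Set.mem_preimage, Set.mem_singleton_iff, Set.mem_compl_iff, Set.mem_iUnion]
      grind
    rw [hpre]
    exact (MeasurableSet.iUnion fun n => .iUnion (hne n)).compl
  · exact hne n hn

@[fun_prop]
lemma UrnPath.measurable_colorAdditions (i : Fin (d + 1)) :
    Measurable (colorAdditions UrnPath.L UrnPath.I UrnPath.A i) := by
  refine measurable_pi_lambda _ fun k => ?_
  cases k with
  | zero => exact (measurable_pi_apply i).comp (UrnPath.measurable_L 0)
  | succ k =>
    have hnth : Measurable fun z : UrnPath d => Nat.nth (UrnPath.I · z = i) k :=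
      (measurable_nth_eq i k).comp
        (measurable_pi_lambda (fun z n => UrnPath.I n z) UrnPath.measurable_I)
    exact measurable_eval_of_countable (f := fun z n => UrnPath.A n z) UrnPath.measurable_A hnth

lemma colorAdditions_clockPath {p : Fin (d + 1) → ℝ} {c : ℕ → Fin (d + 1)}
    (e : Fin (d + 1) → ℕ → ℝ) {i : Fin (d + 1)} (hp : 0 ≤ p i) (hc : {n | c n = i}.Infinite) :
    colorAdditions UrnPath.L UrnPath.I UrnPath.A i (clockPath p c e) =
      fun k => √(p i) * rateGaps (e i) k := by
  have hscale (t : ℝ) : √(2 * p i * t) = √(p i) * √(2 * t) := by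
    rw [mul_comm 2, mul_assoc, Real.sqrt_mul hp]
  ext k
  cases k with
  | zero => exact hscale _
  | succ k =>
    have hcolor : c (Nat.nth (c · = i) k) = i := Nat.nth_mem_of_infinite hc k
    have hcount : Nat.count (c · = i) (Nat.nth (c · = i) k) = k := Nat.count_nth_of_infinite hc k
    change ((clockPath p c e).2 (Nat.nth (c · = i) k)).2 = _
    simp only [clockPath, hcolor, hcount, hscale, rateGaps, mul_sub]

lemma map_scaled_rateGaps (p : Fin (d + 1) → ℝ) :
    (Measure.infinitePi fun _ : Fin (d + 1) => expSeq).map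
        (fun e i k => √(p i) * rateGaps (e i) k) =
      Measure.infinitePi fun i => rateLaw.map fun x k => √(p i) * x k := by
  rw [Measure.infinitePi_map_pi (fun _ : Fin (d + 1) => expSeq)
    (f := fun i (x : ℕ → ℝ) (k : ℕ) => √(p i) * rateGaps x k) fun i => by fun_prop]
  refine congrArg _ (funext fun i => ?_)
  rw [rateLaw, Measure.map_map (by fun_prop) measurable_rateGaps]
  rfl

lemma map_colorAdditions_pathKernel {p : Fin (d + 1) → ℝ} (hp : ∀ i, 0 < p i)
    (hsum : ∑ i, p i = 1) :
    (pathKernel p).map (fun z i => colorAdditions UrnPath.L UrnPath.I UrnPath.A i z) =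
      Measure.infinitePi fun i => rateLaw.map fun x k => √(p i) * x k := by
  rw [← map_scaled_rateGaps, ← map_snd_noiseKernel p, pathKernel_apply,
    Measure.map_map (by fun_prop) (by fun_prop), Measure.map_map (by fun_prop) measurable_snd]
  refine Measure.map_congr ?_
  filter_upwards [ae_noiseKernel_infinite hp hsum] with w hw
  exact funext fun i => colorAdditions_clockPath w.2 (hp i).le (hw i)

lemma map_index_pathKernel (p : Fin (d + 1) → ℝ) :
    (pathKernel p).map (fun z n => UrnPath.I n z) = Measure.infinitePi fun _ => categorical p := by
  rw [← map_fst_noiseKernel, pathKernel_apply, Measure.map_map (by fun_prop) (by fun_prop)]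
  rfl

/-! ### Conditioning on the limiting proportions -/

section Recovery

variable {Ω 𝓧 𝓨 : Type*} [MeasurableSpace Ω] [MeasurableSpace 𝓧] [MeasurableSpace 𝓨]

lemma map_prodMk_comp_of_ae_eq [MeasurableEq 𝓧] {ρ : Measure 𝓧} [SFinite ρ]
    {κ : Kernel 𝓧 𝓨} [IsSFiniteKernel κ] {g : 𝓨 → 𝓧} (hg : Measurable g)
    (hg_eq : ∀ᵐ x ∂ρ, ∀ᵐ y ∂(κ x), g y = x) :
    (κ ∘ₘ ρ).map (fun y => (g y, y)) = ρ ⊗ₘ κ := by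
  have hpair : (fun z : 𝓧 × 𝓨 => (g z.2, z.2)) =ᵐ[ρ ⊗ₘ κ] id := by
    filter_upwards [Measure.ae_compProd_of_ae_ae
      (measurableSet_eq_fun (hg.comp measurable_snd) measurable_fst) hg_eq] with z hz
    exact Prod.ext hz rfl
  rw [← Measure.snd_compProd, Measure.snd, Measure.map_map (by fun_prop) measurable_snd]
  exact (Measure.map_congr hpair).trans Measure.map_id

section

variable {ι 𝓩 : Type*} [MeasurableSpace 𝓩] {μ : Measure Ω} [IsFiniteMeasure μ]
  [StandardBorelSpace 𝓨] [Nonempty 𝓨] {X : Ω → 𝓧} {Y : Ω → 𝓨} {κ : Kernel 𝓧 𝓨} [IsFiniteKernel κ]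
  {W : ι → 𝓨 → 𝓩} {ν : ι → 𝓧 → Measure 𝓩} [∀ i x, IsProbabilityMeasure (ν i x)]
  (hX : Measurable X) (hY : Measurable Y) (hκ : HasCondDistrib Y X κ μ)
  (hW : ∀ i, Measurable (W i))
  (hν : ∀ᵐ ω ∂μ, (κ (X ω)).map (fun y i => W i y) = Measure.infinitePi fun i => ν i (X ω))
include hX hY hκ hW hν

lemma condExp_biInter_of_map_eq_infinitePi (S : Finset ι) {B : ι → Set 𝓩}
    (hB : ∀ i, MeasurableSet (B i)) :
    μ⟦⋂ i ∈ S, (fun ω => W i (Y ω)) ⁻¹' B i | MeasurableSpace.comap X inferInstance⟧ =ᵐ[μ]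
      fun ω => ∏ i ∈ S, (ν i (X ω)).real (B i) := by
  have hbox : MeasurableSet ((S : Set ι).pi B) := .pi S.countable_toSet fun i _ => hB i
  have hpre : ⋂ i ∈ S, (fun ω => W i (Y ω)) ⁻¹' B i =
      Y ⁻¹' ((fun y i => W i y) ⁻¹' (S : Set ι).pi B) := by
    ext ω
    simp [Set.mem_pi]
  rw [hpre]
  refine (condExp_of_hasCondDistrib hX hY hκ (measurable_pi_lambda _ hW hbox)).trans ?_
  filter_upwards [hν] with ω hω
  rw [← map_measureReal_apply (measurable_pi_lambda _ hW) hbox, hω, measureReal_def,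
    Measure.infinitePi_pi _ fun i _ => hB i, ENNReal.toReal_prod]
  rfl

lemma hasCondLaw_of_map_eq_infinitePi (i : ι) :
    HasCondLaw (fun ω => W i (Y ω)) X (fun ω => ν i (X ω)) μ := fun B hB => by
  simpa using condExp_biInter_of_map_eq_infinitePi hX hY hκ hW hν {i} fun _ => hB

lemma condIndepFamily_of_map_eq_infinitePi :
    CondIndepFamily (fun i ω => W i (Y ω)) X μ := fun S B hB => by
  have hmarginal : ∀ᵐ ω ∂μ, ∀ i ∈ S,
      (μ⟦(fun ω => W i (Y ω)) ⁻¹' B i | MeasurableSpace.comap X inferInstance⟧) ω =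
        (ν i (X ω)).real (B i) :=
    (eventually_all_finset S).2 fun i _ =>
      hasCondLaw_of_map_eq_infinitePi hX hY hκ hW hν i (B i) (hB i)
  filter_upwards [condExp_biInter_of_map_eq_infinitePi hX hY hκ hW hν S hB, hmarginal]
    with ω hω hω_marginal
  rw [hω, Finset.prod_congr rfl hω_marginal]

end

end Recovery

/-- The limiting proportions along a path. The upper limit makes sense of them on every path, in a
measurable way. -/
def limitProportion (z : UrnPath d) (i : Fin (d + 1)) : ℝ :=
  limsup (fun n => proportion UrnPath.L n z i) atTop

@[fun_prop]
lemma measurable_limitProportion : Measurable (limitProportion (d := d)) :=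
  measurable_pi_lambda _ fun i => .limsup fun n =>
    (measurable_pi_apply i).comp (UrnPath.measurable_proportion n)

lemma limitProportion_eq {z : UrnPath d} {p : Fin (d + 1) → ℝ}
    (hz : Tendsto (fun n => proportion UrnPath.L n z) atTop (𝓝 p)) : limitProportion z = p :=
  funext fun i => (tendsto_pi_nhds.1 hz i).limsup_eq

instance (c : ℝ) : IsProbabilityMeasure (rateLaw.map fun x k => c * x k) :=
  Measure.isProbabilityMeasure_map
    (measurable_pi_lambda _ fun k => (measurable_pi_apply k).const_mul c).aemeasurable

lemma colorAdditions_pathOf {Ω : Type*} (L : ℕ → Ω → Fin (d + 1) → ℝ) (I : ℕ → Ω → Fin (d + 1))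
    (A : ℕ → Ω → ℝ) :
    (fun i ω => colorAdditions UrnPath.L UrnPath.I UrnPath.A i (pathOf L I A ω)) =
      colorAdditions L I A := by
  ext i ω k
  cases k <;> rfl

namespace IsContinuousUrn

variable {Ω : Type*} [MeasurableSpace Ω] {μ : Measure Ω}
  {L : ℕ → Ω → Fin (d + 1) → ℝ} {I : ℕ → Ω → Fin (d + 1)} {A : ℕ → Ω → ℝ}

lemma measurable_limitProportion_pathOf (h : IsContinuousUrn L I A μ) :
    Measurable fun ω => limitProportion (pathOf L I A ω) :=
  measurable_limitProportion.comp h.measurable_pathOf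

variable [IsProbabilityMeasure μ]

lemma ae_pathOf_of_ae_pathKernel (h : IsContinuousUrn L I A μ) {q : UrnPath d → Prop}
    (hq_meas : MeasurableSet {z | q z})
    (hq : ∀ p : Fin (d + 1) → ℝ, (∀ i, 0 < p i) → ∑ i, p i = 1 → ∀ᵐ z ∂(pathKernel p), q z) :
    ∀ᵐ ω ∂μ, q (pathOf L I A ω) := by
  refine ae_of_ae_map h.measurable_pathOf.aemeasurable ?_
  rw [h.map_pathOf]
  refine Measure.ae_comp_of_ae_ae hq_meas ?_
  filter_upwards [ae_dirichletMeasure_pos _] with p hp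
  exact hq p hp.1 hp.2

lemma ae_tendsto_proportion (h : IsContinuousUrn L I A μ) :
    ∀ᵐ ω ∂μ, Tendsto (fun n => proportion L n ω) atTop (𝓝 (limitProportion (pathOf L I A ω))) := by
  have hpath := h.ae_pathOf_of_ae_pathKernel
    (q := fun z => Tendsto (fun n => proportion UrnPath.L n z) atTop (𝓝 (limitProportion z)))
    (measurableSet_tendsto_fun UrnPath.measurable_proportion measurable_limitProportion)
    fun p hp hsum => by
      filter_upwards [ae_pathKernel_tendsto_proportion hp hsum] with z hz
      rwa [limitProportion_eq hz]
  filter_upwards [hpath] with ω hω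
  refine hω.congr fun n => ?_
  ext i
  simp only [proportion, total, h.L_pathOf]

lemma ae_infinite (h : IsContinuousUrn L I A μ) : ∀ᵐ ω ∂μ, ∀ i, {n | I n ω = i}.Infinite :=
  h.ae_pathOf_of_ae_pathKernel (q := fun z => ∀ i, {n | UrnPath.I n z = i}.Infinite)
    UrnPath.measurableSet_infinite fun p hp hsum => by
      rw [pathKernel_apply, ae_map_iff (by fun_prop) UrnPath.measurableSet_infinite]
      exact ae_noiseKernel_infinite hp hsum

lemma map_limitProportion_pathOf (h : IsContinuousUrn L I A μ) :
    μ.map (fun ω => (limitProportion (pathOf L I A ω), pathOf L I A ω)) =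
      (dirichletMeasure fun _ => 1 / 2) ⊗ₘ pathKernel := by
  have := h.isProbabilityMeasure_dirichletMeasure_half
  rw [← map_prodMk_comp_of_ae_eq measurable_limitProportion, ← h.map_pathOf,
    Measure.map_map (by fun_prop) h.measurable_pathOf]
  · rfl
  · filter_upwards [ae_dirichletMeasure_pos _] with p hp
    filter_upwards [ae_pathKernel_tendsto_proportion hp.1 hp.2] with z hz
    exact limitProportion_eq hz

lemma hasLaw_limitProportion (h : IsContinuousUrn L I A μ) :
    HasLaw (fun ω => limitProportion (pathOf L I A ω)) (dirichletMeasure fun _ => 1 / 2) μ := by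
  have := h.isProbabilityMeasure_dirichletMeasure_half
  refine ⟨h.measurable_limitProportion_pathOf.aemeasurable, ?_⟩
  rw [← Measure.fst_compProd (dirichletMeasure fun _ => 1 / 2) (pathKernel (d := d)),
    ← h.map_limitProportion_pathOf, Measure.fst_map_prodMk h.measurable_pathOf]

lemma hasCondDistrib_pathOf (h : IsContinuousUrn L I A μ) :
    HasCondDistrib (pathOf L I A) (fun ω => limitProportion (pathOf L I A ω)) pathKernel μ where
  aemeasurable :=
    (h.measurable_limitProportion_pathOf.prodMk h.measurable_pathOf).aemeasurable
  map_eq := by rw [h.hasLaw_limitProportion.map_eq, h.map_limitProportion_pathOf]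

lemma ae_limitProportion_pos (h : IsContinuousUrn L I A μ) :
    ∀ᵐ ω ∂μ, (∀ i, 0 < limitProportion (pathOf L I A ω) i) ∧
      ∑ i, limitProportion (pathOf L I A ω) i = 1 :=
  ae_of_ae_map h.measurable_limitProportion_pathOf.aemeasurable
    (h.hasLaw_limitProportion.map_eq ▸ ae_dirichletMeasure_pos _)

lemma condIndepFamily_index (h : IsContinuousUrn L I A μ) :
    CondIndepFamily I (fun ω => limitProportion (pathOf L I A ω)) μ :=
  condIndepFamily_of_map_eq_infinitePi (W := UrnPath.I) (Y := pathOf L I A)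
    (ν := fun _ p => categorical p) h.measurable_limitProportion_pathOf h.measurable_pathOf
    h.hasCondDistrib_pathOf UrnPath.measurable_I (.of_forall fun _ => map_index_pathKernel _)

lemma condExp_index (h : IsContinuousUrn L I A μ) (n : ℕ) (i : Fin (d + 1)) :
    μ⟦I n ⁻¹' {i} | MeasurableSpace.comap (fun ω => limitProportion (pathOf L I A ω))
      inferInstance⟧ =ᵐ[μ] fun ω => limitProportion (pathOf L I A ω) i := by
  refine (hasCondLaw_of_map_eq_infinitePi (W := UrnPath.I) (Y := pathOf L I A)
    (ν := fun _ p => categorical p) h.measurable_limitProportion_pathOf h.measurable_pathOf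
    h.hasCondDistrib_pathOf UrnPath.measurable_I (.of_forall fun _ => map_index_pathKernel _)
    n {i} (measurableSet_singleton i)).trans ?_
  filter_upwards [h.ae_limitProportion_pos] with ω hω
  exact categorical_real_singleton (fun i => (hω.1 i).le) hω.2 i

lemma ae_map_colorAdditions_pathKernel (h : IsContinuousUrn L I A μ) :
    ∀ᵐ ω ∂μ, (pathKernel (limitProportion (pathOf L I A ω))).map
        (fun z i => colorAdditions UrnPath.L UrnPath.I UrnPath.A i z) =
      Measure.infinitePi fun i =>
        rateLaw.map fun x k => √(limitProportion (pathOf L I A ω) i) * x k := by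
  filter_upwards [h.ae_limitProportion_pos] with ω hω
  exact map_colorAdditions_pathKernel hω.1 hω.2

lemma condIndepFamily_colorAdditions (h : IsContinuousUrn L I A μ) :
    CondIndepFamily (colorAdditions L I A) (fun ω => limitProportion (pathOf L I A ω)) μ := by
  rw [← colorAdditions_pathOf]
  exact condIndepFamily_of_map_eq_infinitePi
    (ν := fun i p => rateLaw.map fun x k => √(p i) * x k) h.measurable_limitProportion_pathOf
    h.measurable_pathOf h.hasCondDistrib_pathOf UrnPath.measurable_colorAdditions
    h.ae_map_colorAdditions_pathKernel

lemma hasCondLaw_colorAdditions (h : IsContinuousUrn L I A μ) (i : Fin (d + 1)) :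
    HasCondLaw (colorAdditions L I A i) (fun ω => limitProportion (pathOf L I A ω))
      (fun ω => rateLaw.map fun x k => √(limitProportion (pathOf L I A ω) i) * x k) μ := by
  rw [← colorAdditions_pathOf]
  exact hasCondLaw_of_map_eq_infinitePi
    (ν := fun i p => rateLaw.map fun x k => √(p i) * x k) h.measurable_limitProportion_pathOf
    h.measurable_pathOf h.hasCondDistrib_pathOf UrnPath.measurable_colorAdditions
    h.ae_map_colorAdditions_pathKernel i

end IsContinuousUrn

end ContinuousUrn

end

theorem mainTheorem5 {Ω : Type*} [MeasurableSpace Ω] (μ : Measure Ω) [IsProbabilityMeasure μ]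
    (d : ℕ) (L : ℕ → Ω → Fin (d + 1) → ℝ) (I : ℕ → Ω → Fin (d + 1)) (A : ℕ → Ω → ℝ)
    (hurn : ContinuousUrn.IsContinuousUrn L I A μ) :
    ∃ P : Ω → Fin (d + 1) → ℝ, Measurable P ∧
      -- the proportions converge almost surely to a Dirichlet(1/2, …, 1/2) vector
      (∀ᵐ ω ∂μ, Tendsto (fun n => ContinuousUrn.proportion L n ω) atTop (𝓝 (P ω))) ∧
      HasLaw P (ContinuousUrn.dirichletMeasure fun _ => 1 / 2) μ ∧
      -- given the limit, the chosen colors are i.i.d. with law given by the limit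
      ContinuousUrn.CondIndepFamily I P μ ∧
      (∀ n i, μ⟦I n ⁻¹' {i} | MeasurableSpace.comap P inferInstance⟧ =ᵐ[μ] fun ω => P ω i) ∧
      -- every color is added to infinitely often, and given the limit the sequences of additions
      -- are independent rescaled sequences of inter-jump times
      (∀ᵐ ω ∂μ, ∀ i, {n | I n ω = i}.Infinite) ∧
      ContinuousUrn.CondIndepFamily (ContinuousUrn.colorAdditions L I A) P μ ∧
      ∃ ν : Measure (ℕ → ℝ), ContinuousUrn.IsPoissonInterJumpLaw (fun t => t) ν ∧
        ∀ i, ContinuousUrn.HasCondLaw (ContinuousUrn.colorAdditions L I A i) P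
          (fun ω => ν.map fun x k => √(P ω i) * x k) μ :=
  ⟨fun ω => ContinuousUrn.limitProportion (ContinuousUrn.pathOf L I A ω),
    hurn.measurable_limitProportion_pathOf, hurn.ae_tendsto_proportion, hurn.hasLaw_limitProportion,
    hurn.condIndepFamily_index, hurn.condExp_index, hurn.ae_infinite,
    hurn.condIndepFamily_colorAdditions, ContinuousUrn.rateLaw,
    ContinuousUrn.isPoissonInterJumpLaw_rateLaw, hurn.hasCondLaw_colorAdditions⟩
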